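/- Let $g\ge 0$, $n\ge 1$. Let $A$ be a universal tropical divisor and $\theta$ a universal stability condition of type $(g,n)$: for every stable graph $\Gamma$ of genus $g$ with $n$ legs, functions $A_\Gamma:V(\Gamma)\to\mathbb{Z}$ and $\theta_\Gamma:V(\Gamma)\to\mathbb{R}$, additive under edge contractions and compatible with isomorphisms. (For example $A_\Gamma(v)=k(2g(v)-2+\mathrm{val}(v))-\sum_{i\text{ at }v}a_i$ for integers $k,a_1,\dots,a_n$; this has degree $0$ if $\sum a_i=k(2g-2)$.) Assume that $\theta$ and $A$ have the same degree and that $\theta$ is non-degenerate: $\theta_\Gamma(S)\pm\frac12E(S,S^c)\notin\mathbb{Z}$ for all $\Gamma$ and all $\emptyset\ne S\subsetneq V(\Gamma)$, where $E(S,S^c)$ is the number of edges joining $S$ to its complement. Monoids $M$ are sharp, finitely generated, integral and saturated; $M^{\mathrm{gp}}$ is ordered by $x\le y\iff y-x\in M$, and $M$ is dual to the cone $\mathrm{Hom}(M,\mathbb{R}_{\ge0})$ with lattice $\mathrm{Hom}(M,\mathbb{Z})$. Let $\overline{\mathcal{M}}^{\mathrm{trop}}_{g,n}$ be the stack over monoids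 whose objects over $M$ are the stable tropical curves of genus $g$ with $n$ legs with edge lengths in $M\setminus\{0\}$; along $M\to N$ one applies the map to the lengths and contracts the edges whose length becomes $0$. Let $\Sigma_{\mathbf{Rub}^\theta_{g,A}}$ be the stack whose objects over $M$ consist of * a stable tropical curve $\Gamma$ of genus $g$ with $n$ legs over $M$, and a quasi-stable model $\Gamma'\to\Gamma$ (a subdivision over $M$ which subdivides every edge at most once); * a piecewise linear function $\alpha:V(\Gamma')\to M^{\mathrm{gp}}$ (with integral slopes along the edges), vanishing at the vertex of the first leg, such that the divisor $D=A-\mathrm{div}(\alpha)$ on $\Gamma'$ has value $1$ at the exceptional vertices and is $\theta$-semistable, i.e. $|D(S)-\theta(S)|\le\frac12E(S,S^c)$ for all $S\subset V(\Gamma')$; here $A$ and $\theta$ are extended by $0$ to exceptional vertices, and $\mathrm{div}(\alpha)(v)$ is the sum of the slopes of $\alpha$ along the edges oriented towards $v$; * a stable equidimensional lift of $\alpha$: a subdivision $\Gamma''\to\Gamma'$ over $M$ and a finite totally ordered subset $X\subset M^{\mathrm{gp}}$ (a tropical line with these vertices) such that $\alpha$, extended to $\Gamma''$ with the same slopes,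 maps vertices into $X$ and no edge of $\Gamma''$ has an element of $X$ strictly between the values at its endpoints; moreover $X=\alpha(V(\Gamma'))$, and the edges of slope $0$ are not subdivided in $\Gamma''$. Then the map $\Sigma_{\mathbf{Rub}^\theta_{g,A}}\to\overline{\mathcal{M}}^{\mathrm{trop}}_{g,n}$ which remembers only $\Gamma$ factors as $$\Sigma_{\mathbf{Rub}^\theta_{g,A}}\xrightarrow{\ F\ }\mathcal{T}\xrightarrow{\ G\ }\overline{\mathcal{M}}^{\mathrm{trop}}_{g,n},$$ where $G$ is a subdivision and $F$ is a finite index sublattice inclusion. That is, for every map from a cone $\sigma$ to $\overline{\mathcal{M}}^{\mathrm{trop}}_{g,n}$, the base change of $G$ to $\sigma$ is isomorphic to a subdivision of $\sigma$ (a finite rational polyhedral fan with support $\sigma$, with the restricted integral structure); and for every map from a cone $\sigma$ to $\mathcal{T}$, the base change of $F$ to $\sigma$ is isomorphic to the cone $\sigma$ with its lattice replaced by a subgroup of finite index. -/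

import Mathlib

open CategoryTheory

namespace TropRub

/-! ### Monoids and their dual cones -/

/-- A sharp, finitely generated, integral, saturated commutative monoid `M`, given as the
submonoid `mon` of its associated group `gp = M^gp`. -/
structure ToricMonoid where
  gp : Type
  [grp : AddCommGroup gp]
  mon : AddSubmonoid gp
  closure_mon : AddSubgroup.closure (mon : Set gp) = ⊤
  fg : mon.FG
  sharp : ∀ x, x ∈ mon → -x ∈ mon → x = 0
  saturated : ∀ (k : ℕ) (x : gp), 0 < k → k • x ∈ mon → x ∈ mon

attribute [instance] ToricMonoid.grp

/-- A homomorphism of monoids `M → N`, given as the induced map `M^gp → N^gp`. -/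
@[ext] structure ToricMonoid.Hom (M N : ToricMonoid) where
  toFun : M.gp →+ N.gp
  map_mem : ∀ x ∈ M.mon, toFun x ∈ N.mon

instance : Category ToricMonoid where
  Hom := ToricMonoid.Hom
  id M := ⟨AddMonoidHom.id _, fun _ hx => hx⟩
  comp f g := ⟨g.toFun.comp f.toFun, fun x hx => g.map_mem _ (f.map_mem x hx)⟩

/-- The order of `M^gp`: `x ≤ y` if `y - x ∈ M`. -/
def ToricMonoid.le (M : ToricMonoid) (x y : M.gp) : Prop := y - x ∈ M.mon

/-- The cone `Hom(M, ℝ≥0)` dual to `M`, inside `Hom(M^gp, ℝ)`. Its lattice is `Hom(M^gp, ℤ)`. -/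
def ToricMonoid.cone (M : ToricMonoid) : Set (M.gp →+ ℝ) := {x | ∀ m ∈ M.mon, 0 ≤ x m}

/-- `τ` is a rational polyhedral cone contained in the cone of `M`. -/
def ToricMonoid.IsSubcone (M : ToricMonoid) (τ : Set (M.gp →+ ℝ)) : Prop :=
  ∃ U : Finset M.gp, τ = {x ∈ M.cone | ∀ u ∈ U, 0 ≤ x u}

/-- `ρ` is a face of the rational polyhedral cone `τ`. -/
def ToricMonoid.IsFace (M : ToricMonoid) (ρ τ : Set (M.gp →+ ℝ)) : Prop :=
  ∃ u : M.gp, (∀ x ∈ τ, 0 ≤ x u) ∧ ρ = {x ∈ τ | x u = 0}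

/-- A subdivision of the cone dual to `M`: a finite fan of rational polyhedral cones whose
union is the whole cone. Each of its cones carries the integral structure restricted from
`Hom(M^gp, ℤ)`. -/
structure ConeSubdivision (M : ToricMonoid) where
  cones : Set (Set (M.gp →+ ℝ))
  finite : cones.Finite
  isSubcone : ∀ τ ∈ cones, M.IsSubcone τ
  face_mem : ∀ τ ∈ cones, ∀ ρ, M.IsFace ρ τ → ρ ∈ cones
  inter_face : ∀ τ ∈ cones, ∀ τ' ∈ cones, M.IsFace (τ ∩ τ') τ ∧ M.IsFace (τ ∩ τ') τ'
  sUnion_eq : ⋃₀ cones = M.cone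

/-! ### Maps of cone stacks

A cone stack is treated as a category cofibred in groupoids over monoids (equivalently, fibred in
groupoids over cones): its objects over `M` are the maps from the cone dual to `M`, and an arrow
`y ⟶ z` over `M ⟶ N` exhibits `z` as the restriction of `y` along the map from the cone dual to
`N` to the cone dual to `M`. -/

/-- `F : 𝒳 ⥤ 𝒴` is a subdivision of cone stacks: for every map `y` from a cone `σ` to `𝒴`, the
base change `𝒳 ×_𝒴 σ → σ` is (the functor of points of) a subdivision of `σ`. Full faithfulness
says that lifts along `F` are unique up to a unique isomorphism; the last clause says that the
restriction of `y` along a map of cones to `σ` has a lift exactly if this map lands in one of the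
cones of the subdivision. -/
def IsSubdivision {𝒳 𝒴 : Type 1} [Category.{0} 𝒳] [Category.{0} 𝒴] (p : 𝒴 ⥤ ToricMonoid)
    (F : 𝒳 ⥤ 𝒴) : Prop :=
  F.Full ∧ F.Faithful ∧ ∀ y : 𝒴, ∃ Δ : ConeSubdivision (p.obj y), ∀ (z : 𝒴) (f : y ⟶ z),
    F.essImage z ↔ ∃ τ ∈ Δ.cones, ∀ x ∈ (p.obj z).cone, x.comp (p.map f).toFun ∈ τ

/-- `F : 𝒳 ⥤ 𝒴` is a finite index sublattice inclusion of cone stacks: for every map `y` from a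
cone `σ` to `𝒴`, the base change `𝒳 ×_𝒴 σ → σ` is (the functor of points of) the same cone `σ`,
with its lattice replaced by a subgroup `L` of finite index. -/
def IsFiniteIndexInclusion {𝒳 𝒴 : Type 1} [Category.{0} 𝒳] [Category.{0} 𝒴]
    (p : 𝒴 ⥤ ToricMonoid) (F : 𝒳 ⥤ 𝒴) : Prop :=
  F.Full ∧ F.Faithful ∧ ∀ y : 𝒴, ∃ L : AddSubgroup ((p.obj y).gp →+ ℤ), L.FiniteIndex ∧
    ∀ (z : 𝒴) (f : y ⟶ z),
      F.essImage z ↔ ∀ x : (p.obj z).gp →+ ℤ, x.comp (p.map f).toFun ∈ L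

/-! ### Graphs and contractions -/

/-- A finite graph with vertex genera and `n` legs. `D` is the set of oriented edges, `src` the
initial vertex and `inv` the reversal of orientation. Loops and multiple edges are allowed. -/
structure DualGraph (n : ℕ) where
  V : Type
  D : Type
  [fintypeV : Fintype V]
  [fintypeD : Fintype D]
  src : D → V
  inv : D → D
  inv_inv : ∀ h, inv (inv h) = h
  inv_ne : ∀ h, inv h ≠ h
  genus : V → ℕ
  leg : Fin n → V

attribute [instance] DualGraph.fintypeV DualGraph.fintypeD

namespace DualGraph

variable {n : ℕ}

/-- The final vertex of an oriented edge. -/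
def tgt (Γ : DualGraph n) (h : Γ.D) : Γ.V := Γ.src (Γ.inv h)

open Classical in
/-- The valence (legs not counted); a loop counts twice. -/
noncomputable def valence (Γ : DualGraph n) (v : Γ.V) : ℕ :=
  (Finset.univ.filter fun h => Γ.src h = v).card

/-- `2 g(v) - 2 + val(v)`, the degree of the dualizing sheaf on the component `v`. -/
noncomputable def canDeg (Γ : DualGraph n) (v : Γ.V) : ℤ :=
  2 * (Γ.genus v : ℤ) - 2 + (Γ.valence v : ℤ)

open Classical in
/-- Stable connected graphs of genus `g`. As the valences add up to `2 |E|`, the last clause says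
that `∑ g(v) + |E| - |V| + 1 = g`. -/
structure IsStable (g : ℕ) (Γ : DualGraph n) : Prop where
  nonempty : Nonempty Γ.V
  connected : ∀ v w, Relation.ReflTransGen (fun a b => ∃ h, Γ.src h = a ∧ Γ.tgt h = b) v w
  stable : ∀ v, 0 < Γ.canDeg v + ((Finset.univ.filter fun i => Γ.leg i = v).card : ℤ)
  genus_eq : ∑ v, Γ.canDeg v = 2 * (g : ℤ) - 2

open Classical in
/-- The number of edges joining `S` to its complement. -/
noncomputable def cut (Γ : DualGraph n) (S : Finset Γ.V) : ℕ :=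
  (Finset.univ.filter fun h => Γ.src h ∈ S ∧ Γ.tgt h ∉ S).card

open Classical in
/-- An edge contraction `Γ → Γ'` (isomorphisms included). It is given by the map of vertices and
by the inclusion of the oriented edges of `Γ'` in those of `Γ`; the oriented edges outside the
image of this inclusion are the contracted ones. With the other clauses, `canDeg_eq` says that the
genus of `v'` is the sum of the genera of the vertices over `v'` plus the first Betti number of
the graph contracted to `v'`. -/
@[ext] structure Contraction (Γ Γ' : DualGraph n) where
  onV : Γ.V → Γ'.V
  onD : Γ'.D → Γ.D
  onV_surjective : Function.Surjective onV
  onD_injective : Function.Injective onD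
  onD_inv : ∀ h, onD (Γ'.inv h) = Γ.inv (onD h)
  onV_src : ∀ h, onV (Γ.src (onD h)) = Γ'.src h
  onV_eq_iff : ∀ v w, onV v = onV w ↔ Relation.ReflTransGen
    (fun a b => ∃ h, h ∉ Set.range onD ∧ Γ.src h = a ∧ Γ.tgt h = b) v w
  canDeg_eq : ∀ v', Γ'.canDeg v' = ∑ v with onV v = v', Γ.canDeg v
  onV_leg : ∀ i, onV (Γ.leg i) = Γ'.leg i

namespace Contraction

theorem onV_contracted {Γ Γ' : DualGraph n} (f : Contraction Γ Γ') {h : Γ.D}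
    (hh : h ∉ Set.range f.onD) : f.onV (Γ.src h) = f.onV (Γ.tgt h) :=
  (f.onV_eq_iff _ _).2 (Relation.ReflTransGen.single ⟨h, hh, rfl, rfl⟩)

theorem onV_tgt {Γ Γ' : DualGraph n} (f : Contraction Γ Γ') (h : Γ'.D) :
    f.onV (Γ.tgt (f.onD h)) = Γ'.tgt h := by
  unfold tgt
  rw [← f.onD_inv, f.onV_src]

open Classical in
theorem sum_fibre_comp {R : Type*} [AddCommMonoid R] {α β γ : Type*} [Fintype α] [Fintype β]
    (f : α → β) (g : β → γ) (F : α → R) (c : γ) :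
    ∑ b with g b = c, ∑ a with f a = b, F a = ∑ a with g (f a) = c, F a := by
  rw [← Finset.sum_fiberwise_of_maps_to (s := Finset.univ.filter fun a => g (f a) = c)
    (t := Finset.univ.filter fun b => g b = c) (g := f) (by simp)]
  refine Finset.sum_congr rfl fun b hb => Finset.sum_congr ?_ fun _ _ => rfl
  ext a
  simp only [Finset.mem_filter, Finset.mem_univ, true_and] at hb ⊢
  exact ⟨fun h => ⟨h ▸ hb, h⟩, fun h => h.2⟩

/-- The identity contraction. -/
def id (Γ : DualGraph n) : Contraction Γ Γ where
  onV := _root_.id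
  onD := _root_.id
  onV_surjective := Function.surjective_id
  onD_injective := Function.injective_id
  onD_inv _ := rfl
  onV_src _ := rfl
  onV_eq_iff v w := by
    constructor
    · rintro rfl
      exact Relation.ReflTransGen.refl
    · intro h
      induction h with
      | refl => rfl
      | tail _ h _ => obtain ⟨h, hh, _⟩ := h; exact (hh ⟨h, rfl⟩).elim
  canDeg_eq v' := by
    rw [Finset.sum_filter]
    simp only [_root_.id]
    classical
    rw [Finset.sum_eq_single v' (fun b _ hb => if_neg hb) (by simp), if_pos rfl]
  onV_leg _ := rfl

/-- The composition of two contractions. -/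
def comp {Γ Γ' Γ'' : DualGraph n} (f : Contraction Γ Γ') (g : Contraction Γ' Γ'') :
    Contraction Γ Γ'' where
  onV := g.onV ∘ f.onV
  onD := f.onD ∘ g.onD
  onV_surjective := g.onV_surjective.comp f.onV_surjective
  onD_injective := f.onD_injective.comp g.onD_injective
  onD_inv h := by simp [g.onD_inv, f.onD_inv]
  onV_src h := by simp [f.onV_src, g.onV_src]
  onV_eq_iff v w := by
    have lift : ∀ a b, f.onV a = f.onV b → Relation.ReflTransGen (fun a b =>
        ∃ h, h ∉ Set.range (f.onD ∘ g.onD) ∧ Γ.src h = a ∧ Γ.tgt h = b) a b := by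
      intro a b hab
      have h' := (f.onV_eq_iff a b).1 hab
      induction h' with
      | refl => exact Relation.ReflTransGen.refl
      | tail hpre hstep ih =>
        obtain ⟨h, hh, hx, hy⟩ := hstep
        exact (ih ((f.onV_eq_iff _ _).2 hpre)).tail
          ⟨h, fun ⟨k, hk⟩ => hh ⟨g.onD k, hk⟩, hx, hy⟩
    constructor
    · intro h
      have h' := (g.onV_eq_iff (f.onV v) (f.onV w)).1 h
      have key : ∀ c, Relation.ReflTransGen (fun a b =>
          ∃ h, h ∉ Set.range g.onD ∧ Γ'.src h = a ∧ Γ'.tgt h = b) (f.onV v) c →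
          ∀ w, f.onV w = c → Relation.ReflTransGen (fun a b =>
        ∃ h, h ∉ Set.range (f.onD ∘ g.onD) ∧ Γ.src h = a ∧ Γ.tgt h = b) v w := by
        intro c hc
        induction hc with
        | refl => intro w hw; exact lift _ _ hw.symm
        | tail _ hstep ih =>
          intro w hw
          obtain ⟨k, hk, hk1, hk2⟩ := hstep
          refine ((ih (Γ.src (f.onD k)) (by rw [f.onV_src, hk1])).tail ?_).trans
            (lift (Γ.tgt (f.onD k)) w (by rw [f.onV_tgt, hk2, hw]))
          exact ⟨f.onD k, fun ⟨m, hm⟩ => hk ⟨m, f.onD_injective hm⟩, rfl, rfl⟩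
      exact key _ h' w rfl
    · intro h
      induction h with
      | refl => rfl
      | tail _ hstep ih =>
        obtain ⟨k, hk, rfl, rfl⟩ := hstep
        refine ih.trans ?_
        by_cases hkf : k ∈ Set.range f.onD
        · obtain ⟨m, rfl⟩ := hkf
          have hm : m ∉ Set.range g.onD := fun ⟨q, hq⟩ => hk ⟨q, by simp [hq]⟩
          simp only [Function.comp_apply, f.onV_src, f.onV_tgt]
          exact g.onV_contracted hm
        · simp only [Function.comp_apply, f.onV_contracted hkf]
  canDeg_eq v'' := by
    rw [g.canDeg_eq, Finset.sum_congr rfl fun v' _ => f.canDeg_eq v', sum_fibre_comp]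
    rfl
  onV_leg i := by simp [f.onV_leg, g.onV_leg]

end Contraction

end DualGraph

/-! ### Tropical curves -/

/-- A tropical curve with `n` legs, metrized by `M`. -/
structure TropicalCurve (M : ToricMonoid) (n : ℕ) extends DualGraph n where
  len : D → M.gp
  len_mem : ∀ h, len h ∈ M.mon
  len_ne_zero : ∀ h, len h ≠ 0
  len_inv : ∀ h, len (inv h) = len h

/-- Given `φ : M ⟶ N`, a presentation of the tropical curve `C'` over `N` as the push-forward of
the tropical curve `C` over `M`: apply `φ` to the lengths and contract the edges whose length
becomes zero. -/
@[ext] structure TropicalHom {M N : ToricMonoid} {n : ℕ} (φ : M ⟶ N) (C : TropicalCurve M n)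
    (C' : TropicalCurve N n) extends DualGraph.Contraction C.toDualGraph C'.toDualGraph where
  len_onD : ∀ h, φ.toFun (C.len (onD h)) = C'.len h
  len_contracted : ∀ h, h ∉ Set.range onD → φ.toFun (C.len h) = 0

/-- The identity of a tropical curve. -/
def TropicalHom.id {M : ToricMonoid} {n : ℕ} (C : TropicalCurve M n) : TropicalHom (𝟙 M) C C where
  toContraction := DualGraph.Contraction.id _
  len_onD _ := rfl
  len_contracted h hh := (hh ⟨h, rfl⟩).elim

/-- The composition of two maps of tropical curves. -/
def TropicalHom.comp {M N P : ToricMonoid} {n : ℕ} {φ : M ⟶ N} {ψ : N ⟶ P}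
    {C : TropicalCurve M n} {C' : TropicalCurve N n} {C'' : TropicalCurve P n}
    (f : TropicalHom φ C C') (g : TropicalHom ψ C' C'') : TropicalHom (φ ≫ ψ) C C'' where
  toContraction := f.toContraction.comp g.toContraction
  len_onD h := by
    change ψ.toFun (φ.toFun (C.len (f.onD (g.onD h)))) = _
    rw [f.len_onD, g.len_onD]
  len_contracted h hh := by
    change ψ.toFun (φ.toFun (C.len h)) = 0
    by_cases hf : h ∈ Set.range f.onD
    · obtain ⟨k, rfl⟩ := hf
      rw [f.len_onD]
      exact g.len_contracted k fun ⟨m, hm⟩ => hh ⟨m, congrArg f.onD hm⟩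
    · rw [f.len_contracted h hf, map_zero]

/-- A subdivision `C' → C` of tropical curves. The oriented edges of `C'` over an oriented edge `h`
of `C` form a path from the initial to the final vertex of `h` through exceptional vertices,
and their lengths add up to that of `h`. The exceptional vertices are those outside the range of
`onV`; they have genus zero, valence two and no legs. -/
structure CurveSubdivision {M : ToricMonoid} {n : ℕ} (C' C : TropicalCurve M n) where
  onV : C.V → C'.V
  onD : C'.D → C.D
  onV_injective : Function.Injective onV
  onD_inv : ∀ h, onD (C'.inv h) = C.inv (onD h)
  path : ∀ h : C.D, ∃ (m : ℕ) (e : Fin (m + 1) → C'.D), Function.Injective e ∧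
    (∀ h', onD h' = h ↔ h' ∈ Set.range e) ∧
    C'.src (e 0) = onV (C.src h) ∧ C'.tgt (e (Fin.last m)) = onV (C.tgt h) ∧
    (∀ i : Fin m, C'.tgt (e i.castSucc) = C'.src (e i.succ) ∧
      C'.tgt (e i.castSucc) ∉ Set.range onV) ∧
    ∑ i, C'.len (e i) = C.len h
  genus_onV : ∀ v, C'.genus (onV v) = C.genus v
  leg_eq : ∀ i, C'.leg i = onV (C.leg i)
  exceptional : ∀ v', v' ∉ Set.range onV → C'.genus v' = 0 ∧ C'.valence v' = 2

namespace CurveSubdivision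

variable {M : ToricMonoid} {n : ℕ} {C' C : TropicalCurve M n}

open Classical in
/-- Every edge is subdivided at most once. -/
def IsQuasiStable (q : CurveSubdivision C' C) : Prop :=
  ∀ h, (Finset.univ.filter fun h' => q.onD h' = h).card ≤ 2

open Classical in
/-- The lift to `C'` of a function on the vertices of `C`, with value `0` on the exceptional
vertices. -/
noncomputable def lift {R : Type*} [AddCommMonoid R] (q : CurveSubdivision C' C) (F : C.V → R)
    (v' : C'.V) : R :=
  ∑ v with q.onV v = v', F v

/-- The maps `f' : C₁' → C₂'` and `f : C₁ → C₂` commute with the subdivisions. -/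
def Compatible {M₁ M₂ : ToricMonoid} {φ : M₁ ⟶ M₂} {C₁' C₁ : TropicalCurve M₁ n}
    {C₂' C₂ : TropicalCurve M₂ n} (q₁ : CurveSubdivision C₁' C₁) (q₂ : CurveSubdivision C₂' C₂)
    (f' : TropicalHom φ C₁' C₂') (f : TropicalHom φ C₁ C₂) : Prop :=
  (∀ v, f'.onV (q₁.onV v) = q₂.onV (f.onV v)) ∧ ∀ h, q₁.onD (f'.onD h) = f.onD (q₂.onD h)

end CurveSubdivision

/-- A piecewise linear function on `C`. The slopes are recorded, but they are determined by the
values. -/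
structure PLFunction {M : ToricMonoid} {n : ℕ} (C : TropicalCurve M n) where
  val : C.V → M.gp
  slope : C.D → ℤ
  val_tgt_sub : ∀ h, val (C.tgt h) - val (C.src h) = slope h • C.len h

open Classical in
/-- The divisor of a piecewise linear function: at `v`, the sum of the slopes along the edges
oriented towards `v`. -/
noncomputable def PLFunction.div {M : ToricMonoid} {n : ℕ} {C : TropicalCurve M n}
    (α : PLFunction C) (v : C.V) : ℤ :=
  ∑ h with C.tgt h = v, α.slope h

/-- `α'` is the lift of `α` along a subdivision. -/
def PLFunction.IsLift {M : ToricMonoid} {n : ℕ} {C' C : TropicalCurve M n}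
    (q : CurveSubdivision C' C) (α' : PLFunction C') (α : PLFunction C) : Prop :=
  (∀ v, α'.val (q.onV v) = α.val v) ∧ ∀ h, α'.slope h = α.slope (q.onD h)

/-- A tropical line: the polyhedral decomposition of `ℝ` over `M` with the given vertices, which
form a finite totally ordered set of elements of `M^gp`. -/
structure TropicalLine (M : ToricMonoid) where
  vertices : Finset M.gp
  total : ∀ x ∈ vertices, ∀ y ∈ vertices, M.le x y ∨ M.le y x

/-- `α` is an equidimensional map to the tropical line `X`: vertices map to vertices of `X`, and
every edge maps into a single cell of `X`, that is, no vertex of `X` lies strictly between the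
values at its endpoints. -/
def PLFunction.IsEquidimensional {M : ToricMonoid} {n : ℕ} {C : TropicalCurve M n}
    (α : PLFunction C) (X : TropicalLine M) : Prop :=
  (∀ v, α.val v ∈ X.vertices) ∧
  ∀ h, ∀ x ∈ X.vertices, M.le (α.val (C.src h)) x → M.le x (α.val (C.tgt h)) →
    x = α.val (C.src h) ∨ x = α.val (C.tgt h)

/-! ### The moduli stack of stable tropical curves -/

/-- The objects of `M̄_{g,n}^trop`: stable tropical curves of genus `g` with `n` legs, metrized by
a monoid. -/
structure Mbar (g n : ℕ) where
  M : ToricMonoid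
  C : TropicalCurve M n
  stable : C.IsStable g

/-- The arrows of `M̄_{g,n}^trop`. -/
@[ext] structure Mbar.Hom {g n : ℕ} (x y : Mbar g n) where
  φ : x.M ⟶ y.M
  f : TropicalHom φ x.C y.C

instance (g n : ℕ) : Category (Mbar g n) where
  Hom := Mbar.Hom
  id x := ⟨𝟙 _, TropicalHom.id _⟩
  comp a b := ⟨a.φ ≫ b.φ, a.f.comp b.f⟩

/-- The projection of `M̄_{g,n}^trop` to monoids. -/
def Mbar.base (g n : ℕ) : Mbar g n ⥤ ToricMonoid where
  obj x := x.M
  map a := a.φ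

/-! ### Universal divisors and stability conditions -/

open Classical in
/-- A function on the vertices of each stable graph of genus `g` with `n` legs, compatible with
all edge contractions and isomorphisms. For `R = ℤ` this is a universal tropical divisor, for
`R = ℝ` a universal stability condition. -/
structure UniversalFunction (g n : ℕ) (R : Type) [AddCommMonoid R] where
  toFun : ∀ Γ : DualGraph n, Γ.IsStable g → Γ.V → R
  specialize : ∀ (Γ Γ' : DualGraph n) (hΓ : Γ.IsStable g) (hΓ' : Γ'.IsStable g)
    (f : Γ.Contraction Γ') (v' : Γ'.V), toFun Γ' hΓ' v' = ∑ v with f.onV v = v', toFun Γ hΓ v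

open Classical in
/-- The multidegree of `ω^k(-∑ aᵢ xᵢ)`. -/
noncomputable def ramificationDivisor (g n : ℕ) (k : ℤ) (a : Fin n → ℤ) :
    UniversalFunction g n ℤ where
  toFun Γ _ v := k * Γ.canDeg v - ∑ i with Γ.leg i = v, a i
  specialize Γ Γ' _ _ f v' := by
    have h := DualGraph.Contraction.sum_fibre_comp Γ.leg f.onV a v'
    simp only [f.onV_leg] at h
    rw [Finset.sum_sub_distrib, h, f.canDeg_eq, Finset.mul_sum]

/-- A universal stability condition is non-degenerate if `θ(S) ± E(S, Sᶜ)/2` is never an integer,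
for `S` a nonempty proper subset of the vertices of a stable graph. -/
def UniversalFunction.IsNondegenerate {g n : ℕ} (θ : UniversalFunction g n ℝ) : Prop :=
  ∀ (Γ : DualGraph n) (hΓ : Γ.IsStable g) (S : Finset Γ.V), S.Nonempty → S ≠ Finset.univ →
    ∀ m : ℤ, ∑ v ∈ S, θ.toFun Γ hΓ v + (Γ.cut S : ℝ) / 2 ≠ m ∧
      ∑ v ∈ S, θ.toFun Γ hΓ v - (Γ.cut S : ℝ) / 2 ≠ m

/-- The divisor `D` on `Γ` is semistable for the numerical stability condition `t`. -/
def IsSemistable {n : ℕ} (Γ : DualGraph n) (t : Γ.V → ℝ) (D : Γ.V → ℤ) : Prop :=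
  ∀ S : Finset Γ.V, ∑ v ∈ S, t v - (Γ.cut S : ℝ) / 2 ≤ ((∑ v ∈ S, D v : ℤ) : ℝ) ∧
    ((∑ v ∈ S, D v : ℤ) : ℝ) ≤ ∑ v ∈ S, t v + (Γ.cut S : ℝ) / 2

/-! ### The stack of equidimensional lifts -/

/-- The objects of `Σ_Rub^θ_{g,A}`: a stable tropical curve `C` metrized by `M`, a quasi-stable
model `C'` of `C`, a piecewise linear function `α` on `C'` vanishing on the vertex of the first
leg such that `D = A - div α` is admissible and `θ`-semistable, and a stable lift of `α` to an
equidimensional map `C'' → X` from a subdivision of `C'` to a tropical line. -/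
structure Rub {g n : ℕ} [NeZero n] (A : UniversalFunction g n ℤ) (θ : UniversalFunction g n ℝ) where
  M : ToricMonoid
  C : TropicalCurve M n
  stable : C.IsStable g
  C' : TropicalCurve M n
  q : CurveSubdivision C' C
  quasiStable : q.IsQuasiStable
  α : PLFunction C'
  α_leg : α.val (C'.leg 0) = 0
  admissible : ∀ v', v' ∉ Set.range q.onV →
    q.lift (A.toFun C.toDualGraph stable) v' - α.div v' = 1
  semistable : IsSemistable C'.toDualGraph (q.lift (θ.toFun C.toDualGraph stable))
    fun v' => q.lift (A.toFun C.toDualGraph stable) v' - α.div v'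
  C'' : TropicalCurve M n
  r : CurveSubdivision C'' C'
  α' : PLFunction C''
  isLift : α'.IsLift r α
  X : TropicalLine M
  equidimensional : α'.IsEquidimensional X
  /-- Stability: the vertices of `X` are images of vertices of `C'`. -/
  vertices_eq : ∀ x ∈ X.vertices, ∃ v, α.val v = x
  /-- Stability: edges on which `α` has slope zero are not subdivided. -/
  slope_ne_zero : ∀ h, C''.src h ∉ Set.range r.onV → α'.slope h ≠ 0

namespace Rub

variable {g n : ℕ} [NeZero n] {A : UniversalFunction g n ℤ} {θ : UniversalFunction g n ℝ}

/-- The arrows of `Σ_Rub^θ_{g,A}`: maps of the three curves which commute with the subdivisions,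
the piecewise linear functions and the maps to the tropical lines. -/
@[ext] structure Hom (x y : Rub A θ) where
  φ : x.M ⟶ y.M
  f : TropicalHom φ x.C y.C
  f' : TropicalHom φ x.C' y.C'
  f'' : TropicalHom φ x.C'' y.C''
  compat_q : x.q.Compatible y.q f' f
  compat_r : x.r.Compatible y.r f'' f'
  map_α : ∀ v, φ.toFun (x.α.val v) = y.α.val (f'.onV v)
  map_α' : ∀ v, φ.toFun (x.α'.val v) = y.α'.val (f''.onV v)
  map_X : ∀ t ∈ x.X.vertices, φ.toFun t ∈ y.X.vertices

instance : Category (Rub A θ) where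
  Hom := Hom
  id x :=
    { φ := 𝟙 _
      f := TropicalHom.id _
      f' := TropicalHom.id _
      f'' := TropicalHom.id _
      compat_q := ⟨fun _ => rfl, fun _ => rfl⟩
      compat_r := ⟨fun _ => rfl, fun _ => rfl⟩
      map_α := fun _ => rfl
      map_α' := fun _ => rfl
      map_X := fun _ ht => ht }
  comp {x y z} a b :=
    { φ := a.φ ≫ b.φ
      f := a.f.comp b.f
      f' := a.f'.comp b.f'
      f'' := a.f''.comp b.f''
      compat_q := ⟨fun v => (congrArg b.f'.onV (a.compat_q.1 v)).trans (b.compat_q.1 _),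
        fun h => (a.compat_q.2 _).trans (congrArg a.f.onD (b.compat_q.2 h))⟩
      compat_r := ⟨fun v => (congrArg b.f''.onV (a.compat_r.1 v)).trans (b.compat_r.1 _),
        fun h => (a.compat_r.2 _).trans (congrArg a.f'.onD (b.compat_r.2 h))⟩
      map_α := fun v => (congrArg b.φ.toFun (a.map_α v)).trans (b.map_α _)
      map_α' := fun v => (congrArg b.φ.toFun (a.map_α' v)).trans (b.map_α' _)
      map_X := fun t ht => b.map_X _ (a.map_X t ht) }

variable (A θ)

/-- The map `Σ_Rub^θ_{g,A} → M̄_{g,n}^trop`. -/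
def stabilization : Rub A θ ⥤ Mbar g n where
  obj x := ⟨x.M, x.C, x.stable⟩
  map a := ⟨a.φ, a.f⟩

end Rub

end TropRub

/-! Fix a stable curve `C` over `M`. Admissibility forces the two slopes of `α` on a subdivided edge
to be consecutive integers. A quasi-stable model with its function `α` therefore amounts to a
potential `a` on the vertices of `C`, with integers `s h` such that the slope of `a` along `h` lies
between `s h` and `s h + 1`. With `c = A - θ`, semistability becomes `c(S) ≤ ∑ (s h + 1/2)`, summed
over the edges entering `S` (`Model.isSolution`, `IsSolution.exists_model`).

At a real point of the cone the lengths are real numbers. Taking for `s h` the floor of the slope,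
the inequality says that a convex energy does not decrease to first order when the potential is
raised on `S`. The energy has a minimum because the graph is connected and `c` has total degree zero
(`exists_isRealSolution`); a maximum principle together with non-degeneracy makes the solution
unique up to a constant (`IsRealSolution.sub_eq_sub`). Every point of the cone thus carries exactly
one normalized potential. Since equalities in `M.gp` can be tested on the cone (Farkas), potentials
over monoids are unique and functorial as well (`IsSolution.map_eq`).

Non-degeneracy also forces the edges of integral slope to connect the graph
(`connected_by_integral_slopes`). Hence the potential is an integral combination of edge lengths,
with coefficients that stay fixed as long as certain signs do not change: those of the slopes
compared with integers, and of the differences between the values at vertices and break points.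
These signs cut the cone into a fan (`exists_coneSubdivision`), and a map of cones lands in one cone
of this fan exactly if the restricted curve has a model whose values are totally ordered
(`exists_fan`). The intermediate stack is the full subcategory of the curves with such a model, and
`G` is its inclusion.

Over such a curve the equidimensional lift is dictated by `α`: an edge of nonzero slope is
subdivided wherever `α` takes the value of a vertex. The required positions exist in the group
exactly if the slope divides certain differences of values, which is a finite list of divisibility
conditions and hence a sublattice of finite index (`isFiniteIndexInclusion_toHasModel`). Full
faithfulness rests on a statement about subdivisions: a map of curves lifts when the positions of
the vertices correspond, and a lift is unique (`CurveSubdivision.exists_compatible`,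
`CurveSubdivision.Compatible.unique`). -/

namespace TropRub

/-! ### The order and the duality theory of toric monoids -/

/-- **Farkas' lemma** for finitely generated submonoids of a free abelian group. -/
theorem farkas {G : Type*} [AddCommGroup G] [Module.Free ℤ G] (l : List G) :
    ∀ m : G, (∃ k : ℕ, 0 < k ∧ k • m ∈ AddSubmonoid.closure {x | x ∈ l}) ∨
      ∃ f : G →+ ℤ, (∀ x ∈ l, 0 ≤ f x) ∧ f m < 0 := by
  induction hn : l.length generalizing l with
  | zero =>
    intro m
    obtain rfl := List.length_eq_zero_iff.1 hn
    by_cases hm : m = 0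
    · exact Or.inl ⟨1, one_pos, by simp [hm]⟩
    · right
      let b := Module.Free.chooseBasis ℤ G
      have : ∃ i, b.repr m i ≠ 0 := by
        by_contra! h
        exact hm (b.repr.map_eq_zero_iff.1 (Finsupp.ext h))
      obtain ⟨i, hi⟩ := this
      rcases lt_or_gt_of_ne hi with h | h
      · exact ⟨(b.coord i).toAddMonoidHom, by simp, h⟩
      · exact ⟨-(b.coord i).toAddMonoidHom, by simp, by simpa using h⟩
  | succ n ih =>
    intro m
    obtain ⟨s, l, rfl⟩ := List.exists_cons_of_length_eq_add_one hn
    have hl : l.length = n := by simpa using hn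
    have hsub : AddSubmonoid.closure {x | x ∈ l} ≤ AddSubmonoid.closure {x | x ∈ s :: l} :=
      AddSubmonoid.closure_mono fun x hx => List.mem_cons_of_mem _ hx
    have hs : s ∈ AddSubmonoid.closure {x | x ∈ s :: l} :=
      AddSubmonoid.subset_closure (by simp)
    rcases ih l hl m with ⟨k, hk, h⟩ | ⟨f, hf, hfm⟩
    · exact Or.inl ⟨k, hk, hsub h⟩
    by_cases hfs : 0 ≤ f s
    · exact Or.inr ⟨f, by simpa [hfs] using hf, hfm⟩
    push Not at hfs
    -- `P` kills `s` and has image in the kernel of `f`: it is the projection along `s`, scaled by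
    -- `-f s > 0` to avoid denominators.
    let P : G →+ G := AddMonoidHom.mk' (fun g => (-f s) • g + f g • s) (by
      intro a b; simp only [smul_add, map_add, add_smul]; abel)
    have hP : ∀ g, P g = (-f s) • g + f g • s := fun _ => rfl
    rcases ih (l.map P) (by simpa using hl) (P m) with ⟨k, hk, h⟩ | ⟨f', hf', hfm'⟩
    · left
      obtain ⟨p, hp⟩ := Int.eq_ofNat_of_zero_le (neg_nonneg.2 hfs.le)
      obtain ⟨r, hr⟩ := Int.eq_ofNat_of_zero_le (neg_nonneg.2 hfm.le)
      refine ⟨k * p, Nat.mul_pos hk (by omega), ?_⟩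
      have hle : AddSubmonoid.closure {x | x ∈ l.map P} ≤ AddSubmonoid.closure {x | x ∈ s :: l} := by
        rw [AddSubmonoid.closure_le]
        intro x hx
        obtain ⟨y, hy, rfl⟩ := List.mem_map.1 hx
        obtain ⟨q, hq⟩ := Int.eq_ofNat_of_zero_le (hf y hy)
        rw [hP, hp, hq, natCast_zsmul, natCast_zsmul]
        exact add_mem (nsmul_mem (hsub (AddSubmonoid.subset_closure hy)) _) (nsmul_mem hs _)
      -- With `p = -f s` and `r = -f m` one has `p • m = P m + r • s`, so `k * r` copies of `s` turn
      -- `k • P m` into `(k * p) • m`.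
      have := add_mem (hle h) (nsmul_mem hs (k * r))
      rw [hP, hp, show f m = -(r : ℤ) by omega, neg_smul, natCast_zsmul, natCast_zsmul] at this
      rw [mul_smul]
      rw [smul_add, mul_smul, smul_neg, neg_add_cancel_right] at this
      exact this
    · right
      refine ⟨f'.comp P, ?_, hfm'⟩
      intro x hx
      rcases List.mem_cons.1 hx with rfl | hx
      · have : P x = 0 := by rw [hP]; simp
        simp [this]
      · exact hf' _ (List.mem_map_of_mem hx)

namespace ToricMonoid

variable (M : ToricMonoid)

instance : PartialOrder M.gp where
  le := M.le
  le_refl x := by simp [ToricMonoid.le]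
  le_trans x y z h1 h2 := by
    have := M.mon.add_mem h1 h2
    simp only [ToricMonoid.le] at *
    convert this using 1
    abel
  le_antisymm x y h1 h2 := by
    have := M.sharp (y - x) h1 (by rw [neg_sub]; exact h2)
    exact (sub_eq_zero.1 this).symm

theorem le_iff_sub_mem {x y : M.gp} : x ≤ y ↔ y - x ∈ M.mon := Iff.rfl

theorem nonneg_iff_mem {x : M.gp} : 0 ≤ x ↔ x ∈ M.mon := by rw [le_iff_sub_mem, sub_zero]

instance : IsOrderedAddMonoid M.gp where
  add_le_add_left x y h z := by
    rw [le_iff_sub_mem] at *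
    convert h using 1
    abel

theorem nonneg_of_nsmul_nonneg {k : ℕ} (hk : 0 < k) {x : M.gp} (h : 0 ≤ k • x) : 0 ≤ x :=
  M.nonneg_iff_mem.2 (M.saturated k x hk (M.nonneg_iff_mem.1 h))

theorem eq_zero_of_nsmul_eq_zero {k : ℕ} (hk : 0 < k) {x : M.gp} (h : k • x = 0) : x = 0 :=
  le_antisymm (neg_nonneg.1 (M.nonneg_of_nsmul_nonneg hk (by simp [h])))
    (M.nonneg_of_nsmul_nonneg hk h.ge)

instance : IsAddTorsionFree M.gp where
  nsmul_right_injective k hk x y h := by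
    refine sub_eq_zero.1 (M.eq_zero_of_nsmul_eq_zero (Nat.pos_of_ne_zero hk) ?_)
    rw [nsmul_sub]
    exact sub_eq_zero.2 h

instance : Module.Finite ℤ M.gp := by
  obtain ⟨s, hs⟩ := M.fg
  refine ⟨⟨s, ?_⟩⟩
  rw [← Submodule.toAddSubgroup_inj, Submodule.span_int_eq_addSubgroupClosure,
    Submodule.top_toAddSubgroup, eq_top_iff, ← M.closure_mon, AddSubgroup.closure_le, ← hs]
  exact (AddSubmonoid.closure_le (S := (AddSubgroup.closure (s : Set M.gp)).toAddSubmonoid)).2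
    AddSubgroup.subset_closure

/-- Saturation absorbs the multiple `k` that `farkas` leaves open; `farkas` applies because a
finitely generated torsion-free group is free. -/
theorem exists_neg_of_not_nonneg {m : M.gp} (h : ¬ 0 ≤ m) :
    ∃ f : M.gp →+ ℤ, (∀ x ∈ M.mon, 0 ≤ f x) ∧ f m < 0 := by
  obtain ⟨s, hs⟩ := M.fg
  rcases farkas s.toList m with ⟨k, hk, hm⟩ | ⟨f, hf, hm⟩
  · refine absurd (M.nonneg_of_nsmul_nonneg hk (M.nonneg_iff_mem.2 ?_)) h
    rw [← hs]
    simpa using hm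
  · refine ⟨f, fun x hx => ?_, hm⟩
    rw [← hs] at hx
    induction hx using AddSubmonoid.closure_induction with
    | mem x hx => exact hf x (by simpa using hx)
    | zero => simp
    | add x y _ _ hx hy => rw [map_add]; exact add_nonneg hx hy

theorem cone_apply_nonneg {x : M.gp →+ ℝ} (hx : x ∈ M.cone) {m : M.gp} (hm : 0 ≤ m) : 0 ≤ x m :=
  hx m (M.nonneg_iff_mem.1 hm)

theorem cone_apply_mono {x : M.gp →+ ℝ} (hx : x ∈ M.cone) {m m' : M.gp} (hm : m ≤ m') :
    x m ≤ x m' := by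
  have := hx _ hm
  rwa [map_sub, sub_nonneg] at this

/-- Biduality. It transfers uniqueness and inequalities from real metric graphs to curves over `M`.
-/
theorem nonneg_of_forall_cone {m : M.gp} (h : ∀ x ∈ M.cone, 0 ≤ x m) : 0 ≤ m := by
  by_contra hm
  obtain ⟨f, hf, hfm⟩ := M.exists_neg_of_not_nonneg hm
  have := h ((Int.castAddHom ℝ).comp f) (fun m hm => by simpa using hf m hm)
  simp only [AddMonoidHom.comp_apply, Int.coe_castAddHom] at this
  have : (0 : ℤ) ≤ f m := by exact_mod_cast this
  omega

theorem le_of_forall_cone {m m' : M.gp} (h : ∀ x ∈ M.cone, x m ≤ x m') : m ≤ m' :=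
  sub_nonneg.1 (M.nonneg_of_forall_cone fun x hx => by simpa using h x hx)

theorem eq_of_forall_cone {m m' : M.gp} (h : ∀ x ∈ M.cone, x m = x m') : m = m' :=
  le_antisymm (M.le_of_forall_cone fun x hx => (h x hx).le)
    (M.le_of_forall_cone fun x hx => (h x hx).ge)

theorem zero_mem_cone : (0 : M.gp →+ ℝ) ∈ M.cone := fun _ _ => le_rfl

theorem sum_mem_cone {ι : Type*} (s : Finset ι) (f : ι → M.gp →+ ℝ) (h : ∀ i ∈ s, f i ∈ M.cone) :
    ∑ i ∈ s, f i ∈ M.cone := by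
  intro m hm
  rw [AddMonoidHom.finsetSum_apply]
  exact Finset.sum_nonneg fun i hi => h i hi m hm

/-- A point in the interior of the cone. -/
theorem exists_mem_cone_pos : ∃ x ∈ M.cone, ∀ m, 0 ≤ m → m ≠ 0 → 0 < x m := by
  classical
  obtain ⟨s, hs⟩ := M.fg
  -- One point of the cone for each generator, positive there if the generator is nonzero. The sum
  -- of these points is positive on every nonzero generator, hence on every nonzero element of `M`.
  have key : ∀ m : M.gp, ∃ x ∈ M.cone, m ∈ s → m ≠ 0 → 0 < x m := by
    intro m
    by_cases hm : m ∈ s ∧ m ≠ 0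
    · have hm0 : 0 ≤ m := by
        rw [nonneg_iff_mem, ← hs]; exact AddSubmonoid.subset_closure hm.1
      have : ¬ ∀ x ∈ M.cone, x m = x 0 := fun h => hm.2 (M.eq_of_forall_cone h)
      push Not at this
      obtain ⟨x, hx, hxm⟩ := this
      rw [map_zero] at hxm
      exact ⟨x, hx, fun _ _ => lt_of_le_of_ne (M.cone_apply_nonneg hx hm0) hxm.symm⟩
    · exact ⟨0, M.zero_mem_cone, fun h1 h2 => absurd ⟨h1, h2⟩ hm⟩
  choose x hx hpos using key
  have hmem := M.sum_mem_cone s x (fun i _ => hx i)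
  refine ⟨∑ m ∈ s, x m, hmem, ?_⟩
  have : ∀ m ∈ AddSubmonoid.closure (s : Set M.gp), m = 0 ∨ 0 < (∑ m ∈ s, x m) m := by
    intro m hm
    induction hm using AddSubmonoid.closure_induction with
    | mem m hm =>
      by_cases h0 : m = 0
      · exact Or.inl h0
      · right
        have hm0 : 0 ≤ m := by
          rw [nonneg_iff_mem, ← hs]; exact AddSubmonoid.subset_closure hm
        rw [AddMonoidHom.finsetSum_apply]
        exact Finset.sum_pos' (fun i _ => M.cone_apply_nonneg (hx i) hm0) ⟨m, hm, hpos m hm h0⟩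
    | zero => exact Or.inl rfl
    | add a b _ _ ha hb =>
      rcases ha with rfl | ha
      · simpa using hb
      · rcases hb with rfl | hb
        · simpa using Or.inr ha
        · right; rw [map_add]; exact add_pos ha hb
  intro m hm h0
  rw [nonneg_iff_mem, ← hs] at hm
  exact (this m hm).resolve_left h0

/-- `M.gp` is free, so divisibility can be tested on coordinates. This translates the existence of
subdivision points into a condition on lattice points of the dual cone. -/
theorem exists_zsmul_eq_iff {s : ℤ} {m : M.gp} :
    (∃ p, s • p = m) ↔ ∀ x : M.gp →+ ℤ, s ∣ x m := by
  constructor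
  · rintro ⟨p, rfl⟩ x
    rw [map_zsmul, smul_eq_mul]
    exact dvd_mul_right _ _
  · intro h
    let b := Module.Free.chooseBasis ℤ M.gp
    choose c hc using fun i => h (b.coord i).toAddMonoidHom
    refine ⟨∑ i, c i • b i, ?_⟩
    rw [← b.sum_repr m, Finset.smul_sum]
    refine Finset.sum_congr rfl fun i _ => ?_
    rw [smul_smul, ← hc i]
    rfl

theorem zsmul_left_cancel {s : ℤ} (hs : s ≠ 0) {p q : M.gp} (h : s • p = s • q) : p = q :=
  zsmul_right_injective hs h

end ToricMonoid

/-- Each condition defines the kernel of a homomorphism to `ZMod |d i|`, which is finite as `d i ≠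
0`; finite intersections preserve finite index. -/
theorem finiteIndex_forall_dvd {G ι : Type*} [AddCommGroup G] [Finite ι] (d : ι → ℤ) (g : ι → G)
    (hd : ∀ i, d i ≠ 0) : ∃ L : AddSubgroup (G →+ ℤ), L.FiniteIndex ∧
      ∀ x, x ∈ L ↔ ∀ i, d i ∣ x (g i) := by
  have key : ∀ i, ∃ L : AddSubgroup (G →+ ℤ), L.FiniteIndex ∧ ∀ x, x ∈ L ↔ d i ∣ x (g i) := by
    intro i
    have : NeZero (d i).natAbs := ⟨by simpa using hd i⟩
    let F : (G →+ ℤ) →+ ZMod (d i).natAbs :=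
      (Int.castAddHom _).comp (AddMonoidHom.eval (g i))
    refine ⟨F.ker, AddSubgroup.finiteIndex_ker F, fun x => ?_⟩
    rw [AddMonoidHom.mem_ker]
    change ((x (g i) : ℤ) : ZMod (d i).natAbs) = 0 ↔ _
    rw [ZMod.intCast_zmod_eq_zero_iff_dvd]
    simp
  choose L hL hmem using key
  refine ⟨⨅ i, L i, AddSubgroup.finiteIndex_iInf hL, fun x => ?_⟩
  simp [AddSubgroup.mem_iInf, hmem]

end TropRub

namespace TropRub

/-! ### Semistable potentials on real metric graphs -/

namespace DualGraph

variable {n : ℕ} (Γ : DualGraph n)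

@[simp] theorem src_inv (h : Γ.D) : Γ.src (Γ.inv h) = Γ.tgt h := rfl

@[simp] theorem tgt_inv (h : Γ.D) : Γ.tgt (Γ.inv h) = Γ.src h := by rw [tgt, Γ.inv_inv]

/-- Reversal of orientation as a permutation. -/
def invEquiv : Γ.D ≃ Γ.D := ⟨Γ.inv, Γ.inv, Γ.inv_inv, Γ.inv_inv⟩

@[simp] theorem invEquiv_apply (h : Γ.D) : Γ.invEquiv h = Γ.inv h := rfl

open Classical in
/-- The oriented edges which enter `S`. -/
noncomputable def inEdges (S : Finset Γ.V) : Finset Γ.D :=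
  Finset.univ.filter fun h => Γ.src h ∉ S ∧ Γ.tgt h ∈ S

@[simp] theorem mem_inEdges {S : Finset Γ.V} {h : Γ.D} :
    h ∈ Γ.inEdges S ↔ Γ.src h ∉ S ∧ Γ.tgt h ∈ S := by simp [inEdges]

open Classical in
theorem sum_inEdges_compl {R : Type*} [AddCommMonoid R] (S : Finset Γ.V) (F : Γ.D → R) :
    ∑ h ∈ Γ.inEdges Sᶜ, F h = ∑ h ∈ Γ.inEdges S, F (Γ.inv h) := by
  refine Finset.sum_equiv Γ.invEquiv (fun h => ?_) fun h _ => ?_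
  · simp [and_comm]
  · simp [Γ.inv_inv]

theorem card_inEdges (S : Finset Γ.V) : (Γ.inEdges S).card = Γ.cut S := by
  refine Finset.card_equiv Γ.invEquiv fun h => ?_
  simp [and_comm]

open Classical in
theorem cut_compl (S : Finset Γ.V) : Γ.cut Sᶜ = Γ.cut S := by
  rw [← card_inEdges, ← card_inEdges, Finset.card_eq_sum_ones, Finset.card_eq_sum_ones,
    Γ.sum_inEdges_compl]

open Classical in
theorem sum_eq_sum_inEdges {R : Type*} [AddCommMonoid R] (S : Finset Γ.V) (F : Γ.D → R)
    (hF : ∀ h, (Γ.src h ∈ S ↔ Γ.tgt h ∈ S) → F h = 0) :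
    ∑ h, F h = ∑ h ∈ Γ.inEdges S, F h + ∑ h ∈ Γ.inEdges S, F (Γ.inv h) := by
  rw [← sum_inEdges_compl, ← Finset.sum_union]
  · refine (Finset.sum_subset (Finset.subset_univ _) fun h _ hh => hF h ?_).symm
    simp only [Finset.mem_union, mem_inEdges, Finset.mem_compl] at hh
    tauto
  · rw [Finset.disjoint_left]
    intro h h1 h2
    simp only [mem_inEdges, Finset.mem_compl] at h1 h2
    tauto

/-- The potential `a` on the metric graph `Γ` (edges of length zero being contracted) is
semistable: `c` is the difference of the divisor and the stability condition. -/
structure IsRealSolution (c : Γ.V → ℝ) (len : Γ.D → ℝ) (a : Γ.V → ℝ) : Prop where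
  eq_of_len_eq_zero : ∀ h, len h = 0 → a (Γ.tgt h) = a (Γ.src h)
  sum_le : ∀ S : Finset Γ.V, (∀ h ∈ Γ.inEdges S, len h ≠ 0) →
    ∑ v ∈ S, c v ≤ ∑ h ∈ Γ.inEdges S, ((⌊(a (Γ.tgt h) - a (Γ.src h)) / len h⌋ : ℝ) + 1 / 2)

variable {Γ} {c : Γ.V → ℝ} {len : Γ.D → ℝ}

-- Maximum principle. Let `S` be the set where `b - a` is maximal; along every edge entering `S` the
-- slope of `b` is strictly larger than that of `a`. Since `⌊x⌋ + ⌊-y⌋ ≤ -1` for `x < y`, the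
-- inequality for `a` on `S` and that for `b` on the complement add up to `0 ≤ 0`. Both are then
-- equalities, so `c(S) - E(S, Sᶜ)/2` is an integer, against non-degeneracy.
open Classical in
theorem IsRealSolution.sub_eq_sub (hlen : ∀ h, 0 ≤ len h) (hinv : ∀ h, len (Γ.inv h) = len h)
    (hc : ∑ v, c v = 0)
    (hnd : ∀ S : Finset Γ.V, S.Nonempty → S ≠ Finset.univ → ∀ m : ℤ,
      ∑ v ∈ S, c v - (Γ.cut S : ℝ) / 2 ≠ m)
    {a b : Γ.V → ℝ} (ha : Γ.IsRealSolution c len a) (hb : Γ.IsRealSolution c len b) (v w : Γ.V) :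
    b v - a v = b w - a w := by
  by_contra hne
  wlog hlt : b v - a v < b w - a w generalizing v w
  · exact this w v (Ne.symm hne) (lt_of_le_of_ne (not_lt.1 hlt) (Ne.symm hne))
  obtain ⟨u, -, hu⟩ := Finset.exists_max_image Finset.univ (fun v => b v - a v) ⟨v, Finset.mem_univ v⟩
  simp only [Finset.mem_univ, true_implies] at hu
  set S : Finset Γ.V := Finset.univ.filter fun v => b v - a v = b u - a u with hS
  have hlt' : ∀ h ∈ Γ.inEdges S,
      a (Γ.tgt h) - a (Γ.src h) < b (Γ.tgt h) - b (Γ.src h) := by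
    intro h hh
    simp only [mem_inEdges, hS, Finset.mem_filter, Finset.mem_univ, true_and] at hh
    have := lt_of_le_of_ne (hu (Γ.src h)) hh.1
    linarith [hh.2]
  have hpos : ∀ h ∈ Γ.inEdges S, len h ≠ 0 := by
    intro h hh h0
    have := hlt' h hh
    rw [ha.eq_of_len_eq_zero h h0, hb.eq_of_len_eq_zero h h0] at this
    simp at this
  have h1 := ha.sum_le S hpos
  have h2 := hb.sum_le Sᶜ (by
    intro h hh
    simp only [mem_inEdges, Finset.mem_compl, not_not] at hh
    rw [← hinv]
    exact hpos _ (by simpa [and_comm] using hh))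
  rw [sum_inEdges_compl] at h2
  have h3 := Finset.sum_add_sum_compl S c
  rw [hc] at h3
  have h4 : ∑ h ∈ Γ.inEdges S, ((⌊(a (Γ.tgt h) - a (Γ.src h)) / len h⌋ : ℝ) + 1 / 2) +
      ∑ h ∈ Γ.inEdges S, ((⌊(b (Γ.tgt (Γ.inv h)) - b (Γ.src (Γ.inv h))) / len (Γ.inv h)⌋ : ℝ)
        + 1 / 2) ≤ 0 := by
    rw [← Finset.sum_add_distrib]
    refine Finset.sum_nonpos fun h hh => ?_
    have hl : 0 < len h := lt_of_le_of_ne (hlen h) (hpos h hh).symm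
    have hd := div_lt_div_of_pos_right (hlt' h hh) hl
    rw [hinv, tgt_inv, src_inv]
    have e1 := Int.floor_le ((a (Γ.tgt h) - a (Γ.src h)) / len h)
    have e2 := Int.floor_le ((b (Γ.src h) - b (Γ.tgt h)) / len h)
    have e3 : (b (Γ.src h) - b (Γ.tgt h)) / len h = -((b (Γ.tgt h) - b (Γ.src h)) / len h) := by
      ring
    have e4 : ((⌊(a (Γ.tgt h) - a (Γ.src h)) / len h⌋ + ⌊(b (Γ.src h) - b (Γ.tgt h)) / len h⌋ : ℤ)
        : ℝ) < 0 := by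
      push_cast
      linarith
    have e5 : ⌊(a (Γ.tgt h) - a (Γ.src h)) / len h⌋ + ⌊(b (Γ.src h) - b (Γ.tgt h)) / len h⌋ ≤ -1 := by
      have := Int.cast_lt_zero.1 e4
      omega
    have e6 : ((⌊(a (Γ.tgt h) - a (Γ.src h)) / len h⌋ + ⌊(b (Γ.src h) - b (Γ.tgt h)) / len h⌋ : ℤ)
        : ℝ) ≤ ((-1 : ℤ) : ℝ) := Int.cast_le.2 e5
    push_cast at e6
    linarith
  refine hnd S ⟨u, by simp [hS]⟩ (fun h => ?_) (∑ h ∈ Γ.inEdges S, ⌊(a (Γ.tgt h) - a (Γ.src h)) / len h⌋) ?_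
  · have hv : v ∈ S := h ▸ Finset.mem_univ v
    simp only [hS, Finset.mem_filter, Finset.mem_univ, true_and] at hv
    linarith [hu w]
  · have h5 : ∑ v ∈ S, c v =
        ∑ h ∈ Γ.inEdges S, ((⌊(a (Γ.tgt h) - a (Γ.src h)) / len h⌋ : ℝ) + 1 / 2) := by linarith
    rw [h5, Finset.sum_add_distrib, Finset.sum_const, card_inEdges]
    push_cast
    rw [nsmul_eq_mul]
    ring

-- Take for `S` the sublevel set of `a` at the final vertex of `h`. All edges entering `S` have
-- negative slope, so each contributes a nonpositive term and none of them can fall far below `-∑ |c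
-- v|`. The resulting bound leaves finitely many integral slopes to consider on the whole cone.
open Classical in
theorem IsRealSolution.neg_le_div (hlen : ∀ h, 0 ≤ len h)
    {a : Γ.V → ℝ} (ha : Γ.IsRealSolution c len a) (h : Γ.D) :
    -(∑ v, |c v| + 1 / 2) ≤ (a (Γ.tgt h) - a (Γ.src h)) / len h := by
  have hC : 0 ≤ ∑ v, |c v| := Finset.sum_nonneg fun _ _ => abs_nonneg _
  by_cases hneg : 0 ≤ a (Γ.tgt h) - a (Γ.src h)
  · have := div_nonneg hneg (hlen h)
    linarith
  push Not at hneg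
  set S : Finset Γ.V := Finset.univ.filter fun v => a v ≤ a (Γ.tgt h) with hS
  have hin : ∀ k ∈ Γ.inEdges S, a (Γ.tgt k) - a (Γ.src k) < 0 := by
    intro k hk
    simp only [mem_inEdges, hS, Finset.mem_filter, Finset.mem_univ, true_and, not_le] at hk
    linarith
  have hh : h ∈ Γ.inEdges S := by
    simp only [mem_inEdges, hS, Finset.mem_filter, Finset.mem_univ, true_and, not_le, le_refl,
      and_true]
    linarith
  have h0 : ∀ k ∈ Γ.inEdges S, len k ≠ 0 := by
    intro k hk hk0
    have := hin k hk
    rw [ha.eq_of_len_eq_zero k hk0] at this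
    simp at this
  have h1 := ha.sum_le S h0
  have h2 : ∀ k ∈ Γ.inEdges S, ((⌊(a (Γ.tgt k) - a (Γ.src k)) / len k⌋ : ℝ) + 1 / 2) ≤ 0 := by
    intro k hk
    have : (a (Γ.tgt k) - a (Γ.src k)) / len k < 0 :=
      div_neg_of_neg_of_pos (hin k hk) (lt_of_le_of_ne (hlen k) (h0 k hk).symm)
    have : ⌊(a (Γ.tgt k) - a (Γ.src k)) / len k⌋ ≤ -1 := by
      have := Int.floor_lt.2 (by exact_mod_cast this : (a (Γ.tgt k) - a (Γ.src k)) / len k < ((0 : ℤ) : ℝ))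
      omega
    have := (Int.cast_le (R := ℝ)).2 this
    push_cast at this
    linarith
  have h3 := Finset.add_sum_erase _
    (fun k => (⌊(a (Γ.tgt k) - a (Γ.src k)) / len k⌋ : ℝ) + 1 / 2) hh
  have h4 := Finset.sum_nonpos fun k (hk : k ∈ (Γ.inEdges S).erase h) => h2 k (Finset.mem_of_mem_erase hk)
  have h5 : -∑ v, |c v| ≤ ∑ v ∈ S, c v := by
    rw [neg_le]
    calc -∑ v ∈ S, c v = ∑ v ∈ S, -c v := by rw [Finset.sum_neg_distrib]
      _ ≤ ∑ v ∈ S, |c v| := Finset.sum_le_sum fun v _ => neg_le_abs _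
      _ ≤ ∑ v, |c v| := Finset.sum_le_sum_of_subset_of_nonneg (Finset.subset_univ _)
          fun v _ _ => abs_nonneg _
  have h6 := Int.floor_le ((a (Γ.tgt h) - a (Γ.src h)) / len h)
  linarith

/-- The slopes of a semistable potential are bounded independently of the lengths. -/
theorem IsRealSolution.abs_div_le (hlen : ∀ h, 0 ≤ len h) (hinv : ∀ h, len (Γ.inv h) = len h)
    {a : Γ.V → ℝ} (ha : Γ.IsRealSolution c len a) (h : Γ.D) :
    |(a (Γ.tgt h) - a (Γ.src h)) / len h| ≤ ∑ v, |c v| + 1 / 2 := by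
  rw [abs_le]
  refine ⟨ha.neg_le_div hlen h, ?_⟩
  have := ha.neg_le_div hlen (Γ.inv h)
  rw [hinv, tgt_inv, src_inv, ← neg_sub, neg_div] at this
  linarith

end DualGraph

/-! ### Existence of semistable potentials by minimizing an energy -/

/-- The piecewise linear interpolation of `t ^ 2 / 2` at the integers. -/
noncomputable def interp (t : ℝ) : ℝ := t ^ 2 / 2 + Int.fract t * (1 - Int.fract t) / 2

/-- The right derivative of `interp` at `t` is thus `⌊t⌋ + 1/2`, the summand in
`IsRealSolution.sum_le`; this is what dictates the choice of `interp`. -/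
theorem interp_eq {t : ℝ} {k : ℤ} (h1 : k ≤ t) (h2 : t ≤ k + 1) :
    interp t = (k + 1 / 2) * t - k * (k + 1) / 2 := by
  unfold interp
  rcases h2.lt_or_eq with h2 | rfl
  · have : ⌊t⌋ = k := Int.floor_eq_iff.2 ⟨h1, h2⟩
    rw [Int.fract, this]
    ring
  · have : Int.fract ((k : ℝ) + 1) = 0 := by
      rw [show ((k : ℝ) + 1) = ((k + 1 : ℤ) : ℝ) by push_cast; ring, Int.fract_intCast]
    rw [this]
    ring

theorem interp_neg (t : ℝ) : interp (-t) = interp t := by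
  have h1 := Int.floor_le t
  have h2 := (Int.lt_floor_add_one t).le
  rw [interp_eq h1 h2, interp_eq (k := -⌊t⌋ - 1) (by push_cast; linarith) (by push_cast; linarith)]
  push_cast
  ring

/-- Quadratic growth, the source of coercivity of the energy. -/
theorem sq_div_two_le_interp (t : ℝ) : t ^ 2 / 2 ≤ interp t := by
  have h1 := Int.fract_nonneg t
  have h2 := (Int.fract_lt_one t).le
  have := mul_nonneg h1 (sub_nonneg.2 h2)
  unfold interp
  linarith

theorem interp_zero : interp 0 = 0 := by simp [interp]

theorem continuous_interp : Continuous interp := by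
  have : Continuous fun t : ℝ => Int.fract t * (1 - Int.fract t) := by
    refine ContinuousOn.comp_fract'' (f := fun t : ℝ => t * (1 - t)) ?_ (by simp)
    fun_prop
  unfold interp
  fun_prop

theorem exists_pos_forall_le {ι : Type*} (s : Finset ι) (f : ι → ℝ) (hf : ∀ i ∈ s, 0 < f i) :
    ∃ ε > 0, ∀ i ∈ s, ε ≤ f i := by
  classical
  induction s using Finset.induction_on with
  | empty => exact ⟨1, one_pos, by simp⟩
  | insert i s _ ih =>
    obtain ⟨ε, hε, h⟩ := ih fun j hj => hf j (Finset.mem_insert_of_mem hj)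
    refine ⟨min ε (f i), lt_min hε (hf i (Finset.mem_insert_self _ _)), fun j hj => ?_⟩
    rcases Finset.mem_insert.1 hj with rfl | hj
    · exact min_le_right _ _
    · exact (min_le_left _ _).trans (h j hj)

namespace DualGraph

variable {n : ℕ} {Γ : DualGraph n} {c : Γ.V → ℝ} {len : Γ.D → ℝ}

/-- The energy of a potential; its minima are the semistable potentials. -/
noncomputable def energy (c : Γ.V → ℝ) (len : Γ.D → ℝ) (a : Γ.V → ℝ) : ℝ :=
  (∑ h, len h * interp ((a (Γ.tgt h) - a (Γ.src h)) / len h)) / 2 - ∑ v, c v * a v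

theorem continuous_energy : Continuous (energy c len) := by
  unfold energy
  have := continuous_interp
  fun_prop

theorem energy_add_const (hc : ∑ v, c v = 0) (a : Γ.V → ℝ) (t : ℝ) :
    energy c len (fun v => a v + t) = energy c len a := by
  simp only [energy, add_sub_add_right_eq_sub, mul_add, Finset.sum_add_distrib, ← Finset.sum_mul,
    hc, zero_mul, add_zero]

/-- Telescoping along a path from `v` to `w`. -/
theorem abs_le_of_connected {v w : Γ.V}
    (hconn : Relation.ReflTransGen (fun a b => ∃ h, Γ.src h = a ∧ Γ.tgt h = b) v w) :
    ∃ C : ℝ, 0 ≤ C ∧ ∀ a : Γ.V → ℝ, a v = 0 → |a w| ≤ C * ∑ h, |a (Γ.tgt h) - a (Γ.src h)| := by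
  induction hconn with
  | refl => exact ⟨0, le_rfl, fun a ha => by simp [ha]⟩
  | tail _ hstep ih =>
    obtain ⟨C, hC, ih⟩ := ih
    obtain ⟨h, rfl, rfl⟩ := hstep
    refine ⟨C + 1, by linarith, fun a ha => ?_⟩
    have h1 := ih a ha
    have h2 : |a (Γ.tgt h) - a (Γ.src h)| ≤ ∑ h, |a (Γ.tgt h) - a (Γ.src h)| :=
      Finset.single_le_sum (f := fun h => |a (Γ.tgt h) - a (Γ.src h)|)
        (fun _ _ => abs_nonneg _) (Finset.mem_univ h)
    have h3 := abs_add_le (a (Γ.src h)) (a (Γ.tgt h) - a (Γ.src h))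
    rw [add_sub_cancel] at h3
    linarith

/-- Coercivity. Let `s` be the total variation of `a`. By connectedness the linear term of the
energy is at most a constant times `s`, while quadratic growth and Cauchy-Schwarz bound the other
term below by a positive constant times `s ^ 2`. -/
theorem exists_norm_le_of_energy_nonpos (hlen : ∀ h, 0 ≤ len h) {v₀ : Γ.V}
    (hconn : ∀ w, Relation.ReflTransGen (fun a b => ∃ h, Γ.src h = a ∧ Γ.tgt h = b) v₀ w) :
    ∃ R : ℝ, ∀ a : Γ.V → ℝ, a v₀ = 0 → (∀ h, len h = 0 → a (Γ.tgt h) = a (Γ.src h)) →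
      energy c len a ≤ 0 → ‖a‖ ≤ R := by
  choose C hC0 hC using fun w => abs_le_of_connected (hconn w)
  set C₁ := ∑ w, C w with hC₁
  have hC₁0 : 0 ≤ C₁ := Finset.sum_nonneg fun w _ => hC0 w
  set K := ∑ v, |c v| with hK
  have hK0 : 0 ≤ K := Finset.sum_nonneg fun w _ => abs_nonneg _
  -- A common bound for all lengths; the summand `1`, here and in `N`, keeps the constants positive
  -- when there are no edges or all lengths vanish.
  set Λ := 1 + ∑ h, len h with hΛ
  have hs0 : 0 ≤ ∑ h, len h := Finset.sum_nonneg fun w _ => hlen w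
  have hΛ0 : 0 < Λ := by linarith
  set N : ℝ := (Finset.univ : Finset Γ.D).card + 1 with hN
  have hN0 : 0 < N := by positivity
  refine ⟨C₁ * (4 * Λ * N * (K * C₁)), fun a ha hzero hE => ?_⟩
  set s := ∑ h, |a (Γ.tgt h) - a (Γ.src h)| with hs
  have hs0 : 0 ≤ s := Finset.sum_nonneg fun _ _ => abs_nonneg _
  have hbound : ∀ w, |a w| ≤ C₁ * s := fun w =>
    (hC w a ha).trans (mul_le_mul_of_nonneg_right
      (Finset.single_le_sum (fun w _ => hC0 w) (Finset.mem_univ w)) hs0)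
  have h1 : ∑ v, c v * a v ≤ K * (C₁ * s) := by
    rw [hK, Finset.sum_mul]
    refine Finset.sum_le_sum fun v _ => (le_abs_self _).trans ?_
    rw [abs_mul]
    exact mul_le_mul_of_nonneg_left (hbound v) (abs_nonneg _)
  have h2 : ∀ h, |a (Γ.tgt h) - a (Γ.src h)| ^ 2 / (2 * Λ) ≤
      len h * interp ((a (Γ.tgt h) - a (Γ.src h)) / len h) := by
    intro h
    by_cases h0 : len h = 0
    · rw [hzero h h0, h0]
      simp
    · have hpos : 0 < len h := lt_of_le_of_ne (hlen h) (Ne.symm h0)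
      have hle : len h ≤ Λ := by
        have := Finset.single_le_sum (fun h _ => hlen h) (Finset.mem_univ h)
        linarith
      calc |a (Γ.tgt h) - a (Γ.src h)| ^ 2 / (2 * Λ)
          ≤ |a (Γ.tgt h) - a (Γ.src h)| ^ 2 / (2 * len h) := by gcongr
        _ = len h * (((a (Γ.tgt h) - a (Γ.src h)) / len h) ^ 2 / 2) := by
            rw [sq_abs]; field_simp
        _ ≤ _ := mul_le_mul_of_nonneg_left (sq_div_two_le_interp _) hpos.le
  have h3 : s ^ 2 ≤ N * ∑ h, |a (Γ.tgt h) - a (Γ.src h)| ^ 2 := by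
    have h4 : 0 ≤ ∑ h, |a (Γ.tgt h) - a (Γ.src h)| ^ 2 := Finset.sum_nonneg fun _ _ => sq_nonneg _
    have := sq_sum_le_card_mul_sum_sq (s := Finset.univ)
      (f := fun h => |a (Γ.tgt h) - a (Γ.src h)|)
    rw [hN, add_mul, one_mul]
    linarith
  have h5 := Finset.sum_le_sum fun h (_ : h ∈ Finset.univ) => h2 h
  rw [← Finset.sum_div] at h5
  set Q := ∑ h, |a (Γ.tgt h) - a (Γ.src h)| ^ 2 with hQ
  have h6 : Q / (2 * Λ) ≤ 2 * (K * (C₁ * s)) := by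
    unfold energy at hE
    linarith
  rw [div_le_iff₀ (by positivity)] at h6
  have h7 : s ≤ 4 * Λ * N * (K * C₁) := by
    by_contra hlt
    push Not at hlt
    have hpos : 0 < s := lt_of_le_of_lt (by positivity) hlt
    have h8 : s * s ≤ s * (4 * Λ * N * (K * C₁)) := by
      have := mul_le_mul_of_nonneg_left h6 hN0.le
      nlinarith
    exact absurd (le_of_mul_le_mul_left h8 hpos) (not_le.2 hlt)
  rw [pi_norm_le_iff_of_nonneg (by positivity)]
  intro v
  exact (hbound v).trans (mul_le_mul_of_nonneg_left h7 hC₁0)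

/-- Compactness. Adding a constant does not change the energy because `c` sums to zero, so
potentials may be normalized at `v₀`; those of nonpositive energy then lie in a ball, and the others
lose against the zero potential. Edges of length zero contribute nothing to the energy and enter as
a closed linear constraint instead. -/
theorem exists_energy_min (hlen : ∀ h, 0 ≤ len h) (hc : ∑ v, c v = 0) {v₀ : Γ.V}
    (hconn : ∀ w, Relation.ReflTransGen (fun a b => ∃ h, Γ.src h = a ∧ Γ.tgt h = b) v₀ w) :
    ∃ a : Γ.V → ℝ, a v₀ = 0 ∧ (∀ h, len h = 0 → a (Γ.tgt h) = a (Γ.src h)) ∧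
      ∀ b : Γ.V → ℝ, (∀ h, len h = 0 → b (Γ.tgt h) = b (Γ.src h)) →
        energy c len a ≤ energy c len b := by
  obtain ⟨R, hR⟩ := exists_norm_le_of_energy_nonpos (c := c) hlen hconn
  set K : Set (Γ.V → ℝ) := {a | a v₀ = 0 ∧ ∀ h, len h = 0 → a (Γ.tgt h) = a (Γ.src h)} with hK
  have hKc : IsClosed K := by
    have : K = {a | a v₀ = 0} ∩ ⋂ h, {a | len h = 0 → a (Γ.tgt h) = a (Γ.src h)} := by
      ext a; simp [hK]
    rw [this]
    refine (isClosed_eq (continuous_apply _) continuous_const).inter (isClosed_iInter fun h => ?_)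
    by_cases h0 : len h = 0
    · simpa [h0] using isClosed_eq (continuous_apply (Γ.tgt h)) (continuous_apply (Γ.src h))
    · simp [h0]
  have h0K : (0 : Γ.V → ℝ) ∈ K := ⟨rfl, fun _ _ => rfl⟩
  have hE0 : energy c len 0 = 0 := by simp [energy, interp_zero]
  have hcomp : IsCompact (K ∩ Metric.closedBall 0 |R|) :=
    (isCompact_closedBall _ _).inter_left hKc
  obtain ⟨a, ⟨haK, -⟩, hmin⟩ := hcomp.exists_isMinOn ⟨0, h0K, by simp⟩
    (continuous_energy (c := c) (len := len)).continuousOn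
  refine ⟨a, haK.1, haK.2, fun b hb => ?_⟩
  have hb' : energy c len (fun v => b v + -b v₀) = energy c len b := energy_add_const hc b _
  rw [← hb']
  have hbK : (fun v => b v + -b v₀) ∈ K := ⟨by simp, fun h h0 => by simp [hb h h0]⟩
  by_cases hle : energy c len (fun v => b v + -b v₀) ≤ 0
  · refine hmin ⟨hbK, ?_⟩
    rw [mem_closedBall_zero_iff]
    exact (hR _ hbK.1 hbK.2 hle).trans (le_abs_self R)
  · have h1 : energy c len a ≤ energy c len 0 := hmin ⟨h0K, by simp⟩
    linarith

-- Raising a minimizer by a small `ε` on `S` changes the energy by `ε` times the difference of the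
-- two sides of `sum_le`, and this change cannot be negative.
open Classical in
theorem exists_isRealSolution (hlen : ∀ h, 0 ≤ len h) (hinv : ∀ h, len (Γ.inv h) = len h)
    (hc : ∑ v, c v = 0) {v₀ : Γ.V}
    (hconn : ∀ w, Relation.ReflTransGen (fun a b => ∃ h, Γ.src h = a ∧ Γ.tgt h = b) v₀ w) :
    ∃ a : Γ.V → ℝ, a v₀ = 0 ∧ Γ.IsRealSolution c len a := by
  obtain ⟨a, ha0, hazero, hmin⟩ := exists_energy_min (c := c) hlen hc hconn
  refine ⟨a, ha0, hazero, fun S hS => ?_⟩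
  have hpos : ∀ h ∈ Γ.inEdges S, 0 < len h := fun h hh => lt_of_le_of_ne (hlen h) (hS h hh).symm
  -- `ε` is so small that no slope along an edge entering `S` passes the next integer; `interp` is
  -- then linear on the interval involved.
  obtain ⟨ε, hε, hεle⟩ := exists_pos_forall_le (Γ.inEdges S)
    (fun h => (⌊(a (Γ.tgt h) - a (Γ.src h)) / len h⌋ + 1) * len h - (a (Γ.tgt h) - a (Γ.src h)))
    (fun h hh => by
      have := (div_lt_iff₀ (hpos h hh)).1
        (Int.lt_floor_add_one ((a (Γ.tgt h) - a (Γ.src h)) / len h))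
      linarith)
  set b : Γ.V → ℝ := fun v => a v + if v ∈ S then ε else 0 with hb
  -- No edge of length zero crosses the boundary of `S`, so `b` still satisfies the constraint of
  -- the minimization.
  have hbzero : ∀ h, len h = 0 → b (Γ.tgt h) = b (Γ.src h) := by
    intro h h0
    have : Γ.src h ∈ S ↔ Γ.tgt h ∈ S := by
      constructor
      · intro h1
        by_contra h2
        exact hS (Γ.inv h) (by simp [h1, h2]) (by rw [hinv, h0])
      · intro h1
        by_contra h2
        exact hS h (by simp [h1, h2]) h0
    simp only [hb, hazero h h0, this]
  have hle := hmin b hbzero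
  set F : Γ.D → ℝ := fun h => len h * interp ((b (Γ.tgt h) - b (Γ.src h)) / len h) -
    len h * interp ((a (Γ.tgt h) - a (Γ.src h)) / len h) with hF
  have hFinv : ∀ h, F (Γ.inv h) = F h := by
    intro h
    simp only [hF, hinv, tgt_inv, src_inv]
    rw [← neg_sub (b _), ← neg_sub (a _), neg_div, neg_div, interp_neg, interp_neg]
  have hFin : ∀ h ∈ Γ.inEdges S, F h =
      ε * ((⌊(a (Γ.tgt h) - a (Γ.src h)) / len h⌋ : ℝ) + 1 / 2) := by
    intro h hh
    have hl := hpos h hh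
    have hl' := hε
    have hmem := Γ.mem_inEdges.1 hh
    have e1 := Int.floor_le ((a (Γ.tgt h) - a (Γ.src h)) / len h)
    have e2 := (Int.lt_floor_add_one ((a (Γ.tgt h) - a (Γ.src h)) / len h)).le
    have e3 : b (Γ.tgt h) - b (Γ.src h) = a (Γ.tgt h) - a (Γ.src h) + ε := by
      simp only [hb, hmem.1, hmem.2, if_true, if_false]; ring
    have e4 := hεle h hh
    have e5 : (b (Γ.tgt h) - b (Γ.src h)) / len h ≤
        (⌊(a (Γ.tgt h) - a (Γ.src h)) / len h⌋ : ℝ) + 1 := by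
      rw [div_le_iff₀ hl, e3]; linarith
    have e6 : (⌊(a (Γ.tgt h) - a (Γ.src h)) / len h⌋ : ℝ) ≤
        (b (Γ.tgt h) - b (Γ.src h)) / len h := by
      refine e1.trans (div_le_div_of_nonneg_right ?_ hl.le)
      linarith
    simp only [hF]
    rw [interp_eq e1 e2, interp_eq e6 e5, e3]
    field_simp
    ring
  -- The two orientations of a crossing edge contribute equally; the factor `2` cancels the `/ 2` in
  -- `energy`.
  have hsum : ∑ h, F h = 2 * ∑ h ∈ Γ.inEdges S, F h := by
    rw [Γ.sum_eq_sum_inEdges S F, two_mul]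
    · simp only [hFinv]
    · intro h hh
      have : b (Γ.tgt h) - b (Γ.src h) = a (Γ.tgt h) - a (Γ.src h) := by
        simp only [hb, hh]; ring
      simp only [hF, this, sub_self]
  rw [Finset.sum_congr rfl hFin, ← Finset.mul_sum] at hsum
  have hcb : ∑ v, c v * b v = ∑ v, c v * a v + ε * ∑ v ∈ S, c v := by
    simp only [hb, mul_add, Finset.sum_add_distrib, mul_ite, mul_zero, Finset.sum_ite_mem,
      Finset.univ_inter, mul_comm ε, Finset.sum_mul]
  have hFsum : ∑ h, F h = ∑ h, len h * interp ((b (Γ.tgt h) - b (Γ.src h)) / len h) -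
      ∑ h, len h * interp ((a (Γ.tgt h) - a (Γ.src h)) / len h) := by
    simp only [hF, Finset.sum_sub_distrib]
  unfold energy at hle
  rw [hcb] at hle
  have : ε * ∑ v ∈ S, c v ≤
      ε * ∑ h ∈ Γ.inEdges S, ((⌊(a (Γ.tgt h) - a (Γ.src h)) / len h⌋ : ℝ) + 1 / 2) := by linarith
  exact le_of_mul_le_mul_left this hε

end DualGraph
end TropRub

namespace TropRub

/-! ### Fans cut out by piecewise linear functions -/

/-- The sign of `a` is that of `b`, or `a = 0`. -/
def SignCompat (a b : ℝ) : Prop := (0 ≤ b → 0 ≤ a) ∧ (b ≤ 0 → a ≤ 0)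

namespace SignCompat

theorem refl (a : ℝ) : SignCompat a a := ⟨id, id⟩

theorem trans {a b c : ℝ} (h : SignCompat a b) (h' : SignCompat b c) : SignCompat a c :=
  ⟨fun hc => h.1 (h'.1 hc), fun hc => h.2 (h'.2 hc)⟩

theorem zero (b : ℝ) : SignCompat 0 b := ⟨fun _ => le_rfl, fun _ => le_rfl⟩

theorem eq_zero {a b : ℝ} (h : SignCompat a b) (hb : b = 0) : a = 0 :=
  le_antisymm (h.2 hb.le) (h.1 hb.ge)

theorem sum {ι : Type*} {s : Finset ι} {a : ι → ℝ} {b : ℝ} (h : ∀ i ∈ s, SignCompat (a i) b) :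
    SignCompat (∑ i ∈ s, a i) b :=
  ⟨fun hb => Finset.sum_nonneg fun i hi => (h i hi).1 hb,
    fun hb => Finset.sum_nonpos fun i hi => (h i hi).2 hb⟩

theorem eq_zero_of_sum_eq_zero {ι : Type*} {s : Finset ι} {a : ι → ℝ} {b : ℝ}
    (h : ∀ i ∈ s, SignCompat (a i) b) (h0 : ∑ i ∈ s, a i = 0) : ∀ i ∈ s, a i = 0 := by
  rcases le_total 0 b with hb | hb
  · exact (Finset.sum_eq_zero_iff_of_nonneg fun i hi => (h i hi).1 hb).1 h0
  · exact (Finset.sum_eq_zero_iff_of_nonpos fun i hi => (h i hi).2 hb).1 h0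

theorem iff_sign (a b : ℝ) : SignCompat a b ↔
    (0 ≤ SignType.sign b → 0 ≤ a) ∧ (SignType.sign b ≤ 0 → a ≤ 0) := by
  simp [SignCompat, sign_nonneg_iff, sign_nonpos_iff]

end SignCompat

/-- Provides a `t > 0` for which passing from `y` to `y - t x` does not change signs. This lets a
segment be prolonged beyond `y` inside a cone. -/
theorem exists_pos_forall_mul_abs_le {ι : Type*} (s : Finset ι) (x y : ι → ℝ)
    (h : ∀ i ∈ s, y i = 0 → x i = 0) : ∃ t > 0, ∀ i ∈ s, t * |x i| ≤ |y i| := by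
  obtain ⟨t, ht, hle⟩ := exists_pos_forall_le s
    (fun i => if y i = 0 then 1 else |y i| / (|x i| + 1)) (fun i _ => by
      split_ifs with h0
      · exact one_pos
      · have := abs_pos.2 h0
        positivity)
  refine ⟨t, ht, fun i hi => ?_⟩
  have h1 := hle i hi
  by_cases h0 : y i = 0
  · simp [h i hi h0]
  · rw [if_neg h0, le_div_iff₀ (by positivity)] at h1
    linarith

namespace ToricMonoid

variable (M : ToricMonoid)

theorem mem_cone_of_generators {s : Finset M.gp} (hs : AddSubmonoid.closure (s : Set M.gp) = M.mon)
    {x : M.gp →+ ℝ} (hx : ∀ m ∈ s, 0 ≤ x m) : x ∈ M.cone := by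
  intro m hm
  rw [← hs] at hm
  induction hm using AddSubmonoid.closure_induction with
  | mem m hm => exact hx m hm
  | zero => simp
  | add a b _ _ ha hb => rw [map_add]; exact add_nonneg ha hb

section Fan

variable {J : Type*} (f : J → (M.gp →+ ℝ) → ℝ)

/-- The cone of the points at which the signs of the functions `f j` are degenerations of those at
`x₀`. -/
def signCone (x₀ : M.gp →+ ℝ) : Set (M.gp →+ ℝ) :=
  {x ∈ M.cone | ∀ j, SignCompat (f j x) (f j x₀)}

variable {M f}

/-- The alternative in `hu` allows the possibly nonlinear `f j` to be exchanged for the linear forms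
`u j` in both directions, which shows that sign cones are polyhedral and rational. -/
theorem signCone_eq {x₀ : M.gp →+ ℝ} {u : J → M.gp}
    (hu : ∀ x ∈ M.cone, ((∀ j, SignCompat (x (u j)) (f j x₀)) ∨
      ∀ j, SignCompat (f j x) (f j x₀)) → ∀ j, f j x = x (u j)) :
    M.signCone f x₀ = {x ∈ M.cone | ∀ j, SignCompat (x (u j)) (f j x₀)} := by
  ext x
  constructor
  · rintro ⟨h1, h2⟩
    exact ⟨h1, fun j => hu x h1 (Or.inr h2) j ▸ h2 j⟩
  · rintro ⟨h1, h2⟩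
    exact ⟨h1, fun j => (hu x h1 (Or.inl h2) j).symm ▸ h2 j⟩

/-- There are finitely many sign vectors, and each point lies in its own sign cone, which settles
finiteness and support. What needs an argument is that intersections are faces and that every face
is again a sign cone, namely that of a point in its relative interior. -/
theorem exists_coneSubdivision [Finite J]
    (hlin : ∀ x₀ ∈ M.cone, ∃ u : J → M.gp, ∀ x ∈ M.cone,
      ((∀ j, SignCompat (x (u j)) (f j x₀)) ∨ ∀ j, SignCompat (f j x) (f j x₀)) →
        ∀ j, f j x = x (u j))
    (hmon : ∀ x₀ ∈ M.cone, ∀ x ∈ M.signCone f x₀, ∀ m ∈ M.mon, x₀ m = 0 → x m = 0) :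
    ∃ Δ : ConeSubdivision M, ∀ τ, τ ∈ Δ.cones ↔ ∃ x₀ ∈ M.cone, τ = M.signCone f x₀ := by
  classical
  have := Fintype.ofFinite J
  choose! u hu using hlin
  have heq : ∀ x₀ ∈ M.cone, M.signCone f x₀ =
      {x ∈ M.cone | ∀ j, SignCompat (x (u x₀ j)) (f j x₀)} := fun x₀ h => signCone_eq (hu x₀ h)
  have hval : ∀ x₀ ∈ M.cone, ∀ x ∈ M.signCone f x₀, ∀ j, f j x = x (u x₀ j) :=
    fun x₀ h x hx => hu x₀ h x hx.1 (Or.inr hx.2)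
  have hinter : ∀ x₀ ∈ M.cone, ∀ x₁ ∈ M.cone,
      M.IsFace (M.signCone f x₀ ∩ M.signCone f x₁) (M.signCone f x₀) := by
    intro x₀ h₀ x₁ h₁
    -- `w j` is nonnegative on the cone of `x₀` and vanishes exactly where the sign of `f j` is also
    -- compatible with `x₁`; the sum of the `w j` therefore cuts out the intersection as a face.
    set w : J → M.gp := fun j =>
      if 0 < f j x₀ ∧ f j x₁ ≤ 0 then u x₀ j else if f j x₀ < 0 ∧ 0 ≤ f j x₁ then -u x₀ j else 0
      with hw
    have hw0 : ∀ x ∈ M.signCone f x₀, ∀ j, 0 ≤ x (w j) := by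
      intro x hx j
      have h1 := hval x₀ h₀ x hx j
      have h2 := hx.2 j
      simp only [hw]
      split_ifs with h3 h4
      · rw [← h1]; exact h2.1 h3.1.le
      · rw [map_neg, ← h1]; linarith [h2.2 h4.1.le]
      · simp
    refine ⟨∑ j, w j, fun x hx => ?_, ?_⟩
    · rw [map_sum]
      exact Finset.sum_nonneg fun j _ => hw0 x hx j
    · ext x
      simp only [Set.mem_inter_iff, Set.mem_ofPred_eq, and_congr_right_iff]
      intro hx
      rw [map_sum, Finset.sum_eq_zero_iff_of_nonneg fun j _ => hw0 x hx j]
      have key : ∀ j, SignCompat (f j x) (f j x₁) ↔ x (w j) = 0 := by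
        intro j
        have h1 := hval x₀ h₀ x hx j
        have h2 := hx.2 j
        simp only [hw]
        split_ifs with h3 h4
        · rw [← h1]
          refine ⟨fun h => le_antisymm (h.2 h3.2) (h2.1 h3.1.le), fun h => ?_⟩
          rw [h]; exact SignCompat.zero _
        · rw [map_neg, ← h1, neg_eq_zero]
          refine ⟨fun h => le_antisymm (h2.2 h4.1.le) (h.1 h4.2), fun h => ?_⟩
          rw [h]; exact SignCompat.zero _
        · simp only [map_zero, iff_true]
          rcases lt_trichotomy (f j x₀) 0 with h5 | h5 | h5
          · have h6 : f j x₁ < 0 := by by_contra h; exact h4 ⟨h5, not_lt.1 h⟩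
            exact ⟨fun h => absurd h (not_le.2 h6), fun _ => h2.2 h5.le⟩
          · rw [h2.eq_zero h5]; exact SignCompat.zero _
          · have h6 : 0 < f j x₁ := by by_contra h; exact h3 ⟨h5, not_lt.1 h⟩
            exact ⟨fun _ => h2.1 h5.le, fun h => absurd h (not_le.2 h6)⟩
      constructor
      · intro h j _
        exact (key j).1 (h.2 j)
      · intro h
        exact ⟨hx.1, fun j => (key j).2 (h j (Finset.mem_univ j))⟩
  refine ⟨⟨{τ | ∃ x₀ ∈ M.cone, τ = M.signCone f x₀}, ?_, ?_, ?_, ?_, ?_⟩, fun τ => Iff.rfl⟩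
  · refine (Set.finite_range fun ε : J → SignType =>
      {x ∈ M.cone | ∀ j, (0 ≤ ε j → 0 ≤ f j x) ∧ (ε j ≤ 0 → f j x ≤ 0)}).subset ?_
    rintro _ ⟨x₀, -, rfl⟩
    refine ⟨fun j => SignType.sign (f j x₀), ?_⟩
    simp only [signCone, SignCompat.iff_sign]
  · rintro _ ⟨x₀, h₀, rfl⟩
    refine ⟨(Finset.univ.filter fun j => 0 ≤ f j x₀).image (u x₀) ∪
      (Finset.univ.filter fun j => f j x₀ ≤ 0).image (fun j => -u x₀ j), ?_⟩
    rw [heq x₀ h₀]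
    ext x
    simp only [Set.mem_ofPred_eq, and_congr_right_iff, SignCompat]
    intro _
    constructor
    · intro h v hv
      rcases Finset.mem_union.1 hv with hv | hv
      · obtain ⟨j, hj, rfl⟩ := Finset.mem_image.1 hv
        exact (h j).1 (Finset.mem_filter.1 hj).2
      · obtain ⟨j, hj, rfl⟩ := Finset.mem_image.1 hv
        rw [map_neg]
        linarith [(h j).2 (Finset.mem_filter.1 hj).2]
    · intro h j
      refine ⟨fun hj => h _ (Finset.mem_union_left _ (Finset.mem_image_of_mem _ (by simpa))),
        fun hj => ?_⟩
      have := h (-u x₀ j) (Finset.mem_union_right _ (Finset.mem_image.2 ⟨j, by simpa, rfl⟩))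
      rw [map_neg] at this
      linarith
  · rintro _ ⟨x₀, h₀, rfl⟩ ρ ⟨v, hv, rfl⟩
    set ρ : Set (M.gp →+ ℝ) := {x ∈ M.signCone f x₀ | x v = 0} with hρ
    have hzero : (0 : M.gp →+ ℝ) ∈ ρ := by
      refine ⟨?_, rfl⟩
      rw [heq x₀ h₀]
      exact ⟨M.zero_mem_cone, fun j => SignCompat.zero _⟩
    -- For each `j`, a point of the face at which `f j` is nonzero if there is any. As each `u x₀ j`
    -- has constant sign on the cone nothing cancels in the sum `y` of these points, so `f j y`
    -- vanishes only if `f j` vanishes on all of the face.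
    have hex : ∀ j, ∃ x ∈ ρ, f j x = 0 → ∀ x' ∈ ρ, f j x' = 0 := by
      intro j
      by_cases h : ∀ x' ∈ ρ, f j x' = 0
      · exact ⟨0, hzero, fun _ => h⟩
      · push Not at h
        obtain ⟨x', h1, h2⟩ := h
        exact ⟨x', h1, fun h => absurd h h2⟩
    choose z hz hz0 using hex
    have hsum : ∀ i j, SignCompat (z i (u x₀ j)) (f j x₀) := by
      intro i j
      have := (hz i).1
      rw [heq x₀ h₀] at this
      exact this.2 j
    set y : M.gp →+ ℝ := ∑ i, z i with hy
    have hyapp : ∀ m, y m = ∑ i, z i m := fun m => AddMonoidHom.finsetSum_apply _ _ _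
    have hyc : y ∈ M.cone := M.sum_mem_cone _ _ fun i _ => (hz i).1.1
    have hyτ : y ∈ M.signCone f x₀ := by
      rw [heq x₀ h₀]
      refine ⟨hyc, fun j => ?_⟩
      rw [hyapp]
      exact SignCompat.sum fun i _ => hsum i j
    have hyv : y v = 0 := by
      rw [hyapp]
      exact Finset.sum_eq_zero fun i _ => (hz i).2
    refine ⟨y, hyc, Set.Subset.antisymm ?_ ?_⟩
    · rintro x ⟨hx, hxv⟩
      refine ⟨hx.1, fun j => ?_⟩
      have h1 := hx.2 j
      have h2 := hyτ.2 j
      rcases lt_trichotomy (f j y) 0 with h | h | h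
      · refine ⟨fun h' => absurd h' (not_le.2 h), fun _ => h1.2 ?_⟩
        by_contra h3
        exact absurd (h2.1 (not_le.1 h3).le) (not_le.2 h)
      · have h3 : ∑ i, z i (u x₀ j) = 0 := by rw [← hyapp, ← hval x₀ h₀ y hyτ j, h]
        have h4 := SignCompat.eq_zero_of_sum_eq_zero (fun i _ => hsum i j) h3 j (Finset.mem_univ _)
        rw [← hval x₀ h₀ _ (hz j).1 j] at h4
        rw [hz0 j h4 x ⟨hx, hxv⟩]
        exact SignCompat.zero _
      · refine ⟨fun _ => h1.1 ?_, fun h' => absurd h' (not_le.2 h)⟩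
        by_contra h3
        exact absurd (h2.2 (not_le.1 h3).le) (not_le.2 h)
    · intro x hx
      have hxτ : x ∈ M.signCone f x₀ := ⟨hx.1, fun j => (hx.2 j).trans (hyτ.2 j)⟩
      refine ⟨hxτ, ?_⟩
      obtain ⟨s, hs⟩ := M.fg
      have hsmem : ∀ m ∈ s, m ∈ M.mon := fun m hm => hs ▸ AddSubmonoid.subset_closure hm
      obtain ⟨t₁, ht₁, h₁⟩ := exists_pos_forall_mul_abs_le s (fun m => x m) (fun m => y m)
        fun m hm => hmon y hyc x hx m (hsmem m hm)
      obtain ⟨t₂, ht₂, h₂⟩ := exists_pos_forall_mul_abs_le Finset.univ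
        (fun j => x (u x₀ j)) (fun j => y (u x₀ j)) fun j _ hj => by
          rw [← hval x₀ h₀ y hyτ j] at hj
          rw [← hval x₀ h₀ x hxτ j]
          exact (hx.2 j).eq_zero hj
      set t := min t₁ t₂ with ht
      have htpos : 0 < t := lt_min ht₁ ht₂
      -- The segment from `x` to `y` can be prolonged beyond `y` within the cone. As `v` vanishes at
      -- `y` and is nonnegative on the cone, it vanishes at `x`; `hmon` ensures that the
      -- prolongation stays in `M.cone`.
      have hτ : y - (AddMonoidHom.mulLeft t).comp x ∈ M.signCone f x₀ := by
        have happ : ∀ m, (y - (AddMonoidHom.mulLeft t).comp x) m = y m - t * x m := fun m => rfl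
        rw [heq x₀ h₀]
        constructor
        · refine M.mem_cone_of_generators hs fun m hm => ?_
          rw [happ]
          have e1 := h₁ m hm
          have e2 := hx.1 m (hsmem m hm)
          have e3 := hyc m (hsmem m hm)
          rw [abs_of_nonneg e2, abs_of_nonneg e3] at e1
          have := mul_le_mul_of_nonneg_right (min_le_left t₁ t₂) e2
          linarith
        · intro j
          rw [happ]
          have e1 := h₂ j (Finset.mem_univ j)
          have e4 : t * |x (u x₀ j)| ≤ |y (u x₀ j)| :=
            (mul_le_mul_of_nonneg_right (min_le_right t₁ t₂) (abs_nonneg _)).trans e1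
          have e2 := hxτ.2 j
          have e3 := hyτ.2 j
          rw [hval x₀ h₀ x hxτ j] at e2
          rw [hval x₀ h₀ y hyτ j] at e3
          constructor
          · intro hb
            rw [abs_of_nonneg (e2.1 hb), abs_of_nonneg (e3.1 hb)] at e4
            linarith
          · intro hb
            rw [abs_of_nonpos (e2.2 hb), abs_of_nonpos (e3.2 hb)] at e4
            linarith
      have h3 := hv _ hτ
      have h4 := hv _ hxτ
      change 0 ≤ y v - t * x v at h3
      rw [hyv, zero_sub] at h3
      have : x v ≤ 0 := by
        by_contra h
        have := mul_pos htpos (not_le.1 h)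
        linarith
      exact le_antisymm this h4
  · rintro _ ⟨x₀, h₀, rfl⟩ _ ⟨x₁, h₁, rfl⟩
    refine ⟨hinter x₀ h₀ x₁ h₁, ?_⟩
    rw [Set.inter_comm]
    exact hinter x₁ h₁ x₀ h₀
  · ext x
    constructor
    · rintro ⟨_, ⟨x₀, -, rfl⟩, hx⟩
      exact hx.1
    · intro hx
      exact ⟨_, ⟨x, hx, rfl⟩, hx, fun j => SignCompat.refl _⟩

end Fan

end ToricMonoid
end TropRub

namespace TropRub

/-! ### Positions on subdivided edges -/

namespace TropicalCurve

variable {M : ToricMonoid} {n : ℕ} (C : TropicalCurve M n)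

theorem len_nonneg (h : C.D) : 0 ≤ C.len h := M.nonneg_iff_mem.2 (C.len_mem h)

theorem len_pos (h : C.D) : 0 < C.len h := lt_of_le_of_ne (C.len_nonneg h) (C.len_ne_zero h).symm

end TropicalCurve

theorem ToricMonoid.Hom.map_nonneg {M N : ToricMonoid} (φ : M ⟶ N) {x : M.gp} (hx : 0 ≤ x) :
    0 ≤ φ.toFun x :=
  N.nonneg_iff_mem.2 (φ.map_mem x (M.nonneg_iff_mem.1 hx))

theorem ToricMonoid.Hom.map_mono {M N : ToricMonoid} (φ : M ⟶ N) {x y : M.gp} (h : x ≤ y) :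
    φ.toFun x ≤ φ.toFun y := by
  have := ToricMonoid.Hom.map_nonneg φ (sub_nonneg.2 h)
  rwa [map_sub, sub_nonneg] at this

theorem TropicalHom.mem_range_onD_iff {M N : ToricMonoid} {n : ℕ} {φ : M ⟶ N}
    {C : TropicalCurve M n} {C' : TropicalCurve N n} (f : TropicalHom φ C C') {h : C.D} :
    h ∈ Set.range f.onD ↔ φ.toFun (C.len h) ≠ 0 := by
  constructor
  · rintro ⟨k, rfl⟩
    rw [f.len_onD]
    exact C'.len_ne_zero k
  · intro hne
    by_contra hh
    exact hne (f.len_contracted h hh)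

theorem sum_Iio_add {R : Type*} [AddCommMonoid R] {m : ℕ} (F : Fin m → R) (i : Fin m) :
    ∑ j ∈ Finset.Iio i, F j + F i = ∑ j ∈ Finset.Iic i, F j := by
  rw [add_comm, ← Finset.sum_insert (by simp), Finset.Iio_insert]

namespace CurveSubdivision

variable {M : ToricMonoid} {n : ℕ} {C' C : TropicalCurve M n} (q : CurveSubdivision C' C)

/-- The number of vertices in the interior of an edge. -/
noncomputable def numInner (h : C.D) : ℕ := (q.path h).choose

/-- The path of edges of the subdivision over an oriented edge. -/
noncomputable def edge (h : C.D) : Fin (q.numInner h + 1) → C'.D := (q.path h).choose_spec.choose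

theorem edge_spec (h : C.D) : Function.Injective (q.edge h) ∧
    (∀ h', q.onD h' = h ↔ h' ∈ Set.range (q.edge h)) ∧
    C'.src (q.edge h 0) = q.onV (C.src h) ∧
    C'.tgt (q.edge h (Fin.last _)) = q.onV (C.tgt h) ∧
    (∀ i : Fin (q.numInner h), C'.tgt (q.edge h i.castSucc) = C'.src (q.edge h i.succ) ∧
      C'.tgt (q.edge h i.castSucc) ∉ Set.range q.onV) ∧
    ∑ i, C'.len (q.edge h i) = C.len h := (q.path h).choose_spec.choose_spec

@[simp] theorem onD_edge (h : C.D) (i) : q.onD (q.edge h i) = h :=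
  ((q.edge_spec h).2.1 _).2 ⟨i, rfl⟩

theorem exists_edge_eq (h' : C'.D) : ∃ i, q.edge (q.onD h') i = h' :=
  ((q.edge_spec (q.onD h')).2.1 h').1 rfl

/-- The distance of the initial vertex of `h'` from that of the edge of `C` which contains it. -/
noncomputable def pos (h' : C'.D) : M.gp :=
  ∑ j ∈ Finset.Iio (q.exists_edge_eq h').choose, C'.len (q.edge (q.onD h') j)

theorem pos_edge (h : C.D) (i) : q.pos (q.edge h i) = ∑ j ∈ Finset.Iio i, C'.len (q.edge h j) := by
  have key : ∀ h' (hh : q.onD h' = h), q.edge h i = h' →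
      q.pos h' = ∑ j ∈ Finset.Iio i, C'.len (q.edge h j) := by
    rintro h' rfl hi
    have : (q.exists_edge_eq h').choose = i :=
      (q.edge_spec _).1 ((q.exists_edge_eq h').choose_spec.trans hi.symm)
    rw [pos, this]
  exact key _ (q.onD_edge h i) rfl

theorem pos_edge_zero (h : C.D) : q.pos (q.edge h 0) = 0 := by
  rw [pos_edge]
  refine Finset.sum_eq_zero fun j hj => ?_
  exact absurd (Finset.mem_Iio.1 hj) (by simp)

theorem pos_edge_succ (h : C.D) (i : Fin (q.numInner h)) :
    q.pos (q.edge h i.succ) = q.pos (q.edge h i.castSucc) + C'.len (q.edge h i.castSucc) := by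
  rw [pos_edge, pos_edge, sum_Iio_add]
  refine Finset.sum_congr ?_ fun _ _ => rfl
  ext j
  simp only [Finset.mem_Iio, Finset.mem_Iic, Fin.lt_def, Fin.le_def, Fin.val_succ,
    Fin.val_castSucc]
  omega

theorem pos_edge_last (h : C.D) :
    q.pos (q.edge h (Fin.last _)) + C'.len (q.edge h (Fin.last _)) = C.len h := by
  rw [pos_edge, ← (q.edge_spec h).2.2.2.2.2, sum_Iio_add]
  refine Finset.sum_congr ?_ fun _ _ => rfl
  ext j
  simp [Fin.le_last j]

/-- Induction along the edges over a given edge. -/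
theorem edge_induction {h : C.D} {P : C'.D → Prop}
    (h0 : ∀ h', q.onD h' = h → q.pos h' = 0 → C'.src h' = q.onV (C.src h) → P h')
    (hs : ∀ h' h'', q.onD h' = h → q.onD h'' = h → C'.tgt h' = C'.src h'' →
      C'.src h'' ∉ Set.range q.onV → q.pos h'' = q.pos h' + C'.len h' → P h' → P h'')
    (h' : C'.D) (hh : q.onD h' = h) : P h' := by
  obtain ⟨i, rfl⟩ := ((q.edge_spec h).2.1 h').1 hh
  clear hh
  induction i using Fin.induction with
  | zero => exact h0 _ (q.onD_edge h 0) (q.pos_edge_zero h) (q.edge_spec h).2.2.1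
  | succ i ih =>
    have := (q.edge_spec h).2.2.2.2.1 i
    exact hs _ _ (q.onD_edge _ _) (q.onD_edge _ _) this.1 (this.1 ▸ this.2) (q.pos_edge_succ h i) ih

theorem pos_nonneg (h' : C'.D) : 0 ≤ q.pos h' :=
  Finset.sum_nonneg fun _ _ => C'.len_nonneg _

/-- Together with `prev` this allows walking along a subdivided edge one piece at a time. -/
theorem next (h' : C'.D) :
    (C'.tgt h' = q.onV (C.tgt (q.onD h')) ∧ q.pos h' + C'.len h' = C.len (q.onD h')) ∨
    ∃ h'', q.onD h'' = q.onD h' ∧ C'.src h'' = C'.tgt h' ∧ C'.src h'' ∉ Set.range q.onV ∧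
      q.pos h'' = q.pos h' + C'.len h' := by
  obtain ⟨h, hh⟩ : ∃ h, q.onD h' = h := ⟨_, rfl⟩
  obtain ⟨i, rfl⟩ := ((q.edge_spec h).2.1 h').1 hh
  rw [onD_edge]
  induction i using Fin.lastCases with
  | last => exact Or.inl ⟨(q.edge_spec h).2.2.2.1, q.pos_edge_last h⟩
  | cast i =>
    have := (q.edge_spec h).2.2.2.2.1 i
    exact Or.inr ⟨q.edge h i.succ, q.onD_edge _ _, this.1.symm, this.1 ▸ this.2,
      q.pos_edge_succ h i⟩

theorem prev (h' : C'.D) :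
    (C'.src h' = q.onV (C.src (q.onD h')) ∧ q.pos h' = 0) ∨
    ∃ k, q.onD k = q.onD h' ∧ C'.tgt k = C'.src h' ∧ C'.src h' ∉ Set.range q.onV ∧
      q.pos h' = q.pos k + C'.len k := by
  refine q.edge_induction (h := q.onD h') (P := fun h' => (C'.src h' = q.onV (C.src (q.onD h')) ∧ q.pos h' = 0) ∨
    ∃ k, q.onD k = q.onD h' ∧ C'.tgt k = C'.src h' ∧ C'.src h' ∉ Set.range q.onV ∧
      q.pos h' = q.pos k + C'.len k) ?_ ?_ h' rfl
  · intro k hk h0 hs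
    exact Or.inl ⟨by rw [hs, hk], h0⟩
  · intro k k' hk hk' h1 h2 h3 _
    exact Or.inr ⟨k, by rw [hk, hk'], h1, h2, h3⟩

theorem pos_eq_zero_iff {h' : C'.D} : q.pos h' = 0 ↔ C'.src h' ∈ Set.range q.onV := by
  rcases q.prev h' with ⟨h1, h2⟩ | ⟨k, -, -, h2, h3⟩
  · exact iff_of_true h2 ⟨_, h1.symm⟩
  · refine iff_of_false (fun h0 => ?_) h2
    rw [h3] at h0
    exact (add_pos_of_nonneg_of_pos (q.pos_nonneg k) (C'.len_pos k)).ne' h0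

theorem src_of_pos_eq_zero {h' : C'.D} (h0 : q.pos h' = 0) :
    C'.src h' = q.onV (C.src (q.onD h')) := by
  rcases q.prev h' with ⟨h1, -⟩ | ⟨k, -, -, h2, -⟩
  · exact h1
  · exact absurd (q.pos_eq_zero_iff.1 h0) h2

/-- Although `M.gp` is only partially ordered, the pieces of one edge are linearly ordered by
position. -/
theorem eq_or_le_of_onD_eq {h' h'' : C'.D} (hh : q.onD h' = q.onD h'') :
    h' = h'' ∨ q.pos h' + C'.len h' ≤ q.pos h'' ∨ q.pos h'' + C'.len h'' ≤ q.pos h' := by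
  obtain ⟨h, hh'⟩ : ∃ h, q.onD h'' = h := ⟨_, rfl⟩
  rw [hh'] at hh
  obtain ⟨i, rfl⟩ := ((q.edge_spec h).2.1 h').1 hh
  obtain ⟨j, rfl⟩ := ((q.edge_spec h).2.1 h'').1 hh'
  have key : ∀ i j, i < j →
      q.pos (q.edge h i) + C'.len (q.edge h i) ≤ q.pos (q.edge h j) := by
    intro i j hij
    rw [pos_edge, pos_edge, sum_Iio_add]
    refine Finset.sum_le_sum_of_subset_of_nonneg ?_ fun k _ _ => C'.len_nonneg _
    intro k hk
    exact Finset.mem_Iio.2 ((Finset.mem_Iic.1 hk).trans_lt hij)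
  rcases lt_trichotomy i j with hij | rfl | hij
  · exact Or.inr (Or.inl (key i j hij))
  · exact Or.inl rfl
  · exact Or.inr (Or.inr (key j i hij))

theorem pos_injOn {h' h'' : C'.D} (hh : q.onD h' = q.onD h'') (hp : q.pos h' = q.pos h'') :
    h' = h'' := by
  rcases q.eq_or_le_of_onD_eq hh with h | h | h
  · exact h
  · rw [hp] at h
    exact absurd h (not_le_of_gt (lt_add_of_pos_right _ (C'.len_pos _)))
  · rw [hp] at h
    exact absurd h (not_le_of_gt (lt_add_of_pos_right _ (C'.len_pos _)))

theorem eq_of_exceptional {w : C'.V} (hw : w ∉ Set.range q.onV) {a b c : C'.D} (ha : C'.src a = w)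
    (hb : C'.src b = w) (hc : C'.src c = w) (hab : a ≠ b) (hac : a ≠ c) : b = c := by
  classical
  by_contra hbc
  have h2 := (q.exceptional w hw).2
  have : 2 < C'.valence w := by
    rw [DualGraph.valence, Finset.two_lt_card]
    exact ⟨a, by simpa, b, by simpa, c, by simpa, hab, hac, hbc⟩
  omega

/-- The path over the reversed edge is not assumed to be the reversed path. It is so because an
exceptional vertex has valence two, which determines each next step; the induction starts at the far
end. -/
theorem pos_inv (h' : C'.D) :
    q.pos (C'.inv h') = C.len (q.onD h') - (q.pos h' + C'.len h') := by
  obtain ⟨h, hh⟩ : ∃ h, q.onD h' = h := ⟨_, rfl⟩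
  obtain ⟨i, rfl⟩ := ((q.edge_spec h).2.1 h').1 hh
  clear hh
  rw [onD_edge]
  induction i using Fin.reverseInduction with
  | last =>
    rw [pos_edge_last, sub_self, pos_eq_zero_iff, DualGraph.src_inv]
    exact ⟨_, (q.edge_spec h).2.2.2.1.symm⟩
  | cast i ih =>
    obtain ⟨h1, h2⟩ := (q.edge_spec h).2.2.2.2.1 i
    rcases q.next (C'.inv (q.edge h i.succ)) with ⟨h3, -⟩ | ⟨k, hk1, hk2, hk3, hk4⟩
    · rw [DualGraph.tgt_inv, ← h1] at h3
      exact absurd ⟨_, h3.symm⟩ h2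
    · rw [DualGraph.tgt_inv] at hk2
      have hne : ∀ x, q.onD x = C.inv h → q.edge h i.succ ≠ x := by
        rintro x hx rfl
        rw [onD_edge] at hx
        exact C.inv_ne h hx.symm
      have : k = C'.inv (q.edge h i.castSucc) := by
        refine q.eq_of_exceptional h2 h1.symm (hk2.trans h1.symm) (DualGraph.src_inv _ _)
          (hne _ ?_) (hne _ ?_)
        · rw [hk1, q.onD_inv, onD_edge]
        · rw [q.onD_inv, onD_edge]
      rw [← this, hk4, ih, C'.len_inv, pos_edge_succ]
      abel

theorem pos_add_len_le (h' : C'.D) : q.pos h' + C'.len h' ≤ C.len (q.onD h') := by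
  have := q.pos_nonneg (C'.inv h')
  rwa [pos_inv, sub_nonneg] at this

theorem pos_lt_len (h' : C'.D) : q.pos h' < C.len (q.onD h') :=
  (lt_add_of_pos_right _ (C'.len_pos _)).trans_le (q.pos_add_len_le h')

/-- An exceptional vertex has a second outgoing piece, the reversal of the preceding one. All
constructions at exceptional vertices have to be checked against the exchange of these two. -/
theorem exists_twin {h' : C'.D} (hx : C'.src h' ∉ Set.range q.onV) :
    ∃ k, q.onD k = C.inv (q.onD h') ∧ C'.src k = C'.src h' ∧
      q.pos k = C.len (q.onD h') - q.pos h' := by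
  rcases q.prev h' with ⟨h1, -⟩ | ⟨k, h1, h2, -, h3⟩
  · exact absurd ⟨_, h1.symm⟩ hx
  · exact ⟨C'.inv k, by rw [q.onD_inv, h1], h2, by rw [pos_inv, h1, h3]⟩

theorem eq_or_twin {h' h'' : C'.D} (hx : C'.src h' ∉ Set.range q.onV) (hs : C'.src h'' = C'.src h') :
    h'' = h' ∨ (q.onD h'' = C.inv (q.onD h') ∧ q.pos h'' = C.len (q.onD h') - q.pos h') := by
  obtain ⟨k, h1, h2, h3⟩ := q.exists_twin hx
  by_cases h : h'' = h'
  · exact Or.inl h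
  · right
    have : k = h'' := q.eq_of_exceptional hx rfl h2 hs (fun h' => C.inv_ne _ (h' ▸ h1).symm)
      (Ne.symm h)
    exact this ▸ ⟨h1, h3⟩

theorem exists_src_eq {v' : C'.V} (hv : v' ∉ Set.range q.onV) : ∃ h', C'.src h' = v' := by
  classical
  have h2 := (q.exceptional v' hv).2
  rw [DualGraph.valence] at h2
  obtain ⟨h', hh⟩ := Finset.card_pos.1 (h2 ▸ two_pos)
  exact ⟨h', by simpa using hh⟩

/-- The positions of the vertices on an edge, the endpoints included. -/
def points (h : C.D) : Set M.gp := {p | p = C.len h ∨ ∃ h', q.onD h' = h ∧ q.pos h' = p}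

theorem pos_mem_points (h' : C'.D) : q.pos h' ∈ q.points (q.onD h') := Or.inr ⟨h', rfl, rfl⟩

theorem len_mem_points (h : C.D) : C.len h ∈ q.points h := Or.inl rfl

theorem zero_mem_points (h : C.D) : 0 ∈ q.points h :=
  Or.inr ⟨q.edge h 0, q.onD_edge _ _, q.pos_edge_zero h⟩

theorem pos_add_len_mem_points (h' : C'.D) : q.pos h' + C'.len h' ∈ q.points (q.onD h') := by
  rcases q.next h' with ⟨-, h⟩ | ⟨k, h1, -, -, h2⟩
  · exact Or.inl h
  · exact Or.inr ⟨k, h1, h2⟩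

theorem le_or_le_of_mem_points {h' : C'.D} {p : M.gp} (hp : p ∈ q.points (q.onD h')) :
    p ≤ q.pos h' ∨ q.pos h' + C'.len h' ≤ p := by
  rcases hp with rfl | ⟨k, hk, rfl⟩
  · exact Or.inr (q.pos_add_len_le h')
  · rcases q.eq_or_le_of_onD_eq hk with rfl | h | h
    · exact Or.inl le_rfl
    · exact Or.inl ((le_add_of_nonneg_right (C'.len_nonneg _)).trans h)
    · exact Or.inr h

theorem nonneg_of_mem_points {h : C.D} {p : M.gp} (hp : p ∈ q.points h) : 0 ≤ p := by
  rcases hp with rfl | ⟨k, -, rfl⟩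
  · exact C.len_nonneg h
  · exact q.pos_nonneg k

theorem le_len_of_mem_points {h : C.D} {p : M.gp} (hp : p ∈ q.points h) : p ≤ C.len h := by
  rcases hp with rfl | ⟨k, rfl, rfl⟩
  · exact le_rfl
  · exact (q.pos_lt_len k).le

theorem exists_pos_eq {h : C.D} {p : M.gp} (hp : p ∈ q.points h) (hne : p ≠ C.len h) :
    ∃ h', q.onD h' = h ∧ q.pos h' = p := hp.resolve_left hne

open Classical in
/-- The vertex at a given position of an edge. -/
noncomputable def vertexAt (h : C.D) (p : M.gp) : C'.V :=
  -- The second branch serves `p = C.len h`, where no piece begins; elsewhere outside `points` the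
  -- value is junk.
  if hp : ∃ h', q.onD h' = h ∧ q.pos h' = p then C'.src hp.choose else q.onV (C.tgt h)

theorem vertexAt_pos (h' : C'.D) : q.vertexAt (q.onD h') (q.pos h') = C'.src h' := by
  have hp : ∃ k, q.onD k = q.onD h' ∧ q.pos k = q.pos h' := ⟨h', rfl, rfl⟩
  rw [vertexAt, dif_pos hp, q.pos_injOn hp.choose_spec.1 hp.choose_spec.2]

theorem vertexAt_len (h : C.D) : q.vertexAt h (C.len h) = q.onV (C.tgt h) := by
  rw [vertexAt, dif_neg]
  rintro ⟨k, rfl, hk⟩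
  exact (q.pos_lt_len k).ne hk

theorem vertexAt_zero (h : C.D) : q.vertexAt h 0 = q.onV (C.src h) := by
  have := q.vertexAt_pos (q.edge h 0)
  rwa [onD_edge, pos_edge_zero, q.src_of_pos_eq_zero (q.pos_edge_zero h), onD_edge] at this

theorem vertexAt_inv {h : C.D} {p : M.gp} (hp : p ∈ q.points h) :
    q.vertexAt (C.inv h) (C.len h - p) = q.vertexAt h p := by
  rcases hp with rfl | ⟨k, rfl, rfl⟩
  · rw [sub_self, vertexAt_zero, vertexAt_len, DualGraph.src_inv]
  · by_cases h0 : q.pos k = 0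
    · rw [h0, sub_zero, ← C.len_inv, vertexAt_len, vertexAt_zero, DualGraph.tgt_inv]
    · obtain ⟨k', h1, h2, h3⟩ := q.exists_twin (fun h => h0 (q.pos_eq_zero_iff.2 h))
      rw [vertexAt_pos, ← h1, ← h3, vertexAt_pos, h2]

theorem vertexAt_pos_add_len (h' : C'.D) :
    q.vertexAt (q.onD h') (q.pos h' + C'.len h') = C'.tgt h' := by
  rw [← q.vertexAt_inv (q.pos_add_len_mem_points h'), ← pos_inv, ← q.onD_inv, vertexAt_pos,
    DualGraph.src_inv]

theorem len_sub_mem_points {h : C.D} {p : M.gp} (hp : p ∈ q.points h) :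
    C.len h - p ∈ q.points (C.inv h) := by
  rcases hp with rfl | ⟨k, rfl, rfl⟩
  · rw [sub_self]; exact q.zero_mem_points _
  · by_cases h0 : q.pos k = 0
    · rw [h0, sub_zero, ← C.len_inv]; exact q.len_mem_points _
    · obtain ⟨k', h1, h2, h3⟩ := q.exists_twin (fun h => h0 (q.pos_eq_zero_iff.2 h))
      rw [← h1, ← h3]; exact q.pos_mem_points _

theorem eq_zero_or_eq_len_of_vertexAt_mem {h : C.D} {p : M.gp} (hp : p ∈ q.points h)
    (hv : q.vertexAt h p ∈ Set.range q.onV) : p = 0 ∨ p = C.len h := by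
  rcases hp with rfl | ⟨k, rfl, rfl⟩
  · exact Or.inr rfl
  · rw [vertexAt_pos, ← pos_eq_zero_iff] at hv
    exact Or.inl hv

theorem valence_onV (v : C.V) : C'.valence (q.onV v) = C.valence v := by
  classical
  symm
  refine Finset.card_bij (fun h _ => q.edge h 0) ?_ ?_ ?_
  · intro h hh
    simp only [Finset.mem_filter, Finset.mem_univ, true_and] at hh ⊢
    rw [(q.edge_spec h).2.2.1, hh]
  · intro h _ k _ hhk
    rw [← q.onD_edge h 0, hhk, onD_edge]
  · intro h' hh
    simp only [Finset.mem_filter, Finset.mem_univ, true_and] at hh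
    have h0 : q.pos h' = 0 := q.pos_eq_zero_iff.2 ⟨v, hh.symm⟩
    refine ⟨q.onD h', ?_, ?_⟩
    · simp only [Finset.mem_filter, Finset.mem_univ, true_and]
      exact q.onV_injective (by rw [← q.src_of_pos_eq_zero h0, hh])
    · exact q.pos_injOn (q.onD_edge _ _) (by rw [pos_edge_zero, h0])

theorem canDeg_onV (v : C.V) : C'.canDeg (q.onV v) = C.canDeg v := by
  rw [DualGraph.canDeg, DualGraph.canDeg, valence_onV, q.genus_onV]

theorem canDeg_exceptional {v' : C'.V} (hv : v' ∉ Set.range q.onV) : C'.canDeg v' = 0 := by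
  rw [DualGraph.canDeg, (q.exceptional v' hv).1, (q.exceptional v' hv).2]
  norm_num

theorem sum_eq_sum_onV {R : Type*} [AddCommMonoid R] (F : C'.V → R)
    (hF : ∀ v', v' ∉ Set.range q.onV → F v' = 0) : ∑ v', F v' = ∑ v, F (q.onV v) := by
  classical
  rw [← Finset.sum_image (s := Finset.univ) (g := q.onV) (f := F)
    (fun a _ b _ h => q.onV_injective h)]
  refine (Finset.sum_subset (Finset.subset_univ _) fun v' _ hv => hF v' ?_).symm
  simpa using hv

end CurveSubdivision
end TropRub

namespace TropRub

/-! ### Lifting maps of tropical curves to subdivisions -/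

namespace CurveSubdivision

variable {n : ℕ} {M₁ M₂ : ToricMonoid} {φ : M₁ ⟶ M₂} {C₁' C₁ : TropicalCurve M₁ n}
  {C₂' C₂ : TropicalCurve M₂ n} {q₁ : CurveSubdivision C₁' C₁} {q₂ : CurveSubdivision C₂' C₂}
  {f : TropicalHom φ C₁ C₂}

theorem map_pos_eq_zero (q₁ : CurveSubdivision C₁' C₁) {h' : C₁'.D}
    (hh : q₁.onD h' ∉ Set.range f.onD) : φ.toFun (q₁.pos h') = 0 := by
  have h1 := ToricMonoid.Hom.map_nonneg φ (q₁.pos_nonneg h')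
  have h2 := ToricMonoid.Hom.map_mono φ (q₁.pos_lt_len h').le
  rw [f.len_contracted _ hh] at h2
  exact le_antisymm h2 h1

theorem map_len_eq_zero (q₁ : CurveSubdivision C₁' C₁) {h' : C₁'.D}
    (hh : q₁.onD h' ∉ Set.range f.onD) : φ.toFun (C₁'.len h') = 0 := by
  have h1 := ToricMonoid.Hom.map_nonneg φ (C₁'.len_nonneg h')
  have h2 := ToricMonoid.Hom.map_mono φ
    ((le_add_of_nonneg_left (q₁.pos_nonneg h')).trans (q₁.pos_add_len_le h'))
  rw [f.len_contracted _ hh] at h2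
  exact le_antisymm h2 h1

/-! ### Uniqueness of compatible lifts -/

section Unique

variable {f' : TropicalHom φ C₁' C₂'}

theorem Compatible.onV_src_of_contracted (hf : q₁.Compatible q₂ f' f) {h' : C₁'.D}
    (hh : q₁.onD h' ∉ Set.range f.onD) :
    f'.onV (C₁'.src h') = q₂.onV (f.onV (C₁.src (q₁.onD h'))) := by
  obtain ⟨h, hh'⟩ : ∃ h, q₁.onD h' = h := ⟨_, rfl⟩
  rw [hh'] at hh ⊢
  refine q₁.edge_induction (P := fun h' => f'.onV (C₁'.src h') = q₂.onV (f.onV (C₁.src h)))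
    ?_ ?_ h' hh'
  · intro k _ _ hs
    rw [hs, hf.1]
  · intro k k' hk hk' h1 _ _ ih
    rw [← h1, ← ih]
    refine (f'.onV_contracted ?_).symm
    rw [f'.mem_range_onD_iff, not_not]
    exact q₁.map_len_eq_zero (f := f) (hk ▸ hh)

/-- A vertex determines its position on a given oriented edge: the position `C₂.len` of the far end
is excluded since the piece `k'` has positive length, and at an exceptional vertex the only other
piece belongs to the reversed edge. -/
theorem Compatible.pos_of_onV_src (hf : q₁.Compatible q₂ f' f) {k' : C₂'.D}
    (hp : φ.toFun (q₁.pos (f'.onD k')) ∈ q₂.points (q₂.onD k'))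
    (hv : q₂.vertexAt (q₂.onD k') (φ.toFun (q₁.pos (f'.onD k'))) = C₂'.src k') :
    φ.toFun (q₁.pos (f'.onD k')) = q₂.pos k' := by
  have hlt : φ.toFun (q₁.pos (f'.onD k')) ≠ C₂.len (q₂.onD k') := by
    intro he
    have h1 := ToricMonoid.Hom.map_mono φ (q₁.pos_add_len_le (f'.onD k'))
    rw [hf.2, f.len_onD, map_add, he, f'.len_onD] at h1
    exact absurd h1 (not_le_of_gt (lt_add_of_pos_right _ (C₂'.len_pos k')))
  obtain ⟨k'', h1, h2⟩ := q₂.exists_pos_eq hp hlt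
  rw [← h2, ← h1, vertexAt_pos] at hv
  rw [← h2]
  by_cases h0 : C₂'.src k' ∈ Set.range q₂.onV
  · rw [q₂.pos_eq_zero_iff.2 h0, q₂.pos_eq_zero_iff.2 (hv ▸ h0)]
  · rcases q₂.eq_or_twin h0 hv with rfl | ⟨h3, -⟩
    · rfl
    · exact absurd (h1 ▸ h3) (C₂.inv_ne _).symm

/-- Walk along the subdivided edge. At a contracted piece neither the image vertex nor the image of
the position changes; at a surviving piece both advance by one piece of the target. The image of an
inner vertex is therefore dictated by its position. -/
theorem Compatible.onV_src (hf : q₁.Compatible q₂ f' f) {h' : C₁'.D} {k : C₂.D}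
    (hk : q₁.onD h' = f.onD k) : φ.toFun (q₁.pos h') ∈ q₂.points k ∧
      q₂.vertexAt k (φ.toFun (q₁.pos h')) = f'.onV (C₁'.src h') := by
  refine q₁.edge_induction (P := fun h' => φ.toFun (q₁.pos h') ∈ q₂.points k ∧
      q₂.vertexAt k (φ.toFun (q₁.pos h')) = f'.onV (C₁'.src h')) ?_ ?_ h' hk
  · intro h' _ h0 hs
    rw [h0, map_zero, hs, hf.1, f.onV_src]
    exact ⟨q₂.zero_mem_points k, q₂.vertexAt_zero k⟩
  · rintro h' h'' hk hk' h1 - h3 ⟨h4, h5⟩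
    rw [h3, map_add, ← h1]
    by_cases hc : h' ∈ Set.range f'.onD
    · obtain ⟨k', rfl⟩ := hc
      have : q₂.onD k' = k := f.onD_injective (by rw [← hk, hf.2])
      subst this
      rw [f'.onV_src] at h5
      rw [hf.pos_of_onV_src h4 h5, f'.len_onD, f'.onV_tgt]
      exact ⟨q₂.pos_add_len_mem_points k', q₂.vertexAt_pos_add_len k'⟩
    · rw [f'.len_contracted _ hc, add_zero, ← f'.onV_contracted hc]
      exact ⟨h4, h5⟩

theorem Compatible.map_pos (hf : q₁.Compatible q₂ f' f) (k' : C₂'.D) :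
    φ.toFun (q₁.pos (f'.onD k')) = q₂.pos k' := by
  have := hf.onV_src (hf.2 k')
  rw [f'.onV_src] at this
  exact hf.pos_of_onV_src this.1 this.2

theorem eq_of_map_pos_eq (q₁ : CurveSubdivision C₁' C₁) {h h' : C₁'.D}
    (hh : q₁.onD h = q₁.onD h') (hp : φ.toFun (q₁.pos h) = φ.toFun (q₁.pos h'))
    (hl : φ.toFun (C₁'.len h) ≠ 0) (hl' : φ.toFun (C₁'.len h') ≠ 0) : h = h' := by
  rcases q₁.eq_or_le_of_onD_eq hh with h1 | h1 | h1
  · exact h1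
  · have := ToricMonoid.Hom.map_mono φ h1
    rw [map_add, ← hp] at this
    exact absurd (le_antisymm (by simpa using this)
      (ToricMonoid.Hom.map_nonneg φ (C₁'.len_nonneg h))) hl
  · have := ToricMonoid.Hom.map_mono φ h1
    rw [map_add, ← hp] at this
    exact absurd (le_antisymm (by simpa using this)
      (ToricMonoid.Hom.map_nonneg φ (C₁'.len_nonneg h'))) hl'

/-- Vertices are determined by their positions. Edges are too, because among pieces over one edge
that survive under `φ` the image of the position is injective. -/
theorem Compatible.unique {f'' : TropicalHom φ C₁' C₂'} (hf' : q₁.Compatible q₂ f' f)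
    (hf'' : q₁.Compatible q₂ f'' f) : f' = f'' := by
  refine TropicalHom.ext (funext fun v' => ?_) (funext fun k' => ?_)
  · by_cases hv : v' ∈ Set.range q₁.onV
    · obtain ⟨v, rfl⟩ := hv
      rw [hf'.1, hf''.1]
    · obtain ⟨h', rfl⟩ := q₁.exists_src_eq hv
      by_cases hh : q₁.onD h' ∈ Set.range f.onD
      · obtain ⟨k, hk⟩ := hh
        rw [← (hf'.onV_src hk.symm).2, ← (hf''.onV_src hk.symm).2]
      · rw [hf'.onV_src_of_contracted hh, hf''.onV_src_of_contracted hh]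
  · refine q₁.eq_of_map_pos_eq (φ := φ) ?_ ?_ ?_ ?_
    · rw [hf'.2, hf''.2]
    · rw [hf'.map_pos, hf''.map_pos]
    · rw [f'.len_onD]; exact C₂'.len_ne_zero k'
    · rw [f''.len_onD]; exact C₂'.len_ne_zero k'

end Unique

/-! ### Existence of compatible lifts -/

section Exists

variable (q₁ q₂ f)

open Classical in
/-- The image of the initial vertex of an edge of a subdivision. -/
noncomputable def liftSrc (h' : C₁'.D) : C₂'.V :=
  if hk : ∃ k, f.onD k = q₁.onD h' then q₂.vertexAt hk.choose (φ.toFun (q₁.pos h'))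
  else q₂.onV (f.onV (C₁.src (q₁.onD h')))

open Classical in
/-- The image of a vertex of a subdivision. -/
noncomputable def liftV (v' : C₁'.V) : C₂'.V :=
  if hv : v' ∈ Set.range q₁.onV then q₂.onV (f.onV hv.choose)
  else q₁.liftSrc q₂ f (q₁.exists_src_eq hv).choose

theorem liftSrc_of_eq {h' : C₁'.D} {k : C₂.D} (hk : f.onD k = q₁.onD h') :
    q₁.liftSrc q₂ f h' = q₂.vertexAt k (φ.toFun (q₁.pos h')) := by
  have hk' : ∃ k, f.onD k = q₁.onD h' := ⟨k, hk⟩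
  rw [liftSrc, dif_pos hk', f.onD_injective (hk'.choose_spec.trans hk.symm)]

theorem liftSrc_of_contracted {h' : C₁'.D} (hk : q₁.onD h' ∉ Set.range f.onD) :
    q₁.liftSrc q₂ f h' = q₂.onV (f.onV (C₁.src (q₁.onD h'))) := dif_neg hk

theorem liftV_onV (v : C₁.V) : q₁.liftV q₂ f (q₁.onV v) = q₂.onV (f.onV v) := by
  have hv : q₁.onV v ∈ Set.range q₁.onV := ⟨v, rfl⟩
  rw [liftV, dif_pos hv, q₁.onV_injective hv.choose_spec]

variable {q₁ q₂ f}
variable (hpts : ∀ h p, p ∈ q₂.points h ↔ ∃ p₁ ∈ q₁.points (f.onD h), φ.toFun p₁ = p)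
include hpts

/-- Independence of the chosen outgoing piece: the only other choice at an exceptional vertex is its
twin, for which the position is measured from the other end, and `vertexAt_inv` compares the two. -/
theorem liftV_src (h' : C₁'.D) : q₁.liftV q₂ f (C₁'.src h') = q₁.liftSrc q₂ f h' := by
  by_cases hv : C₁'.src h' ∈ Set.range q₁.onV
  · have h0 := q₁.pos_eq_zero_iff.2 hv
    rw [q₁.src_of_pos_eq_zero h0, liftV_onV]
    by_cases hk : q₁.onD h' ∈ Set.range f.onD
    · obtain ⟨k, hk⟩ := hk
      rw [q₁.liftSrc_of_eq q₂ f hk, h0, map_zero, vertexAt_zero, ← hk, f.onV_src]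
    · rw [q₁.liftSrc_of_contracted q₂ f hk]
  · rw [liftV, dif_neg hv]
    obtain ⟨h1, h2⟩ : ∃ h1, h1 = (q₁.exists_src_eq hv).choose := ⟨_, rfl⟩
    have h3 : C₁'.src h1 = C₁'.src h' := h2 ▸ (q₁.exists_src_eq hv).choose_spec
    rw [← h2]
    rcases q₁.eq_or_twin hv h3 with rfl | ⟨h4, h5⟩
    · rfl
    · by_cases hk : q₁.onD h' ∈ Set.range f.onD
      · obtain ⟨k, hk⟩ := hk
        rw [q₁.liftSrc_of_eq q₂ f hk, q₁.liftSrc_of_eq q₂ f (k := C₂.inv k)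
          (by rw [f.onD_inv, hk, h4]), h5, map_sub, ← hk, f.len_onD, vertexAt_inv]
        exact (hpts _ _).2 ⟨_, hk ▸ q₁.pos_mem_points h', rfl⟩
      · have hk' : q₁.onD h1 ∉ Set.range f.onD := by
          rintro ⟨k, hk'⟩
          exact hk ⟨C₂.inv k, by rw [f.onD_inv, hk', h4, C₁.inv_inv]⟩
        rw [q₁.liftSrc_of_contracted q₂ f hk, q₁.liftSrc_of_contracted q₂ f hk', h4,
          DualGraph.src_inv, f.onV_contracted hk]

theorem liftV_src_of_eq {h' : C₁'.D} {k : C₂.D} (hk : f.onD k = q₁.onD h') :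
    q₁.liftV q₂ f (C₁'.src h') = q₂.vertexAt k (φ.toFun (q₁.pos h')) := by
  rw [liftV_src hpts, q₁.liftSrc_of_eq q₂ f hk]

theorem liftV_tgt_of_eq {h' : C₁'.D} {k : C₂.D} (hk : f.onD k = q₁.onD h') :
    q₁.liftV q₂ f (C₁'.tgt h') = q₂.vertexAt k (φ.toFun (q₁.pos h' + C₁'.len h')) := by
  rw [← DualGraph.src_inv, liftV_src_of_eq hpts (k := C₂.inv k)
    (by rw [f.onD_inv, hk, q₁.onD_inv]), pos_inv, map_sub, ← hk, f.len_onD, vertexAt_inv]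
  exact (hpts _ _).2 ⟨_, hk ▸ q₁.pos_add_len_mem_points h', rfl⟩

theorem liftV_contracted {h' : C₁'.D} (h0 : φ.toFun (C₁'.len h') = 0) :
    q₁.liftV q₂ f (C₁'.src h') = q₁.liftV q₂ f (C₁'.tgt h') := by
  by_cases hk : q₁.onD h' ∈ Set.range f.onD
  · obtain ⟨k, hk⟩ := hk
    rw [liftV_src_of_eq hpts hk, liftV_tgt_of_eq hpts hk, map_add, h0, add_zero]
  · have hk' : q₁.onD (C₁'.inv h') ∉ Set.range f.onD := by
      rintro ⟨k, hk'⟩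
      exact hk ⟨C₂.inv k, by rw [f.onD_inv, hk', q₁.onD_inv, C₁.inv_inv]⟩
    rw [liftV_src hpts, ← DualGraph.src_inv, liftV_src hpts, q₁.liftSrc_of_contracted q₂ f hk,
      q₁.liftSrc_of_contracted q₂ f hk', q₁.onD_inv, DualGraph.src_inv, f.onV_contracted hk]

/-- Several pieces may begin at positions with the same image. The last of them survives, since
otherwise the next piece would begin at the same image as well. -/
theorem exists_liftD (k' : C₂'.D) : ∃ h', q₁.onD h' = f.onD (q₂.onD k') ∧
    φ.toFun (q₁.pos h') = q₂.pos k' ∧ φ.toFun (C₁'.len h') ≠ 0 := by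
  classical
  obtain ⟨p, hp, hpk⟩ := (hpts _ _).1 (q₂.pos_mem_points k')
  have hne : p ≠ C₁.len (f.onD (q₂.onD k')) := by
    rintro rfl
    rw [f.len_onD] at hpk
    exact (q₂.pos_lt_len k').ne' hpk
  obtain ⟨h₀, hh₀, hp₀⟩ := q₁.exists_pos_eq hp hne
  -- Because `M.gp` is not totally ordered, pieces are ranked by the number of pieces at or before
  -- them.
  obtain ⟨h', hh', hmax⟩ := Finset.exists_max_image
    (Finset.univ.filter fun h' => q₁.onD h' = f.onD (q₂.onD k') ∧
      φ.toFun (q₁.pos h') = q₂.pos k')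
    (fun h' => (Finset.univ.filter fun h'' : C₁'.D => q₁.onD h'' = q₁.onD h' ∧
      q₁.pos h'' ≤ q₁.pos h').card) ⟨h₀, by simp [hh₀, hp₀, hpk]⟩
  simp only [Finset.mem_filter, Finset.mem_univ, true_and] at hh' hmax
  refine ⟨h', hh'.1, hh'.2, fun h0 => ?_⟩
  rcases q₁.next h' with ⟨-, h1⟩ | ⟨h'', h1, -, -, h2⟩
  · have := congrArg φ.toFun h1
    rw [map_add, h0, add_zero, hh'.2, hh'.1, f.len_onD] at this
    exact (q₂.pos_lt_len k').ne this
  · have h3 := hmax h'' ⟨h1.trans hh'.1, by rw [h2, map_add, h0, add_zero, hh'.2]⟩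
    refine absurd h3 (not_le_of_gt (Finset.card_lt_card ?_))
    have hlt : q₁.pos h' < q₁.pos h'' := h2 ▸ lt_add_of_pos_right _ (C₁'.len_pos _)
    rw [Finset.ssubset_iff_of_subset]
    · exact ⟨h'', by simp, by simp [hlt.not_ge]⟩
    · intro x hx
      simp only [Finset.mem_filter, Finset.mem_univ, true_and] at hx ⊢
      exact ⟨hx.1.trans h1.symm, hx.2.trans hlt.le⟩

/-- Both pieces begin at the same position. By `hpts` the end of each is a position on the other
side, and no position lies in the interior of a piece; hence neither can be shorter. -/
theorem map_len_of_map_pos_eq {k' : C₂'.D} {h' : C₁'.D} (hh : q₁.onD h' = f.onD (q₂.onD k'))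
    (hp : φ.toFun (q₁.pos h') = q₂.pos k') (hl : φ.toFun (C₁'.len h') ≠ 0) :
    φ.toFun (C₁'.len h') = C₂'.len k' := by
  have hpos : 0 < φ.toFun (C₁'.len h') :=
    lt_of_le_of_ne (ToricMonoid.Hom.map_nonneg φ (C₁'.len_nonneg _)) hl.symm
  apply le_antisymm
  · obtain ⟨p, hp1, hp2⟩ := (hpts _ _).1 (q₂.pos_add_len_mem_points k')
    rcases q₁.le_or_le_of_mem_points (hh.symm ▸ hp1) with h1 | h1
    · have := ToricMonoid.Hom.map_mono φ h1
      rw [hp2, hp] at this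
      exact absurd this (not_le_of_gt (lt_add_of_pos_right _ (C₂'.len_pos _)))
    · have := ToricMonoid.Hom.map_mono φ h1
      rw [hp2, map_add, hp] at this
      exact le_of_add_le_add_left this
  · have : φ.toFun (q₁.pos h' + C₁'.len h') ∈ q₂.points (q₂.onD k') :=
      (hpts _ _).2 ⟨_, hh ▸ q₁.pos_add_len_mem_points h', rfl⟩
    rw [map_add, hp] at this
    rcases q₂.le_or_le_of_mem_points this with h1 | h1
    · exact absurd h1 (not_le_of_gt (lt_add_of_pos_right _ hpos))
    · exact le_of_add_le_add_left h1

theorem exists_eq_liftD {h' : C₁'.D} (hl : φ.toFun (C₁'.len h') ≠ 0) :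
    ∃ k', q₁.onD h' = f.onD (q₂.onD k') ∧ φ.toFun (q₁.pos h') = q₂.pos k' := by
  by_cases hk : q₁.onD h' ∈ Set.range f.onD
  · obtain ⟨k, hk⟩ := hk
    have hmem : φ.toFun (q₁.pos h') ∈ q₂.points k :=
      (hpts _ _).2 ⟨_, hk ▸ q₁.pos_mem_points h', rfl⟩
    have hpos : 0 < φ.toFun (C₁'.len h') :=
      lt_of_le_of_ne (ToricMonoid.Hom.map_nonneg φ (C₁'.len_nonneg _)) hl.symm
    obtain ⟨k', h1, h2⟩ := q₂.exists_pos_eq hmem (by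
      intro he
      have := ToricMonoid.Hom.map_mono φ (q₁.pos_add_len_le h')
      rw [map_add, he, ← hk, f.len_onD] at this
      exact absurd this (not_le_of_gt (lt_add_of_pos_right _ hpos)))
    exact ⟨k', by rw [h1, hk], h2.symm⟩
  · exact absurd (q₁.map_len_eq_zero hk) hl

-- All pieces between two positions with equal image are contracted, by monotonicity of `φ`.
omit hpts in
theorem reflTransGen_of_map_pos_eq (q₁ : CurveSubdivision C₁' C₁) (φ : M₁ ⟶ M₂) {R : C₁'.V → C₁'.V → Prop}
    (hR : ∀ h', φ.toFun (C₁'.len h') = 0 → R (C₁'.src h') (C₁'.tgt h')) {h h' : C₁'.D}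
    (hh : q₁.onD h = q₁.onD h') (hp : φ.toFun (q₁.pos h) = φ.toFun (q₁.pos h'))
    (hle : q₁.pos h ≤ q₁.pos h') : Relation.ReflTransGen R (C₁'.src h) (C₁'.src h') := by
  obtain ⟨e, he⟩ : ∃ e, q₁.onD h' = e := ⟨_, rfl⟩
  revert hp hle hh
  refine q₁.edge_induction (P := fun h' => q₁.onD h = q₁.onD h' → φ.toFun (q₁.pos h) =
    φ.toFun (q₁.pos h') → q₁.pos h ≤ q₁.pos h' →
    Relation.ReflTransGen R (C₁'.src h) (C₁'.src h')) ?_ ?_ h' he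
  · intro h' _ h0 _ hh _ hle
    have : h = h' := q₁.pos_injOn hh (by
      rw [h0] at hle ⊢
      exact le_antisymm hle (q₁.pos_nonneg h))
    rw [this]
  · intro k k' hk hk' h1 _ h3 ih hh hp hle
    rcases q₁.eq_or_le_of_onD_eq hh with rfl | h4 | h4
    · exact Relation.ReflTransGen.refl
    · have hhk : q₁.onD h = q₁.onD k := by rw [hh, hk', hk]
      have hle' : q₁.pos h ≤ q₁.pos k := by
        rcases q₁.eq_or_le_of_onD_eq hhk with rfl | h5 | h5
        · exact le_rfl
        · exact (le_add_of_nonneg_right (C₁'.len_nonneg _)).trans h5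
        · rw [← h3] at h5
          exact absurd (h4.trans h5) (not_le_of_gt (lt_add_of_pos_right _ (C₁'.len_pos _)))
      have h6 := ToricMonoid.Hom.map_mono φ hle'
      rw [h3, map_add] at hp
      have h7 : φ.toFun (C₁'.len k) = 0 := by
        refine le_antisymm ?_ (ToricMonoid.Hom.map_nonneg φ (C₁'.len_nonneg k))
        rw [hp] at h6
        simpa using h6
      rw [h7, add_zero] at hp
      exact (ih hhk hp hle').tail (h1 ▸ hR k h7)
    · exact absurd (h4.trans hle) (not_le_of_gt (lt_add_of_pos_right _ (C₁'.len_pos _)))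

omit hpts in
theorem le_total_pos (q₁ : CurveSubdivision C₁' C₁) {h h' : C₁'.D} (hh : q₁.onD h = q₁.onD h') :
    q₁.pos h ≤ q₁.pos h' ∨ q₁.pos h' ≤ q₁.pos h := by
  rcases q₁.eq_or_le_of_onD_eq hh with rfl | h4 | h4
  · exact Or.inl le_rfl
  · exact Or.inl ((le_add_of_nonneg_right (C₁'.len_nonneg _)).trans h4)
  · exact Or.inr ((le_add_of_nonneg_right (C₁'.len_nonneg _)).trans h4)

/-- A vertex either is joined by contracted pieces to a vertex of `C₁`, and then the contraction
property of `f` applies, or maps to an exceptional vertex. In the latter case two vertices with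
equal image sit, possibly after passing to a twin, on the same edge at positions with equal image,
and the segment between them is contracted. -/
theorem liftV_eq_iff (v w : C₁'.V) : q₁.liftV q₂ f v = q₁.liftV q₂ f w ↔
    Relation.ReflTransGen (fun a b => ∃ h', φ.toFun (C₁'.len h') = 0 ∧
      C₁'.src h' = a ∧ C₁'.tgt h' = b) v w := by
  set R : C₁'.V → C₁'.V → Prop := fun a b => ∃ h', φ.toFun (C₁'.len h') = 0 ∧
      C₁'.src h' = a ∧ C₁'.tgt h' = b with hRdef
  have hR : ∀ h', φ.toFun (C₁'.len h') = 0 → R (C₁'.src h') (C₁'.tgt h') :=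
    fun h' h0 => ⟨h', h0, rfl, rfl⟩
  have hsymm : ∀ {a b}, Relation.ReflTransGen R a b → Relation.ReflTransGen R b a := by
    intro a b hab
    induction hab with
    | refl => exact Relation.ReflTransGen.refl
    | tail _ hstep ih =>
      obtain ⟨h', h0, rfl, rfl⟩ := hstep
      refine Relation.ReflTransGen.head ⟨C₁'.inv h', by rw [C₁'.len_inv, h0], ?_, ?_⟩ ih
      · rw [DualGraph.src_inv]
      · rw [DualGraph.tgt_inv]
  constructor
  swap
  · intro h
    induction h with
    | refl => rfl
    | tail _ hstep ih =>
      obtain ⟨h', h0, rfl, rfl⟩ := hstep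
      exact ih.trans (liftV_contracted hpts h0)
  intro hvw
  have hfirst : ∀ h', φ.toFun (q₁.pos h') = 0 →
      Relation.ReflTransGen R (C₁'.src h') (q₁.onV (C₁.src (q₁.onD h'))) := by
    intro h' h0
    have h1 := (q₁.pos_edge_zero (q₁.onD h'))
    have := q₁.reflTransGen_of_map_pos_eq φ hR (h := q₁.edge (q₁.onD h') 0) (h' := h')
      (q₁.onD_edge _ _) (by rw [h1, map_zero, h0]) (by rw [h1]; exact q₁.pos_nonneg _)
    rw [q₁.src_of_pos_eq_zero h1, q₁.onD_edge] at this
    exact hsymm this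
  have hedge : ∀ h, φ.toFun (C₁.len h) = 0 →
      Relation.ReflTransGen R (q₁.onV (C₁.src h)) (q₁.onV (C₁.tgt h)) := by
    intro h h0
    obtain ⟨k, h1, h2⟩ : ∃ k, q₁.onD k = h ∧ C₁'.tgt k = q₁.onV (C₁.tgt h) :=
      ⟨_, q₁.onD_edge h (Fin.last _), (q₁.edge_spec h).2.2.2.1⟩
    have h3 : φ.toFun (q₁.pos k + C₁'.len k) = 0 :=
      le_antisymm ((ToricMonoid.Hom.map_mono φ (q₁.pos_add_len_le k)).trans (by rw [h1, h0]))
        (ToricMonoid.Hom.map_nonneg φ (add_nonneg (q₁.pos_nonneg k) (C₁'.len_nonneg k)))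
    rw [map_add] at h3
    have h4 := (add_eq_zero_iff_of_nonneg (ToricMonoid.Hom.map_nonneg φ (q₁.pos_nonneg k))
      (ToricMonoid.Hom.map_nonneg φ (C₁'.len_nonneg k))).1 h3
    have h5 := hsymm (hfirst k h4.1)
    rw [h1] at h5
    exact h5.tail (h2 ▸ hR k h4.2)
  have hon : ∀ v w, f.onV v = f.onV w → Relation.ReflTransGen R (q₁.onV v) (q₁.onV w) := by
    intro v w hvw
    have := (f.onV_eq_iff v w).1 hvw
    clear hvw
    induction this with
    | refl => exact Relation.ReflTransGen.refl
    | tail _ hstep ih =>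
      obtain ⟨h, hh, rfl, rfl⟩ := hstep
      exact ih.trans (hedge h (f.len_contracted h hh))
  have hvert : ∀ a, (∃ v, Relation.ReflTransGen R a (q₁.onV v)) ∨
      ∃ h' k, C₁'.src h' = a ∧ f.onD k = q₁.onD h' ∧
        q₁.liftV q₂ f a = q₂.vertexAt k (φ.toFun (q₁.pos h')) ∧
        φ.toFun (q₁.pos h') ∈ q₂.points k ∧
        q₂.vertexAt k (φ.toFun (q₁.pos h')) ∉ Set.range q₂.onV := by
    intro a
    by_cases ha : a ∈ Set.range q₁.onV
    · obtain ⟨v, rfl⟩ := ha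
      exact Or.inl ⟨v, Relation.ReflTransGen.refl⟩
    obtain ⟨h', rfl⟩ := q₁.exists_src_eq ha
    by_cases hk : q₁.onD h' ∈ Set.range f.onD
    · obtain ⟨k, hk⟩ := hk
      have hmem : φ.toFun (q₁.pos h') ∈ q₂.points k :=
        (hpts _ _).2 ⟨_, hk ▸ q₁.pos_mem_points h', rfl⟩
      by_cases hx : q₂.vertexAt k (φ.toFun (q₁.pos h')) ∈ Set.range q₂.onV
      · left
        rcases q₂.eq_zero_or_eq_len_of_vertexAt_mem hmem hx with h0 | h0
        · exact ⟨_, hfirst h' h0⟩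
        · obtain ⟨h'', h1, h2, h3⟩ := q₁.exists_twin ha
          refine ⟨_, h2 ▸ hfirst h'' ?_⟩
          rw [h3, map_sub, h0, ← hk, f.len_onD, sub_self]
      · exact Or.inr ⟨h', k, rfl, hk, liftV_src_of_eq hpts hk, hmem, hx⟩
    · exact Or.inl ⟨_, hfirst h' (q₁.map_pos_eq_zero hk)⟩
  have hback : ∀ {a b}, Relation.ReflTransGen R a b → q₁.liftV q₂ f a = q₁.liftV q₂ f b := by
    intro a b hab
    induction hab with
    | refl => rfl
    | tail _ hstep ih =>
      obtain ⟨h', h0, rfl, rfl⟩ := hstep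
      exact ih.trans (liftV_contracted hpts h0)
  rcases hvert v with ⟨a, ha⟩ | ⟨h₁, k₁, rfl, hk₁, hl₁, hm₁, hx₁⟩
  · rcases hvert w with ⟨b, hb⟩ | ⟨h₂, k₂, rfl, hk₂, hl₂, hm₂, hx₂⟩
    · refine ha.trans (Relation.ReflTransGen.trans (hon a b ?_) (hsymm hb))
      apply q₂.onV_injective
      rw [← q₁.liftV_onV q₂ f, ← q₁.liftV_onV q₂ f, ← hback ha, ← hback hb, hvw]
    · refine absurd ⟨f.onV a, ?_⟩ hx₂
      rw [← hl₂, ← hvw, hback ha, liftV_onV]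
  · rcases hvert w with ⟨b, hb⟩ | ⟨h₂, k₂, rfl, hk₂, hl₂, hm₂, hx₂⟩
    · refine absurd ⟨f.onV b, ?_⟩ hx₁
      rw [← hl₁, hvw, hback hb, liftV_onV]
    · have hsame : ∀ h₁ h₂ : C₁'.D, q₁.onD h₁ = q₁.onD h₂ →
          φ.toFun (q₁.pos h₁) = φ.toFun (q₁.pos h₂) →
          Relation.ReflTransGen R (C₁'.src h₁) (C₁'.src h₂) := by
        intro h₁ h₂ hh hp
        rcases q₁.le_total_pos hh with hle | hle
        · exact q₁.reflTransGen_of_map_pos_eq φ hR hh hp hle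
        · exact hsymm (q₁.reflTransGen_of_map_pos_eq φ hR hh.symm hp.symm hle)
      have hne : ∀ {k : C₂.D} {p : M₂.gp}, q₂.vertexAt k p ∉ Set.range q₂.onV → p ≠ C₂.len k := by
        rintro k p hx rfl
        exact hx ⟨_, (q₂.vertexAt_len k).symm⟩
      obtain ⟨e₁, he₁, hp₁⟩ := q₂.exists_pos_eq hm₁ (hne hx₁)
      obtain ⟨e₂, he₂, hp₂⟩ := q₂.exists_pos_eq hm₂ (hne hx₂)
      have hs : C₂'.src e₂ = C₂'.src e₁ := by
        rw [← q₂.vertexAt_pos, ← q₂.vertexAt_pos, he₁, hp₁, he₂, hp₂, ← hl₁, ← hl₂, hvw]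
      have hx : C₂'.src e₁ ∉ Set.range q₂.onV := by
        rw [← q₂.vertexAt_pos, he₁, hp₁]; exact hx₁
      rcases q₂.eq_or_twin hx hs with rfl | ⟨h3, h4⟩
      · exact hsame h₁ h₂ (by rw [← hk₁, ← hk₂, ← he₁, ← he₂]) (by rw [← hp₁, ← hp₂])
      · have hxx : C₁'.src h₂ ∉ Set.range q₁.onV := by
          rintro ⟨v, hv⟩
          exact hx₂ ⟨f.onV v, by rw [← hl₂, ← hv, liftV_onV]⟩
        obtain ⟨h₃, e3, e4, e5⟩ := q₁.exists_twin hxx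
        rw [← e4]
        refine hsame h₁ h₃ ?_ ?_
        · rw [e3, ← hk₁, ← hk₂, ← he₂, h3, ← he₁, ← f.onD_inv, C₂.inv_inv]
        · rw [e5, map_sub, ← hk₂, f.len_onD, ← hp₂, h4, ← hp₁, ← he₂, h3, C₂.len_inv]
          abel

/-- A map of tropical curves lifts to subdivisions if the positions of the vertices correspond. -/
theorem exists_compatible : ∃ f' : TropicalHom φ C₁' C₂', q₁.Compatible q₂ f' f := by
  classical
  choose D hD1 hD2 hD3 using exists_liftD hpts
  have hlen : ∀ k', φ.toFun (C₁'.len (D k')) = C₂'.len k' :=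
    fun k' => map_len_of_map_pos_eq hpts (hD1 k') (hD2 k') (hD3 k')
  have huniq : ∀ h' k', φ.toFun (C₁'.len h') ≠ 0 → q₁.onD h' = f.onD (q₂.onD k') →
      φ.toFun (q₁.pos h') = q₂.pos k' → D k' = h' := fun h' k' h1 h2 h3 =>
    q₁.eq_of_map_pos_eq (φ := φ) (by rw [hD1, h2]) (by rw [hD2, h3]) (hD3 k') h1
  have hrange : ∀ h', h' ∉ Set.range D ↔ φ.toFun (C₁'.len h') = 0 := by
    intro h'
    rw [← not_iff_not, not_not]
    constructor
    · rintro ⟨k', rfl⟩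
      exact hD3 k'
    · intro hl
      obtain ⟨k', h1, h2⟩ := exists_eq_liftD hpts hl
      exact ⟨k', huniq h' k' hl h1 h2⟩
  refine ⟨{ onV := q₁.liftV q₂ f, onD := D, onV_surjective := ?_, onD_injective := ?_,
            onD_inv := ?_, onV_src := ?_, onV_eq_iff := ?_, canDeg_eq := ?_, onV_leg := ?_,
            len_onD := hlen, len_contracted := fun h' hh => (hrange h').1 hh },
    fun v => q₁.liftV_onV q₂ f v, hD1⟩
  · intro v'
    by_cases hv : v' ∈ Set.range q₂.onV
    · obtain ⟨v, rfl⟩ := hv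
      obtain ⟨w, rfl⟩ := f.onV_surjective v
      exact ⟨q₁.onV w, q₁.liftV_onV q₂ f w⟩
    · obtain ⟨k', rfl⟩ := q₂.exists_src_eq hv
      exact ⟨C₁'.src (D k'), by rw [liftV_src_of_eq hpts (hD1 k').symm, hD2, vertexAt_pos]⟩
  · intro a b hab
    refine q₂.pos_injOn (f.onD_injective ?_) ?_
    · rw [← hD1, hab, hD1]
    · rw [← hD2, hab, hD2]
  · intro k'
    refine huniq _ _ ?_ ?_ ?_
    · rw [C₁'.len_inv]; exact hD3 k'
    · rw [q₁.onD_inv, hD1, q₂.onD_inv, f.onD_inv]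
    · rw [pos_inv, pos_inv, map_sub, map_add, hD1, f.len_onD, hlen, hD2]
  · intro k'
    rw [liftV_src_of_eq hpts (hD1 k').symm, hD2, vertexAt_pos]
  · intro v w
    simp only [liftV_eq_iff hpts, hrange]
  · intro v'
    -- Exceptional vertices have `canDeg` zero, so the genus condition reduces to that for `f`.
    rw [Finset.sum_filter, q₁.sum_eq_sum_onV]
    · simp only [liftV_onV, canDeg_onV]
      by_cases hv : v' ∈ Set.range q₂.onV
      · obtain ⟨v, rfl⟩ := hv
        rw [canDeg_onV, f.canDeg_eq, Finset.sum_filter]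
        simp only [q₂.onV_injective.eq_iff]
      · rw [q₂.canDeg_exceptional hv]
        exact (Finset.sum_eq_zero fun v _ => if_neg fun h => hv ⟨_, h⟩).symm
    · intro v hv
      rw [q₁.canDeg_exceptional hv, ite_self]
  · intro i
    rw [q₁.leg_eq, liftV_onV, f.onV_leg, q₂.leg_eq]

end Exists

end CurveSubdivision
end TropRub

namespace TropRub

/-! ### Construction of subdivisions -/

namespace CurveSubdivision

theorem pos_eq_of_tgt_eq_src {M : ToricMonoid} {n : ℕ} {C' C : TropicalCurve M n}
    (q : CurveSubdivision C' C) {k h' : C'.D} (hk : q.onD k = q.onD h') (ht : C'.tgt k = C'.src h')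
    (hx : C'.src h' ∉ Set.range q.onV) : q.pos h' = q.pos k + C'.len k := by
  rcases q.next k with ⟨h1, -⟩ | ⟨h'', h1, h2, -, h3⟩
  · exact absurd ⟨_, h1.symm.trans ht⟩ hx
  · rcases q.eq_or_twin hx (h2.trans ht) with rfl | ⟨h4, -⟩
    · exact h3
    · exact absurd (h4.symm.trans (h1.trans hk)) (C.inv_ne _)

theorem isQuasiStable_of_points {M : ToricMonoid} {n : ℕ} {C' C : TropicalCurve M n}
    (q : CurveSubdivision C' C) (hq : ∀ h, ∃ x, ∀ p ∈ q.points h, p = 0 ∨ p = x ∨ p = C.len h) :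
    q.IsQuasiStable := by
  classical
  intro h
  obtain ⟨x, hx⟩ := hq h
  refine (Finset.card_le_card_of_injOn (t := {0, x}) q.pos (fun h' hh => ?_) ?_).trans
    Finset.card_le_two
  · simp only [Finset.coe_filter, Finset.mem_univ, true_and, Set.mem_ofPred_eq] at hh
    have h1 := hx _ (hh ▸ q.pos_mem_points h')
    have h2 := (q.pos_lt_len h').ne
    rw [hh] at h2
    simp only [Finset.coe_insert, Finset.coe_singleton, Set.mem_insert_iff, Set.mem_singleton_iff]
    tauto
  · intro a ha b hb hab
    simp only [Finset.coe_filter, Finset.mem_univ, true_and, Set.mem_ofPred_eq] at ha hb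
    exact q.pos_injOn (ha.trans hb.symm) hab

end CurveSubdivision

/-- Positions of inner vertices on the edges of a tropical curve. -/
structure SubdivisionData {M : ToricMonoid} {n : ℕ} (C : TropicalCurve M n) where
  num : C.D → ℕ
  p : C.D → ℕ → M.gp
  num_inv : ∀ h, num (C.inv h) = num h
  p_zero : ∀ h, p h 0 = 0
  p_last : ∀ h, p h (num h + 1) = C.len h
  p_lt : ∀ h i, i ≤ num h → p h i < p h (i + 1)
  p_inv : ∀ h i, i ≤ num h + 1 → p (C.inv h) i = C.len h - p h (num h + 1 - i)

namespace SubdivisionData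

variable {M : ToricMonoid} {n : ℕ} {C : TropicalCurve M n} (s : SubdivisionData C)

theorem sigma_ext {N : C.D → ℕ} {x y : Σ h, Fin (N h)} (h1 : x.1 = y.1)
    (h2 : (x.2 : ℕ) = y.2) : x = y := by
  obtain ⟨h, i⟩ := x
  obtain ⟨k, j⟩ := y
  obtain rfl : h = k := h1
  rw [Sigma.mk.injEq]
  exact ⟨rfl, heq_of_eq (Fin.ext h2)⟩

/-- Two oriented positions give the same exceptional vertex. -/
def setoid : Setoid (Σ h, Fin (s.num h)) where
  -- Index `i` stands for position `p h (i + 1)`. Reversal sends it to index `num - 1 - i`, whence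
  -- the `+ 1`.
  r x y := x = y ∨ (y.1 = C.inv x.1 ∧ (x.2 : ℕ) + y.2 + 1 = s.num x.1)
  iseqv := by
    refine ⟨fun _ => Or.inl rfl, ?_, ?_⟩
    · rintro x y (rfl | ⟨h1, h2⟩)
      · exact Or.inl rfl
      · have e : s.num y.1 = s.num x.1 := by rw [h1, s.num_inv]
        exact Or.inr ⟨by rw [h1, C.inv_inv], by omega⟩
    · rintro x y z (rfl | ⟨h1, h2⟩) (rfl | ⟨h3, h4⟩)
      · exact Or.inl rfl
      · exact Or.inr ⟨h3, h4⟩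
      · exact Or.inr ⟨h1, h2⟩
      · have e : s.num y.1 = s.num x.1 := by rw [h1, s.num_inv]
        exact Or.inl (sigma_ext (by rw [h3, h1, C.inv_inv]) (by omega))

/-- The exceptional vertex at an oriented position. -/
def inner (h : C.D) (i : ℕ) (hi : i < s.num h) : Quotient s.setoid := Quotient.mk _ ⟨h, ⟨i, hi⟩⟩

theorem inner_eq_iff {h k : C.D} {i j : ℕ} {hi : i < s.num h} {hj : j < s.num k} :
    s.inner h i hi = s.inner k j hj ↔
      (h = k ∧ i = j) ∨ (k = C.inv h ∧ i + j + 1 = s.num h) := by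
  refine Quotient.eq.trans ?_
  change (_ ∨ _) ↔ _
  refine or_congr ⟨fun h => ?_, fun h => sigma_ext h.1 h.2⟩ Iff.rfl
  exact ⟨congrArg Sigma.fst h, congrArg (fun x : Σ h, Fin (s.num h) => (x.2 : ℕ)) h⟩

open Classical in
/-- The underlying graph of the subdivision. -/
noncomputable def graph : DualGraph n where
  V := C.V ⊕ Quotient s.setoid
  D := Σ h, Fin (s.num h + 1)
  fintypeV := Fintype.ofFinite _
  fintypeD := inferInstance
  -- The pieces are numbered `0, …, num`; piece `i > 0` begins at the inner vertex of index `i - 1`,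
  -- and reversal sends piece `i` to piece `num - i`.
  src x := if hx : (x.2 : ℕ) = 0 then Sum.inl (C.src x.1)
    else Sum.inr (s.inner x.1 (x.2 - 1) (by omega))
  inv x := ⟨C.inv x.1, ⟨s.num x.1 - x.2, by rw [s.num_inv]; omega⟩⟩
  inv_inv x := by
    refine sigma_ext (C.inv_inv _) ?_
    have := s.num_inv x.1
    simp only
    omega
  inv_ne x hx := C.inv_ne _ (congrArg Sigma.fst hx)
  genus := Sum.elim C.genus fun _ => 0
  leg i := Sum.inl (C.leg i)

theorem src_graph_zero (x : s.graph.D) (hx : (x.2 : ℕ) = 0) : s.graph.src x = Sum.inl (C.src x.1) :=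
  dif_pos hx

theorem src_graph_pos (x : s.graph.D) (hx : (x.2 : ℕ) ≠ 0) :
    s.graph.src x = Sum.inr (s.inner x.1 (x.2 - 1) (by have := x.2.2; omega)) :=
  dif_neg hx

/-- The subdivided tropical curve. -/
noncomputable def curve : TropicalCurve M n where
  toDualGraph := s.graph
  len x := s.p x.1 (x.2 + 1) - s.p x.1 x.2
  len_mem x := M.nonneg_iff_mem.1 (sub_nonneg.2 (s.p_lt x.1 x.2 (by have := x.2.2; omega)).le)
  len_ne_zero x := (sub_pos.2 (s.p_lt x.1 x.2 (by have := x.2.2; omega))).ne'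
  len_inv x := by
    have hx : (x.2 : ℕ) ≤ s.num x.1 := by have := x.2.2; omega
    change s.p (C.inv x.1) (s.num x.1 - x.2 + 1) - s.p (C.inv x.1) (s.num x.1 - x.2) = _
    rw [s.p_inv _ _ (by omega), s.p_inv _ _ (by omega),
      show s.num x.1 + 1 - (s.num x.1 - x.2 + 1) = x.2 by omega,
      show s.num x.1 + 1 - (s.num x.1 - x.2) = x.2 + 1 by omega]
    abel

theorem tgt_graph_last (x : s.graph.D) (hx : (x.2 : ℕ) = s.num x.1) :
    s.graph.tgt x = Sum.inl (C.tgt x.1) := by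
  refine (s.src_graph_zero _ ?_).trans rfl
  change s.num x.1 - (x.2 : ℕ) = 0
  omega

theorem tgt_graph_inner (x : s.graph.D) (hx : (x.2 : ℕ) < s.num x.1) :
    s.graph.tgt x = Sum.inr (s.inner x.1 x.2 hx) := by
  refine (s.src_graph_pos _ ?_).trans ?_
  · change s.num x.1 - (x.2 : ℕ) ≠ 0
    omega
  · refine congrArg Sum.inr (s.inner_eq_iff.2 (Or.inr ⟨(C.inv_inv _).symm, ?_⟩))
    change s.num x.1 - (x.2 : ℕ) - 1 + x.2 + 1 = s.num (C.inv x.1)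
    rw [s.num_inv]
    omega

theorem valence_inner (h : C.D) (i : ℕ) (hi : i < s.num h) :
    s.graph.valence (Sum.inr (s.inner h i hi)) = 2 := by
  classical
  have hi' : s.num h - i < s.num (C.inv h) + 1 := by rw [s.num_inv]; omega
  let a : s.graph.D := ⟨h, ⟨i + 1, by omega⟩⟩
  let b : s.graph.D := ⟨C.inv h, ⟨s.num h - i, hi'⟩⟩
  have hab : a ≠ b := fun he => C.inv_ne h (congrArg Sigma.fst he).symm
  unfold DualGraph.valence
  rw [Finset.card_eq_two]
  refine ⟨a, b, hab, ?_⟩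
  ext x
  simp only [Finset.mem_filter, Finset.mem_univ, true_and, Finset.mem_insert,
    Finset.mem_singleton]
  constructor
  · intro hx
    by_cases h0 : (x.2 : ℕ) = 0
    · rw [s.src_graph_zero x h0] at hx
      cases hx
    · rw [s.src_graph_pos x h0] at hx
      rcases s.inner_eq_iff.1 (Sum.inr_injective hx) with ⟨h1, h2⟩ | ⟨h1, h2⟩
      · left
        refine sigma_ext h1 ?_
        change (x.2 : ℕ) = i + 1
        omega
      · right
        refine sigma_ext ((C.inv_inv _).symm.trans (congrArg C.inv h1.symm)) ?_
        have h3 := s.num_inv x.1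
        rw [← h1] at h3
        change (x.2 : ℕ) = s.num h - i
        omega
  · rintro (rfl | rfl)
    · rw [s.src_graph_pos _ (Nat.succ_ne_zero i)]
      rfl
    · rw [s.src_graph_pos _ (by change s.num h - i ≠ 0; omega)]
      refine congrArg Sum.inr (s.inner_eq_iff.2 (Or.inr ⟨(C.inv_inv h).symm, ?_⟩))
      change s.num h - i - 1 + i + 1 = s.num (C.inv h)
      rw [s.num_inv]
      omega

/-- The edge of the subdivision with a given initial position. -/
def mkEdge (h : C.D) (i : ℕ) (hi : i < s.num h + 1) : s.curve.D :=
  (⟨h, ⟨i, hi⟩⟩ : Σ h, Fin (s.num h + 1))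

theorem src_mkEdge_zero (h : C.D) :
    s.curve.src (s.mkEdge h 0 (Nat.succ_pos _)) = (Sum.inl (C.src h) : C.V ⊕ Quotient s.setoid) :=
  s.src_graph_zero _ rfl

theorem src_mkEdge_succ (h : C.D) (i : ℕ) (hi : i < s.num h) :
    s.curve.src (s.mkEdge h (i + 1) (Nat.succ_lt_succ hi)) =
      (Sum.inr (s.inner h i hi) : C.V ⊕ Quotient s.setoid) :=
  s.src_graph_pos _ (Nat.succ_ne_zero i)

theorem tgt_mkEdge_of_lt (h : C.D) (i : ℕ) (hi : i < s.num h) :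
    s.curve.tgt (s.mkEdge h i (Nat.lt_succ_of_lt hi)) =
      (Sum.inr (s.inner h i hi) : C.V ⊕ Quotient s.setoid) :=
  s.tgt_graph_inner _ hi

theorem tgt_mkEdge_last (h : C.D) :
    s.curve.tgt (s.mkEdge h (s.num h) (Nat.lt_succ_self _)) =
      (Sum.inl (C.tgt h) : C.V ⊕ Quotient s.setoid) :=
  s.tgt_graph_last _ rfl

/-- The subdivision with the given positions of the exceptional vertices. -/
noncomputable def subdivision : CurveSubdivision s.curve C where
  onV := Sum.inl
  onD := Sigma.fst
  onV_injective := Sum.inl_injective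
  onD_inv _ := rfl
  path h := by
    refine ⟨s.num h, fun i => s.mkEdge h i i.2, fun i j hij => ?_, ?_, ?_, ?_, ?_, ?_⟩
    · exact Fin.ext (congrArg (fun x : s.graph.D => (x.2 : ℕ)) hij)
    · intro x
      constructor
      · rintro rfl
        exact ⟨x.2, rfl⟩
      · rintro ⟨i, rfl⟩
        rfl
    · exact s.src_mkEdge_zero h
    · exact s.tgt_mkEdge_last h
    · intro i
      refine ⟨(s.tgt_mkEdge_of_lt h i i.2).trans (s.src_mkEdge_succ h i i.2).symm, ?_⟩
      rintro ⟨v, hv⟩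
      cases hv.trans (s.tgt_mkEdge_of_lt h i i.2)
    · change ∑ i : Fin (s.num h + 1), (s.p h (i + 1) - s.p h i) = _
      rw [Fin.sum_univ_eq_sum_range (fun i => s.p h (i + 1) - s.p h i), Finset.sum_range_sub,
        s.p_last, s.p_zero, sub_zero]
  genus_onV _ := rfl
  leg_eq _ := rfl
  exceptional v' hv := by
    obtain v | v := v'
    · exact absurd ⟨v, rfl⟩ hv
    · induction v using Quotient.inductionOn with
      | h x => exact ⟨rfl, s.valence_inner x.1 x.2 x.2.2⟩

theorem pos_subdivision (h : C.D) (i : ℕ) (hi : i < s.num h + 1) :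
    s.subdivision.pos (s.mkEdge h i hi) = s.p h i := by
  induction i with
  | zero =>
    rw [s.p_zero, s.subdivision.pos_eq_zero_iff]
    exact ⟨C.src h, (s.src_mkEdge_zero h).symm⟩
  | succ i ih =>
    rw [s.subdivision.pos_eq_of_tgt_eq_src (k := s.mkEdge h i (by omega))
      (h' := s.mkEdge h (i + 1) hi) rfl
      ((s.tgt_mkEdge_of_lt h i (by omega)).trans (s.src_mkEdge_succ h i (by omega)).symm), ih]
    · change _ + (s.p h (i + 1) - s.p h i) = _
      abel
    · rintro ⟨v, hv⟩
      cases hv.trans (s.src_mkEdge_succ h i (by omega))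

theorem mem_points_subdivision {h : C.D} {x : M.gp} :
    x ∈ s.subdivision.points h ↔ ∃ i ≤ s.num h + 1, s.p h i = x := by
  constructor
  · rintro (rfl | ⟨⟨k, i⟩, hk, rfl⟩)
    · exact ⟨_, le_rfl, s.p_last h⟩
    · obtain rfl : k = h := hk
      exact ⟨i, i.2.le, (s.pos_subdivision k i i.2).symm⟩
  · rintro ⟨i, hi, rfl⟩
    rcases hi.eq_or_lt with rfl | hi
    · rw [s.p_last]
      exact s.subdivision.len_mem_points h
    · exact Or.inr ⟨s.mkEdge h i hi, rfl, s.pos_subdivision h i hi⟩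

end SubdivisionData
end TropRub

namespace TropRub

/-! ### Piecewise linear functions on subdivisions -/

namespace ToricMonoid

variable {M : ToricMonoid}

theorem zsmul_right_cancel {s t : ℤ} {x : M.gp} (hx : x ≠ 0) (h : s • x = t • x) : s = t :=
  smul_left_injective ℤ hx h

theorem nonneg_of_zsmul_nonneg {s : ℤ} (hs : 0 < s) {x : M.gp} (h : 0 ≤ s • x) : 0 ≤ x := by
  obtain ⟨k, rfl⟩ := Int.eq_ofNat_of_zero_le hs.le
  rw [natCast_zsmul] at h
  exact M.nonneg_of_nsmul_nonneg (by omega) h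

theorem zsmul_le_zsmul_of_le {s t : ℤ} (hst : s ≤ t) {x : M.gp} (hx : 0 ≤ x) : s • x ≤ t • x := by
  rw [← sub_nonneg, ← sub_smul]
  exact zsmul_nonneg hx (sub_nonneg.2 hst)

theorem lt_of_zsmul_lt_zsmul {s t : ℤ} {x : M.gp} (hx : 0 ≤ x) (h : s • x < t • x) : s < t := by
  by_contra hst
  exact absurd h (not_lt_of_ge (zsmul_le_zsmul_of_le (not_lt.1 hst) hx))

/-- `y` lies weakly between `a` and `b`. -/
def IsBetween (a b y : M.gp) : Prop := (a ≤ y ∧ y ≤ b) ∨ (b ≤ y ∧ y ≤ a)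

end ToricMonoid

namespace PLFunction

variable {M : ToricMonoid} {n : ℕ} {C : TropicalCurve M n} (α : PLFunction C)

theorem slope_inv (h : C.D) : α.slope (C.inv h) = -α.slope h := by
  refine ToricMonoid.zsmul_right_cancel (C.len_ne_zero h) ?_
  have h1 := α.val_tgt_sub h
  have h2 := α.val_tgt_sub (C.inv h)
  rw [C.len_inv, DualGraph.tgt_inv, DualGraph.src_inv] at h2
  rw [← h2, neg_smul, ← h1, neg_sub]

theorem val_tgt (h : C.D) : α.val (C.tgt h) = α.val (C.src h) + α.slope h • C.len h := by
  rw [← α.val_tgt_sub]; abel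

-- Discrete divergence theorem: the two orientations of an edge inside `S` cancel because slopes are
-- antisymmetric.
open Classical in
theorem sum_div (S : Finset C.V) : ∑ v ∈ S, α.div v = ∑ h ∈ C.inEdges S, α.slope h := by
  have h1 : ∑ v ∈ S, α.div v = ∑ h with C.tgt h ∈ S, α.slope h := by
    simp only [PLFunction.div]
    rw [← Finset.sum_fiberwise_of_maps_to (s := Finset.univ.filter fun h => C.tgt h ∈ S) (t := S)
      (g := C.tgt) (by simp)]
    refine Finset.sum_congr rfl fun v hv => Finset.sum_congr ?_ fun _ _ => rfl
    ext h
    simp only [Finset.mem_filter, Finset.mem_univ, true_and]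
    exact ⟨fun e => ⟨e ▸ hv, e⟩, fun e => e.2⟩
  have h2 : (∑ h with C.tgt h ∈ S ∧ C.src h ∈ S, α.slope h) = 0 := by
    have : (∑ h with C.tgt h ∈ S ∧ C.src h ∈ S, α.slope h) =
        ∑ h with C.tgt h ∈ S ∧ C.src h ∈ S, α.slope (C.inv h) := by
      refine Finset.sum_equiv C.invEquiv (fun h => ?_) fun h _ => ?_
      · simp [and_comm]
      · simp [C.inv_inv]
    simp only [slope_inv, Finset.sum_neg_distrib] at this
    omega
  rw [h1, ← Finset.sum_filter_add_sum_filter_not _ (fun h => C.src h ∈ S), Finset.filter_filter,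
    h2, zero_add]
  refine Finset.sum_congr ?_ fun _ _ => rfl
  ext h
  simp [and_comm]

open Classical in
theorem sum_div_univ : ∑ v, α.div v = 0 := by
  rw [sum_div]
  refine Finset.sum_eq_zero fun h hh => ?_
  simp at hh

/-- Only `k` and the reversal of `h` enter this vertex. Admissibility can therefore be read as a
jump of the slope. -/
theorem div_exceptional {C' : TropicalCurve M n} (q : CurveSubdivision C' C) (α : PLFunction C')
    {k h : C'.D} (hk : q.onD k = q.onD h) (ht : C'.tgt k = C'.src h)
    (hx : C'.src h ∉ Set.range q.onV) : α.div (C'.src h) = α.slope k - α.slope h := by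
  classical
  have hne : k ≠ C'.inv h := by
    rintro rfl
    rw [q.onD_inv] at hk
    exact C.inv_ne _ hk
  have : (Finset.univ.filter fun e => C'.tgt e = C'.src h) = {k, C'.inv h} := by
    ext e
    simp only [Finset.mem_filter, Finset.mem_univ, true_and, Finset.mem_insert,
      Finset.mem_singleton]
    constructor
    · intro he
      by_contra hcon
      push Not at hcon
      have := q.eq_of_exceptional hx (a := C'.inv e) (b := C'.inv k) (c := h) he ht rfl
        (fun e' => hcon.1 (by rw [← C'.inv_inv e, e', C'.inv_inv]))
        (fun e' => hcon.2 (by rw [← e', C'.inv_inv]))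
      exact hne (by rw [← this, C'.inv_inv])
    · rintro (rfl | rfl)
      · exact ht
      · exact DualGraph.tgt_inv _ _
  rw [PLFunction.div, this, Finset.sum_pair hne, slope_inv]
  ring

theorem IsLift.val_src {C' : TropicalCurve M n} {q : CurveSubdivision C' C} {α' : PLFunction C'}
    {α : PLFunction C} (hl : α'.IsLift q α) (h' : C'.D) :
    α'.val (C'.src h') = α.val (C.src (q.onD h')) + α.slope (q.onD h') • q.pos h' := by
  obtain ⟨h, hh⟩ : ∃ h, q.onD h' = h := ⟨_, rfl⟩
  rw [hh]
  refine q.edge_induction (P := fun h' => α'.val (C'.src h') =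
    α.val (C.src h) + α.slope h • q.pos h') ?_ ?_ h' hh
  · intro k _ h0 hs
    rw [hs, h0, hl.1, smul_zero, add_zero]
  · intro k k' hk _ h1 _ h3 ih
    rw [← h1, α'.val_tgt, ih, h3, hl.2, hk, smul_add, add_assoc]

theorem IsLift.val_tgt {C' : TropicalCurve M n} {q : CurveSubdivision C' C} {α' : PLFunction C'}
    {α : PLFunction C} (hl : α'.IsLift q α) (h' : C'.D) :
    α'.val (C'.tgt h') = α.val (C.src (q.onD h')) +
      α.slope (q.onD h') • (q.pos h' + C'.len h') := by
  rw [α'.val_tgt, hl.val_src, hl.2, smul_add, add_assoc]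

/-- Every piecewise linear function lifts to every subdivision. -/
theorem exists_isLift {C' : TropicalCurve M n} (q : CurveSubdivision C' C) (α : PLFunction C) :
    ∃ α' : PLFunction C', α'.IsLift q α := by
  classical
  -- The interpolated value does not depend on the outgoing piece used to compute it; the case to
  -- check is that of a piece and its twin.
  have hex : ∀ v' : C'.V, ∃ y, ∀ h', C'.src h' = v' →
      y = α.val (C.src (q.onD h')) + α.slope (q.onD h') • q.pos h' := by
    intro v'
    by_cases hv : v' ∈ Set.range q.onV
    · obtain ⟨v, rfl⟩ := hv
      refine ⟨α.val v, fun h' hh => ?_⟩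
      have h0 : q.pos h' = 0 := q.pos_eq_zero_iff.2 ⟨v, hh.symm⟩
      rw [h0, smul_zero, add_zero, ← q.onV_injective (hh.symm.trans (q.src_of_pos_eq_zero h0))]
    · obtain ⟨k, rfl⟩ := q.exists_src_eq hv
      refine ⟨α.val (C.src (q.onD k)) + α.slope (q.onD k) • q.pos k, fun h' hh => ?_⟩
      rcases q.eq_or_twin hv hh with rfl | ⟨h1, h2⟩
      · rfl
      · rw [h1, h2, slope_inv, DualGraph.src_inv, α.val_tgt, smul_sub, neg_smul, neg_smul]
        abel
  choose val hval using hex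
  refine ⟨⟨fun v' => if hv : ∃ v, q.onV v = v' then α.val hv.choose else val v',
    fun h' => α.slope (q.onD h'), ?_⟩, ?_, fun _ => rfl⟩
  · have hsrc : ∀ h', (if hv : ∃ v, q.onV v = C'.src h' then α.val hv.choose
        else val (C'.src h')) = α.val (C.src (q.onD h')) + α.slope (q.onD h') • q.pos h' := by
      intro h'
      split_ifs with hv
      · have h0 := q.pos_eq_zero_iff.2 hv
        have h1 := hv.choose_spec.trans (q.src_of_pos_eq_zero h0)
        rw [q.onV_injective h1, h0, smul_zero, add_zero]
      · exact hval _ h' rfl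
    intro h'
    have := hsrc (C'.inv h')
    rw [DualGraph.src_inv, q.onD_inv, DualGraph.src_inv, slope_inv, q.pos_inv, α.val_tgt] at this
    rw [this, hsrc, smul_sub, neg_smul, neg_smul, smul_add]
    abel
  · intro v
    have hv : ∃ w, q.onV w = q.onV v := ⟨v, rfl⟩
    exact (dif_pos hv).trans (congrArg α.val (q.onV_injective hv.choose_spec))

end PLFunction

namespace CurveSubdivision

variable {M : ToricMonoid} {n : ℕ} {C' C : TropicalCurve M n} (q : CurveSubdivision C' C)

open Classical in
theorem sum_lift {R : Type*} [AddCommMonoid R] (F : C.V → R) (S : Finset C'.V) :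
    ∑ v' ∈ S, q.lift F v' = ∑ v with q.onV v ∈ S, F v := by
  unfold lift
  rw [← Finset.sum_fiberwise_of_maps_to (s := Finset.univ.filter fun v => q.onV v ∈ S) (t := S)
      (g := q.onV) (by simp)]
  refine Finset.sum_congr rfl fun v' hv => Finset.sum_congr ?_ fun _ _ => rfl
  ext v
  simp only [Finset.mem_filter, Finset.mem_univ, true_and]
  exact ⟨fun e => ⟨e ▸ hv, e⟩, fun e => e.2⟩

theorem lift_exceptional {R : Type*} [AddCommMonoid R] (F : C.V → R) {v' : C'.V}
    (hv : v' ∉ Set.range q.onV) : q.lift F v' = 0 := by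
  classical
  rw [lift]
  refine Finset.sum_eq_zero fun v hh => ?_
  exact absurd ⟨v, (Finset.mem_filter.1 hh).2⟩ hv

/-- The first edge of the path over an oriented edge. -/
noncomputable def first (h : C.D) : C'.D := q.edge h 0

@[simp] theorem onD_first (h : C.D) : q.onD (q.first h) = h := q.onD_edge h 0

@[simp] theorem pos_first (h : C.D) : q.pos (q.first h) = 0 := q.pos_edge_zero h

theorem src_first (h : C.D) : C'.src (q.first h) = q.onV (C.src h) := (q.edge_spec h).2.2.1

theorem eq_first {h' : C'.D} (h0 : q.pos h' = 0) : h' = q.first (q.onD h') :=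
  q.pos_injOn (q.onD_first _).symm (by rw [h0, pos_first])

variable {q}

/-- On a quasi-stable model, an edge is either not subdivided or has a second half `k`. -/
theorem IsQuasiStable.cases (hq : q.IsQuasiStable) (h : C.D) :
    (C'.tgt (q.first h) = q.onV (C.tgt h) ∧ C'.len (q.first h) = C.len h ∧
      ∀ h', q.onD h' = h → h' = q.first h) ∨
    ∃ k, q.onD k = h ∧ C'.tgt (q.first h) = C'.src k ∧ C'.src k ∉ Set.range q.onV ∧
      q.pos k = C'.len (q.first h) ∧ C'.tgt k = q.onV (C.tgt h) ∧
      C'.len (q.first h) + C'.len k = C.len h ∧ k ≠ q.first h ∧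
      ∀ h', q.onD h' = h → h' = q.first h ∨ h' = k := by
  classical
  rcases q.next (q.first h) with ⟨h1, h2⟩ | ⟨k, h1, h2, h3, h4⟩
  · rw [onD_first] at h1 h2
    rw [pos_first, zero_add] at h2
    refine Or.inl ⟨h1, h2, fun h' hh => ?_⟩
    rcases q.eq_or_le_of_onD_eq (hh.trans (q.onD_first h).symm) with h3 | h3 | h3
    · exact h3
    · rw [pos_first] at h3
      exact absurd h3 (not_le_of_gt (add_pos_of_nonneg_of_pos (q.pos_nonneg _) (C'.len_pos _)))
    · rw [pos_first, zero_add, h2] at h3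
      exact absurd h3 (not_le_of_gt (hh ▸ q.pos_lt_len h'))
  · rw [onD_first] at h1
    rw [pos_first, zero_add] at h4
    have hne : k ≠ q.first h := by
      rintro rfl
      exact h3 ⟨_, (q.src_first h).symm⟩
    have hall : ∀ h', q.onD h' = h → h' = q.first h ∨ h' = k := by
      intro h' hh
      by_contra hcon
      push Not at hcon
      have := hq h
      refine absurd this (not_le_of_gt ?_)
      rw [Finset.two_lt_card]
      exact ⟨h', by simpa, q.first h, by simp, k, by simpa, hcon.1, hcon.2, hne.symm⟩
    right
    refine ⟨k, h1, h2.symm, h3, h4, ?_, ?_, hne, hall⟩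
    · rcases q.next k with ⟨h5, -⟩ | ⟨k', h5, h6, h7, h8⟩
      · rw [h5, h1]
      · exfalso
        rcases hall k' (h5.trans h1) with rfl | rfl
        · exact h7 ⟨_, (q.src_first h).symm⟩
        · exact absurd h8 (ne_of_lt (lt_add_of_pos_right _ (C'.len_pos _)))
    · rcases q.next k with ⟨-, h5⟩ | ⟨k', h5, h6, h7, h8⟩
      · rw [← h4, h5, h1]
      · exfalso
        rcases hall k' (h5.trans h1) with rfl | rfl
        · exact h7 ⟨_, (q.src_first h).symm⟩
        · exact absurd h8 (ne_of_lt (lt_add_of_pos_right _ (C'.len_pos _)))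

theorem IsQuasiStable.mem_points_iff (hq : q.IsQuasiStable) {h : C.D} {p : M.gp} :
    p ∈ q.points h ↔ p = 0 ∨ p = C'.len (q.first h) ∨ p = C.len h := by
  constructor
  · rintro (rfl | ⟨h', hh, rfl⟩)
    · simp
    · rcases hq.cases h with ⟨-, -, h1⟩ | ⟨k, -, -, -, h4, -, -, -, h1⟩
      · rw [h1 h' hh]; simp
      · rcases h1 h' hh with rfl | rfl
        · simp
        · simp [h4]
  · rintro (rfl | rfl | rfl)
    · exact q.zero_mem_points h
    · have := q.pos_add_len_mem_points (q.first h)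
      rwa [onD_first, pos_first, zero_add] at this
    · exact q.len_mem_points h

end CurveSubdivision
end TropRub

namespace TropRub

/-! ### Semistable models and potentials -/

variable {g n : ℕ}

/-- The difference of the universal divisor and the universal stability condition. -/
noncomputable def charge (A : UniversalFunction g n ℤ) (θ : UniversalFunction g n ℝ)
    (Γ : DualGraph n) (hΓ : Γ.IsStable g) (v : Γ.V) : ℝ := (A.toFun Γ hΓ v : ℝ) - θ.toFun Γ hΓ v

variable [NeZero n]

/-- A quasi-stable model with a piecewise linear function defining a semistable admissible
divisor, the values of the function being totally ordered. -/
structure Model (A : UniversalFunction g n ℤ) (θ : UniversalFunction g n ℝ) {M : ToricMonoid}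
    (C : TropicalCurve M n) (hC : C.IsStable g) where
  C' : TropicalCurve M n
  q : CurveSubdivision C' C
  quasiStable : q.IsQuasiStable
  α : PLFunction C'
  α_leg : α.val (C'.leg 0) = 0
  admissible : ∀ v', v' ∉ Set.range q.onV →
    q.lift (A.toFun C.toDualGraph hC) v' - α.div v' = 1
  semistable : IsSemistable C'.toDualGraph (q.lift (θ.toFun C.toDualGraph hC))
    fun v' => q.lift (A.toFun C.toDualGraph hC) v' - α.div v'
  total : ∀ v w, α.val v ≤ α.val w ∨ α.val w ≤ α.val v

/-- A semistable potential on the vertices of a tropical curve, `s` being a choice of lower bounds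
for its slopes. -/
structure IsSolution (A : UniversalFunction g n ℤ) (θ : UniversalFunction g n ℝ) {M : ToricMonoid}
    (C : TropicalCurve M n) (hC : C.IsStable g) (a : C.V → M.gp) (s : C.D → ℤ) : Prop where
  leg : a (C.leg 0) = 0
  smul_le : ∀ h, s h • C.len h ≤ a (C.tgt h) - a (C.src h)
  le_smul : ∀ h, a (C.tgt h) - a (C.src h) ≤ (s h + 1) • C.len h
  sum_le : ∀ S : Finset C.V, ∑ v ∈ S, charge A θ C.toDualGraph hC v ≤
    ∑ h ∈ C.inEdges S, ((s h : ℝ) + 1 / 2)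

/-- The position at which the edge `h` has to be subdivided. -/
def breakPos {M : ToricMonoid} (C : TropicalCurve M n) (a : C.V → M.gp) (s : C.D → ℤ) (h : C.D) :
    M.gp := (s h + 1) • C.len h - (a (C.tgt h) - a (C.src h))

/-- The values of the potential at the vertices and at the subdivision points of the edges. -/
def potentialValue {M : ToricMonoid} (C : TropicalCurve M n) (a : C.V → M.gp) (s : C.D → ℤ) :
    C.V ⊕ C.D → M.gp :=
  Sum.elim a fun h => a (C.src h) + s h • breakPos C a s h

variable {A : UniversalFunction g n ℤ} {θ : UniversalFunction g n ℝ} {M : ToricMonoid}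
  {C : TropicalCurve M n} {hC : C.IsStable g}

namespace Model

variable (m : Model A θ C hC)

/-- The potential of a model. -/
def pot (v : C.V) : M.gp := m.α.val (m.q.onV v)

/-- The slopes of a model at the initial vertices of the edges. -/
noncomputable def slope (h : C.D) : ℤ := m.α.slope (m.q.first h)

/-- `A` is extended by zero, so `D = 1` means that `div α` is `-1`. -/
theorem slope_second {k : m.C'.D} (h1 : m.C'.tgt (m.q.first (m.q.onD k)) = m.C'.src k)
    (h2 : m.C'.src k ∉ Set.range m.q.onV) : m.α.slope k = m.slope (m.q.onD k) + 1 := by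
  have h3 := m.admissible _ h2
  rw [m.q.lift_exceptional _ h2, PLFunction.div_exceptional m.q m.α (m.q.onD_first _) h1 h2] at h3
  unfold slope
  omega

/-- If the slope is `s` over a length `t` and `s + 1` over the rest, then `a` grows by `(s + 1) len
- t`, which determines `t`. The formula remains true with `t = len` on an edge that is not
subdivided. The model is thus determined by its potential and slopes. -/
theorem len_first (h : C.D) : m.C'.len (m.q.first h) = breakPos C m.pot m.slope h := by
  unfold breakPos pot
  rcases m.quasiStable.cases h with ⟨h1, h2, -⟩ | ⟨k, hk, h1, h2, -, h4, h5, -⟩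
  · rw [← h1, m.α.val_tgt, m.q.src_first, h2, add_sub_cancel_left, ← sub_smul]
    simp [slope]
  · subst hk
    rw [← h4, m.α.val_tgt, ← h1, m.α.val_tgt, m.q.src_first, m.slope_second h1 h2, ← h5]
    simp only [slope, add_smul, smul_add, one_smul]
    abel

theorem breakPos_pos (h : C.D) : 0 < breakPos C m.pot m.slope h := m.len_first h ▸ m.C'.len_pos _

theorem breakPos_le (h : C.D) : breakPos C m.pot m.slope h ≤ C.len h := by
  have := m.q.pos_add_len_le (m.q.first h)
  rwa [m.q.pos_first, zero_add, m.q.onD_first, len_first] at this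

theorem mem_points_iff {h : C.D} {p : M.gp} :
    p ∈ m.q.points h ↔ p = 0 ∨ p = breakPos C m.pot m.slope h ∨ p = C.len h := by
  rw [m.quasiStable.mem_points_iff, len_first]

theorem val_tgt_first (h : C.D) :
    m.α.val (m.C'.tgt (m.q.first h)) = potentialValue C m.pot m.slope (Sum.inr h) := by
  rw [m.α.val_tgt, m.q.src_first, len_first]
  rfl

theorem pos_eq (h' : m.C'.D) :
    m.q.pos h' = 0 ∨ m.q.pos h' = breakPos C m.pot m.slope (m.q.onD h') := by
  rcases m.mem_points_iff.1 (m.q.pos_mem_points h') with h | h | h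
  · exact Or.inl h
  · exact Or.inr h
  · exact absurd h (m.q.pos_lt_len h').ne

theorem val_src (h' : m.C'.D) : m.α.val (m.C'.src h') =
    m.pot (C.src (m.q.onD h')) + m.slope (m.q.onD h') • m.q.pos h' := by
  rcases m.quasiStable.cases (m.q.onD h') with ⟨-, -, h1⟩ | ⟨k, hk, h1, h2, h3, -, -, -, h4⟩
  · have := h1 h' rfl
    have h2 : m.q.pos h' = 0 := by rw [this, m.q.pos_first]
    rw [h2, m.q.src_of_pos_eq_zero h2, smul_zero, add_zero]
    rfl
  · rcases h4 h' rfl with h5 | rfl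
    · have h2 : m.q.pos h' = 0 := by rw [h5, m.q.pos_first]
      rw [h2, m.q.src_of_pos_eq_zero h2, smul_zero, add_zero]
      rfl
    · rw [← h1, m.val_tgt_first, h3, len_first]
      rfl

/-- The bounds on the slopes say that the break point lies on the edge. The inequality for `S` is
semistability on a suitable set of vertices of the quasi-stable model. -/
theorem isSolution : IsSolution A θ C hC m.pot m.slope := by
  classical
  refine ⟨?_, fun h => ?_, fun h => ?_, fun S => ?_⟩
  · rw [pot, ← m.q.leg_eq]
    exact m.α_leg
  · have := m.breakPos_le h
    rw [breakPos, add_smul, one_smul] at this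
    rw [← sub_nonneg] at this ⊢
    convert this using 1
    abel
  · exact sub_nonneg.1 (m.breakPos_pos h).le
  -- `S` together with all exceptional vertices adjacent to it. The edges entering `S'` are then
  -- exactly the first pieces of the edges entering `S`, and these have slope `m.slope`; the added
  -- vertices do not affect the degrees of `A` and `θ`.
  set S' : Finset m.C'.V := Finset.univ.filter fun v' => v' ∈ S.image m.q.onV ∨
    (v' ∉ Set.range m.q.onV ∧ ∃ e, m.C'.tgt e = v' ∧ m.C'.src e ∈ S.image m.q.onV) with hS'
  have hon : ∀ v, m.q.onV v ∈ S' ↔ v ∈ S := by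
    intro v
    simp only [hS', Finset.mem_filter, Finset.mem_univ, true_and, Finset.mem_image,
      m.q.onV_injective.eq_iff, exists_eq_right, Set.mem_range, exists_eq, not_true, false_and,
      or_false]
  have hex : ∀ v', v' ∉ Set.range m.q.onV →
      (v' ∈ S' ↔ ∃ e, m.C'.tgt e = v' ∧ ∃ v ∈ S, m.q.onV v = m.C'.src e) := by
    intro v' hv
    have : ¬ ∃ v ∈ S, m.q.onV v = v' := by
      rintro ⟨v, -, rfl⟩
      exact hv ⟨v, rfl⟩
    simp only [hS', Finset.mem_filter, Finset.mem_univ, true_and, this, false_or, hv,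
      not_false_iff, Finset.mem_image]
  have h1 := (m.semistable S').2
  rw [Finset.sum_sub_distrib, m.q.sum_lift, m.q.sum_lift, m.α.sum_div] at h1
  simp only [hon, Finset.filter_mem_eq_inter, Finset.univ_inter] at h1
  rw [← DualGraph.card_inEdges] at h1
  have hin : m.C'.inEdges S' = (C.inEdges S).image m.q.first := by
    ext h'
    simp only [DualGraph.mem_inEdges, Finset.mem_image]
    constructor
    · rintro ⟨h2, h3⟩
      have h0 : m.q.pos h' = 0 := by
        by_contra h0
        have hx : m.C'.src h' ∉ Set.range m.q.onV := fun h => h0 (m.q.pos_eq_zero_iff.2 h)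
        refine h2 ((hex _ hx).2 ⟨m.C'.inv h', DualGraph.tgt_inv _ _, ?_⟩)
        rw [DualGraph.src_inv]
        rcases m.quasiStable.cases (m.q.onD h') with ⟨-, -, h4⟩ | ⟨k, hk, -, -, -, h5, -, -, h4⟩
        · exact absurd (by rw [h4 h' rfl, m.q.pos_first]) h0
        · rcases h4 h' rfl with h6 | rfl
          · exact absurd (by rw [h6, m.q.pos_first]) h0
          · rw [h5, hon] at h3
            exact ⟨_, h3, h5.symm⟩
      have hf := m.q.eq_first h0
      have hs := m.q.src_of_pos_eq_zero h0
      rw [hs, hon] at h2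
      refine ⟨m.q.onD h', ⟨h2, ?_⟩, hf.symm⟩
      rcases m.quasiStable.cases (m.q.onD h') with ⟨h4, -, -⟩ | ⟨k, hk, h4, h5, -, h6, -, -, -⟩
      · rw [hf, h4, hon] at h3
        exact h3
      · rw [hf, h4, hex _ h5] at h3
        obtain ⟨e, he, v, hv, hve⟩ := h3
        by_cases hek : e = m.q.first (m.q.onD h')
        · rw [hek, m.q.src_first, m.q.onV_injective.eq_iff] at hve
          exact absurd (hve ▸ hv) h2
        · have : m.C'.inv e = k := by
            refine m.q.eq_of_exceptional h5 (a := m.C'.inv (m.q.first (m.q.onD h'))) ?_ ?_ rfl ?_ ?_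
            · rw [DualGraph.src_inv, h4]
            · rw [DualGraph.src_inv, he]
            · intro h
              exact hek (by rw [← m.C'.inv_inv e, ← h, m.C'.inv_inv])
            · intro h
              have := congrArg m.q.onD h
              rw [m.q.onD_inv, m.q.onD_first, hk] at this
              exact C.inv_ne _ this
          rw [← this, DualGraph.tgt_inv, ← hve, m.q.onV_injective.eq_iff] at h6
          exact h6 ▸ hv
    · rintro ⟨h, ⟨h2, h3⟩, rfl⟩
      rw [m.q.src_first, hon]
      refine ⟨h2, ?_⟩
      rcases m.quasiStable.cases h with ⟨h4, -, -⟩ | ⟨k, hk, h4, h5, -, h6, -, -, -⟩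
      · rw [h4, hon]
        exact h3
      · rw [h4, hex _ h5]
        exact ⟨m.C'.inv k, DualGraph.tgt_inv _ _, _, h3, by rw [DualGraph.src_inv, h6]⟩
  have hinj : Set.InjOn m.q.first (C.inEdges S) := fun a _ b _ hab => by
    rw [← m.q.onD_first a, hab, m.q.onD_first]
  rw [hin, Finset.sum_image hinj, Finset.card_image_of_injOn hinj] at h1
  simp only [charge, Finset.sum_sub_distrib, Finset.sum_add_distrib, Finset.sum_const, nsmul_eq_mul]
  push_cast at h1 ⊢
  simp only [slope]
  linarith

theorem total_potentialValue (i j) :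
    potentialValue C m.pot m.slope i ≤ potentialValue C m.pot m.slope j ∨
      potentialValue C m.pot m.slope j ≤ potentialValue C m.pot m.slope i := by
  have hex : ∀ i, ∃ v, m.α.val v = potentialValue C m.pot m.slope i := by
    rintro (v | h)
    · exact ⟨_, rfl⟩
    · exact ⟨_, m.val_tgt_first h⟩
  obtain ⟨v, hv⟩ := hex i
  obtain ⟨w, hw⟩ := hex j
  rw [← hv, ← hw]
  exact m.total v w

end Model
end TropRub

namespace TropRub

/-! ### Models from potentials -/

variable {g n : ℕ} [NeZero n] {A : UniversalFunction g n ℤ} {θ : UniversalFunction g n ℝ}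
  {M : ToricMonoid} {C : TropicalCurve M n} {hC : C.IsStable g} {a : C.V → M.gp} {s : C.D → ℤ}

namespace IsSolution

/-- Where the upper bound is attained the slope is integral and `s h` can be raised by one. This
only weakens `sum_le`, and the break point moves from the initial to the final vertex of the edge,
so no new value of the potential arises. -/
theorem exists_strict (hs : IsSolution A θ C hC a s) :
    ∃ s', IsSolution A θ C hC a s' ∧ (∀ h, 0 < breakPos C a s' h) ∧
      ∀ i, ∃ j, potentialValue C a s' i = potentialValue C a s j := by
  have hex : ∀ h, ∃ t, s h ≤ t ∧ t • C.len h ≤ a (C.tgt h) - a (C.src h) ∧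
      a (C.tgt h) - a (C.src h) < (t + 1) • C.len h ∧
      (t = s h ∨ t • C.len h = a (C.tgt h) - a (C.src h)) := by
    intro h
    by_cases h0 : a (C.tgt h) - a (C.src h) = (s h + 1) • C.len h
    · refine ⟨s h + 1, by omega, h0.ge, ?_, Or.inr h0.symm⟩
      rw [h0, add_smul (s h + 1) 1, one_smul]
      exact lt_add_of_pos_right _ (C.len_pos h)
    · exact ⟨s h, le_rfl, hs.smul_le h, lt_of_le_of_ne (hs.le_smul h) h0, Or.inl rfl⟩
  choose t h1 h2 h3 h4 using hex
  refine ⟨t, ⟨hs.leg, h2, fun h => (h3 h).le, fun S => (hs.sum_le S).trans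
    (Finset.sum_le_sum fun h _ => ?_)⟩, fun h => sub_pos.2 (h3 h), ?_⟩
  · have : (s h : ℝ) ≤ t h := Int.cast_le.2 (h1 h)
    linarith
  · rintro (v | h)
    · exact ⟨Sum.inl v, rfl⟩
    · rcases h4 h with h5 | h5
      · refine ⟨Sum.inr h, ?_⟩
        simp only [potentialValue, Sum.elim_inr, breakPos, h5]
      · refine ⟨Sum.inl (C.tgt h), ?_⟩
        simp only [potentialValue, Sum.elim_inl, Sum.elim_inr, breakPos]
        rw [add_smul (t h) 1, one_smul, h5, add_sub_cancel_left, h5]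
        abel

variable (hs : IsSolution A θ C hC a s)
include hs

theorem breakPos_le (h : C.D) : breakPos C a s h ≤ C.len h := by
  have := hs.smul_le h
  rw [breakPos, add_smul, one_smul]
  rw [← sub_nonneg] at this ⊢
  convert this using 1
  abel

variable (hpos : ∀ h, 0 < breakPos C a s h)
include hpos

/-- With strict upper bounds `s h` plays the role of the floor of the slope; the floors of `x` and
`-x` add up to `0` or `-1` according to whether `x` is an integer, that is, whether the edge remains
undivided. -/
theorem inv_cases (h : C.D) :
    (breakPos C a s h = C.len h ∧ s (C.inv h) = -s h ∧ breakPos C a s (C.inv h) = C.len h) ∨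
    (breakPos C a s h ≠ C.len h ∧ s (C.inv h) = -s h - 1 ∧
      breakPos C a s (C.inv h) = C.len h - breakPos C a s h) := by
  have h1 := hs.smul_le h
  have h2 := sub_pos.1 (hpos h)
  have h3 := hs.smul_le (C.inv h)
  have h4 := sub_pos.1 (hpos (C.inv h))
  unfold breakPos
  rw [DualGraph.tgt_inv, DualGraph.src_inv, C.len_inv] at h3 h4 ⊢
  set δ := a (C.tgt h) - a (C.src h) with hδ
  have hδ' : a (C.src h) - a (C.tgt h) = -δ := by rw [hδ]; abel
  rw [hδ'] at h3 h4 ⊢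
  have hl := C.len_pos h
  have h5 : s (C.inv h) < -s h + 1 := by
    refine ToricMonoid.lt_of_zsmul_lt_zsmul hl.le (h3.trans_lt ?_)
    rw [add_smul, neg_smul, one_smul]
    exact (neg_le_neg h1).trans_lt (lt_add_of_pos_right _ hl)
  have h6 : -(s h + 1) < s (C.inv h) + 1 := by
    refine ToricMonoid.lt_of_zsmul_lt_zsmul hl.le (lt_trans ?_ h4)
    rw [neg_smul]
    exact neg_lt_neg h2
  rcases (by omega : s (C.inv h) = -s h ∨ s (C.inv h) = -s h - 1) with h7 | h7
  · left
    rw [h7, neg_smul] at h3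
    have h8 : δ = s h • C.len h := le_antisymm (neg_le_neg_iff.1 h3) h1
    rw [h7, h8, add_smul, add_smul, neg_smul, one_smul]
    exact ⟨by abel, rfl, by abel⟩
  · right
    refine ⟨fun h8 => ?_, h7, ?_⟩
    · rw [h7, show -s h - 1 + 1 = -s h by ring, neg_smul] at h4
      refine absurd (neg_lt_neg_iff.1 h4) (not_lt_of_ge (le_of_eq ?_))
      rw [add_smul, one_smul, sub_eq_iff_eq_add, add_comm] at h8
      exact (add_left_cancel h8).symm
    · rw [h7, show -s h - 1 + 1 = -s h by ring, neg_smul, add_smul, one_smul]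
      abel

open Classical in
/-- The positions of the exceptional vertices determined by a potential. -/
noncomputable def data : SubdivisionData C where
  num h := if breakPos C a s h = C.len h then 0 else 1
  p h i := if i = 0 then 0 else if i = 1 then breakPos C a s h else C.len h
  num_inv h := by
    rcases hs.inv_cases hpos h with ⟨h1, -, h2⟩ | ⟨h1, -, h2⟩
    · rw [C.len_inv, if_pos h1, if_pos h2]
    · rw [C.len_inv, if_neg h1, if_neg]
      rw [h2]
      intro h3
      exact (hpos h).ne' (sub_eq_self.1 h3)
  p_zero h := rfl
  p_last h := by
    split_ifs with h1 <;> simp_all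
  p_lt h i hi := by
    split_ifs at hi with h1
    · obtain rfl : i = 0 := by omega
      exact hpos h
    · rcases (by omega : i = 0 ∨ i = 1) with rfl | rfl
      · exact hpos h
      · exact lt_of_le_of_ne (hs.breakPos_le h) h1
  p_inv h i hi := by
    rcases hs.inv_cases hpos h with ⟨h1, -, h2⟩ | ⟨h1, -, h2⟩
    · rw [if_pos h1] at hi ⊢
      rcases (by omega : i = 0 ∨ i = 1) with rfl | rfl
      · simp [h1]
      · simp [h2]
    · rw [if_neg h1] at hi ⊢
      rcases (by omega : i = 0 ∨ i = 1 ∨ i = 2) with rfl | rfl | rfl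
      · simp
      · simp [h2]
      · simp [C.len_inv]

theorem num_data_le (h : C.D) : (hs.data hpos).num h ≤ 1 := by
  classical
  change (if _ then 0 else 1) ≤ 1
  split_ifs <;> omega

theorem num_data_eq_zero {h : C.D} (h1 : breakPos C a s h = C.len h) : (hs.data hpos).num h = 0 :=
  if_pos h1

theorem num_data_eq_one {h : C.D} (h1 : breakPos C a s h ≠ C.len h) : (hs.data hpos).num h = 1 :=
  if_neg h1

theorem ne_of_lt_num {h : C.D} {i : ℕ} (hi : i < (hs.data hpos).num h) :
    breakPos C a s h ≠ C.len h ∧ i = 0 := by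
  have := hs.num_data_le hpos h
  refine ⟨fun h1 => ?_, by omega⟩
  rw [hs.num_data_eq_zero hpos h1] at hi
  omega

/-- The piecewise linear function on the model determined by a potential. -/
noncomputable def plFunction : PLFunction (hs.data hpos).curve where
  val := Sum.elim a (Quotient.lift (fun x => a (C.src x.1) + s x.1 • breakPos C a s x.1) (by
    rintro ⟨h, i⟩ ⟨k, j⟩ (h1 | ⟨h1, h2⟩)
    · rw [h1]
    · obtain rfl : k = C.inv h := h1
      rcases hs.inv_cases hpos h with ⟨h1, -, -⟩ | ⟨h1, h3, h4⟩
      · exact absurd h1 (hs.ne_of_lt_num hpos i.2).1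
      · simp only [h3, h4, DualGraph.src_inv]
        have h6 : a (C.tgt h) = a (C.src h) + s h • C.len h + (C.len h - breakPos C a s h) := by
          rw [breakPos, add_smul, one_smul]
          abel
        rw [h6]
        simp only [smul_sub, sub_smul, neg_smul, one_smul]
        abel))
  -- The index of the piece is `0` or `1`; the increase by one is what admissibility demands.
  slope x := s x.1 + ((x.2 : ℕ) : ℤ)
  val_tgt_sub := by
    rintro ⟨h, i, hi⟩
    change Sum.elim _ _ ((hs.data hpos).curve.tgt ((hs.data hpos).mkEdge h i hi)) -
      Sum.elim _ _ ((hs.data hpos).curve.src ((hs.data hpos).mkEdge h i hi)) =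
      (s h + (i : ℤ)) • ((hs.data hpos).p h (i + 1) - (hs.data hpos).p h i)
    by_cases h1 : breakPos C a s h = C.len h
    · have hn := hs.num_data_eq_zero hpos h1
      obtain rfl : i = 0 := by omega
      have h2 := (hs.data hpos).tgt_mkEdge_last h
      simp only [hn] at h2
      rw [h2, (hs.data hpos).src_mkEdge_zero]
      change a (C.tgt h) - a (C.src h) = (s h + ((0 : ℕ) : ℤ)) • (breakPos C a s h - 0)
      have h3 := h1
      rw [breakPos, add_smul, one_smul, sub_eq_iff_eq_add, add_comm] at h3
      rw [← add_left_cancel h3, h1]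
      simp
    · have hn := hs.num_data_eq_one hpos h1
      rcases (by omega : i = 0 ∨ i = 1) with rfl | rfl
      · rw [(hs.data hpos).tgt_mkEdge_of_lt h 0 (by omega), (hs.data hpos).src_mkEdge_zero]
        simp only [Sum.elim_inl, Sum.elim_inr]
        change a (C.src h) + s h • breakPos C a s h - _ = (s h + ((0 : ℕ) : ℤ)) • (breakPos C a s h - 0)
        simp
      · have h2 := (hs.data hpos).tgt_mkEdge_last h
        simp only [hn] at h2
        rw [h2, (hs.data hpos).src_mkEdge_succ h 0 (by omega)]
        simp only [Sum.elim_inl, Sum.elim_inr]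
        change _ - (a (C.src h) + s h • breakPos C a s h) =
          (s h + ((1 : ℕ) : ℤ)) • (C.len h - breakPos C a s h)
        rw [Nat.cast_one, smul_sub, add_smul _ _ (breakPos C a s h), one_smul]
        conv_rhs => rw [add_comm (_ • breakPos C a s h)]
        nth_rw 2 [breakPos]
        abel

/-- The potential satisfies inequalities for subsets of `C` only. They suffice because, for a fixed
trace `S` on the vertices of `C`, no choice of exceptional vertices makes the bound on the model
smaller than the bound on `C`. -/
theorem sum_inEdges_le (S' : Finset (hs.data hpos).curve.V) (S : Finset C.V)
    (hS : ∀ v, (hs.data hpos).subdivision.onV v ∈ S' ↔ v ∈ S) :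
    ∑ h ∈ C.inEdges S, ((s h : ℝ) + 1 / 2) ≤
      ∑ h ∈ (hs.data hpos).curve.inEdges S', (((hs.plFunction hpos).slope h : ℝ) + 1 / 2) := by
  classical
  have e1 : ∀ (Γ : DualGraph n) (T : Finset Γ.V) (F : Γ.D → ℝ), ∑ h ∈ Γ.inEdges T, F h =
      ∑ h, if Γ.src h ∉ T ∧ Γ.tgt h ∈ T then F h else 0 := by
    intro Γ T F
    rw [DualGraph.inEdges, Finset.sum_filter]
  set f : C.D → ℝ := fun h => if C.src h ∉ S ∧ C.tgt h ∈ S then (s h : ℝ) + 1 / 2 else 0 with hf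
  set G : C.D → ℝ := fun h => ∑ i : Fin ((hs.data hpos).num h + 1),
    if (hs.data hpos).curve.src ((hs.data hpos).mkEdge h i i.2) ∉ S' ∧
      (hs.data hpos).curve.tgt ((hs.data hpos).mkEdge h i i.2) ∈ S' then
      ((s h : ℝ) + ((i : ℕ) : ℝ)) + 1 / 2 else 0 with hG
  have e2 : (∑ h, if (hs.data hpos).curve.src h ∉ S' ∧ (hs.data hpos).curve.tgt h ∈ S' then
      (((hs.plFunction hpos).slope h : ℝ) + 1 / 2) else 0) = ∑ h, G h := by
    refine (Fintype.sum_sigma (α := fun h => Fin ((hs.data hpos).num h + 1)) _).trans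
      (Finset.sum_congr rfl fun h _ => Finset.sum_congr rfl fun i _ => ?_)
    change (if (hs.data hpos).curve.src ((hs.data hpos).mkEdge h i i.2) ∉ S' ∧
      (hs.data hpos).curve.tgt ((hs.data hpos).mkEdge h i i.2) ∈ S' then
      ((s h + ((i : ℕ) : ℤ) : ℤ) : ℝ) + 1 / 2 else 0) = _
    push_cast
    rfl
  rw [e1, e1, e2]
  have e3 : ∀ F : C.D → ℝ, ∑ h, F (C.inv h) = ∑ h, F h := fun F =>
    Equiv.sum_comp C.invEquiv F
  -- Only the sums over both orientations compare. For instance, if just the exceptional vertex of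
  -- an edge lies in `S'`, the two entering pieces have slopes `s h` and `-s h - 1`; the
  -- contribution of one may be negative, but together they give zero.
  suffices ∑ h, (f h + f (C.inv h)) ≤ ∑ h, (G h + G (C.inv h)) by
    rw [Finset.sum_add_distrib, Finset.sum_add_distrib, e3, e3] at this
    linarith
  refine Finset.sum_le_sum fun h _ => ?_
  have hS' : ∀ v, (Sum.inl v : C.V ⊕ Quotient (hs.data hpos).setoid) ∈ S' ↔ v ∈ S := hS
  have G0 : ∀ h, (hs.data hpos).num h = 0 → G h = f h := by
    intro h hn
    have h2 := (hs.data hpos).tgt_mkEdge_last h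
    have h3 := (hs.data hpos).src_mkEdge_zero h
    simp only [hn] at h2
    refine (Fintype.sum_eq_single ⟨0, Nat.succ_pos _⟩ fun i hi => ?_).trans ?_
    · exact absurd (Fin.ext (by have := i.2; change (i : ℕ) = 0; omega)) hi
    · simp only [h2, h3, Nat.cast_zero, add_zero, hf]
      exact if_congr (and_congr (not_congr (hS' _)) (hS' _)) rfl rfl
  have G1 : ∀ h (hn : 0 < (hs.data hpos).num h), G h =
      (if C.src h ∉ S ∧ (Sum.inr ((hs.data hpos).inner h 0 hn) :
        C.V ⊕ Quotient (hs.data hpos).setoid) ∈ S' then (s h : ℝ) + 1 / 2 else 0) +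
      (if (Sum.inr ((hs.data hpos).inner h 0 hn) :
        C.V ⊕ Quotient (hs.data hpos).setoid) ∉ S' ∧ C.tgt h ∈ S then (s h : ℝ) + 1 + 1 / 2
        else 0) := by
    intro h hn
    have hn1 := hs.num_data_le hpos h
    have hn2 : (hs.data hpos).num h = 1 := by omega
    have h2 := (hs.data hpos).tgt_mkEdge_last h
    have h3 := (hs.data hpos).src_mkEdge_zero h
    have h4 := (hs.data hpos).tgt_mkEdge_of_lt h 0 hn
    have h5 := (hs.data hpos).src_mkEdge_succ h 0 hn
    simp only [hn2] at h2
    refine (Fintype.sum_eq_add ⟨0, Nat.succ_pos _⟩ ⟨1, Nat.succ_lt_succ hn⟩ ?_ fun i hi => ?_).trans ?_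
    · intro h
      exact absurd (congrArg Fin.val h) zero_ne_one
    · have := i.2
      rcases (by omega : (i : ℕ) = 0 ∨ (i : ℕ) = 1) with h | h
      · exact absurd (Fin.ext h) hi.1
      · exact absurd (Fin.ext h) hi.2
    · simp only [zero_add] at h5
      simp only [h2, h3, h4, h5, Nat.cast_zero, add_zero, Nat.cast_one]
      exact congrArg₂ (· + ·) (if_congr (and_congr (not_congr (hS' _)) Iff.rfl) rfl rfl)
        (if_congr (and_congr Iff.rfl (hS' _)) rfl rfl)
  rcases hs.inv_cases hpos h with ⟨h1, -, h2⟩ | ⟨h1, h2, h3⟩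
  · rw [G0 h (hs.num_data_eq_zero hpos h1), G0 _ (hs.num_data_eq_zero hpos (h2.trans (C.len_inv h).symm))]
  · have hn : 0 < (hs.data hpos).num h := by rw [hs.num_data_eq_one hpos h1]; exact one_pos
    have hn' : 0 < (hs.data hpos).num (C.inv h) := by rw [(hs.data hpos).num_inv]; exact hn
    have hin : (hs.data hpos).inner (C.inv h) 0 hn' = (hs.data hpos).inner h 0 hn :=
      (hs.data hpos).inner_eq_iff.2 (Or.inr ⟨(C.inv_inv h).symm, by
        rw [(hs.data hpos).num_inv, hs.num_data_eq_one hpos h1]⟩)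
    rw [G1 h hn, G1 _ hn', hin]
    simp only [hf, h2, DualGraph.src_inv, DualGraph.tgt_inv]
    push_cast
    by_cases a1 : C.src h ∈ S <;> by_cases a2 : C.tgt h ∈ S <;>
      by_cases a3 : (Sum.inr ((hs.data hpos).inner h 0 hn) :
        C.V ⊕ Quotient (hs.data hpos).setoid) ∈ S' <;> simp [a1, a2, a3] <;> linarith

theorem semistable_plFunction (hdeg : ∑ v, θ.toFun C.toDualGraph hC v =
      ((∑ v, A.toFun C.toDualGraph hC v : ℤ) : ℝ)) :
    IsSemistable (hs.data hpos).curve.toDualGraph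
      ((hs.data hpos).subdivision.lift (θ.toFun C.toDualGraph hC))
      fun v' => (hs.data hpos).subdivision.lift (A.toFun C.toDualGraph hC) v' -
        (hs.plFunction hpos).div v' := by
  classical
  have upper : ∀ S' : Finset (hs.data hpos).curve.V,
      ((∑ v' ∈ S', ((hs.data hpos).subdivision.lift (A.toFun C.toDualGraph hC) v' -
        (hs.plFunction hpos).div v') : ℤ) : ℝ) ≤
      ∑ v' ∈ S', (hs.data hpos).subdivision.lift (θ.toFun C.toDualGraph hC) v' +
        ((hs.data hpos).curve.cut S' : ℝ) / 2 := by
    intro S'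
    have h1 := hs.sum_inEdges_le hpos S'
      (Finset.univ.filter fun v => (hs.data hpos).subdivision.onV v ∈ S') (by simp)
    have h2 := (hs.sum_le _).trans h1
    rw [Finset.sum_sub_distrib, CurveSubdivision.sum_lift, CurveSubdivision.sum_lift,
      PLFunction.sum_div, ← DualGraph.card_inEdges]
    simp only [charge, Finset.sum_sub_distrib, Finset.sum_add_distrib, Finset.sum_const,
      nsmul_eq_mul] at h2
    push_cast
    linarith
  refine fun S' => ⟨?_, upper S'⟩
  -- The lower bound for a set is the upper bound for its complement, as `D` and `θ` have the same
  -- degree and `div` has degree zero.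
  have h1 := upper S'ᶜ
  have h2 := Finset.sum_add_sum_compl S'
    ((hs.data hpos).subdivision.lift (θ.toFun C.toDualGraph hC))
  have h3 := Finset.sum_add_sum_compl S' fun v' =>
    (hs.data hpos).subdivision.lift (A.toFun C.toDualGraph hC) v' - (hs.plFunction hpos).div v'
  rw [Finset.sum_sub_distrib (s := Finset.univ), PLFunction.sum_div_univ,
    CurveSubdivision.sum_lift, sub_zero] at h3
  rw [CurveSubdivision.sum_lift _ _ Finset.univ] at h2
  simp only [Finset.mem_univ, Finset.filter_true] at h2 h3
  rw [hdeg, ← h3] at h2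
  rw [DualGraph.cut_compl] at h1
  push_cast at h1 h2 ⊢
  linarith

omit hpos in
/-- A potential whose values are totally ordered comes from a model. -/
theorem exists_model (hdeg : ∑ v, θ.toFun C.toDualGraph hC v =
      ((∑ v, A.toFun C.toDualGraph hC v : ℤ) : ℝ))
    (htot : ∀ i j, potentialValue C a s i ≤ potentialValue C a s j ∨
      potentialValue C a s j ≤ potentialValue C a s i) :
    ∃ m : Model A θ C hC, m.pot = a := by
  obtain ⟨s', hs', hpos, hval⟩ := hs.exists_strict
  refine ⟨⟨(hs'.data hpos).curve, (hs'.data hpos).subdivision, ?_, hs'.plFunction hpos, hs.leg, ?_,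
    hs'.semistable_plFunction hpos hdeg, ?_⟩, rfl⟩
  · refine CurveSubdivision.isQuasiStable_of_points _ fun h => ⟨breakPos C a s' h, fun p hp => ?_⟩
    obtain ⟨i, -, rfl⟩ := (hs'.data hpos).mem_points_subdivision.1 hp
    change (if _ then _ else if _ then _ else _) = _ ∨ (if _ then _ else if _ then _ else _) = _ ∨
      (if _ then _ else if _ then _ else _) = _
    split_ifs <;> simp
  · rintro (v | x) hv
    · exact absurd ⟨v, rfl⟩ hv
    · induction x using Quotient.inductionOn with
      | h x =>
        obtain ⟨h, i, hi⟩ := x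
        obtain ⟨h1, rfl⟩ := hs'.ne_of_lt_num hpos hi
        have e := (hs'.data hpos).src_mkEdge_succ h 0 hi
        have e' := (hs'.data hpos).tgt_mkEdge_of_lt h 0 hi
        have key : ∀ w, w = (hs'.data hpos).curve.src
            ((hs'.data hpos).mkEdge h 1 (Nat.succ_lt_succ hi)) →
            w ∉ Set.range (hs'.data hpos).subdivision.onV →
            (hs'.data hpos).subdivision.lift (A.toFun C.toDualGraph hC) w -
              (hs'.plFunction hpos).div w = 1 := by
          rintro w rfl hw
          rw [CurveSubdivision.lift_exceptional _ _ hw,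
            PLFunction.div_exceptional (hs'.data hpos).subdivision (hs'.plFunction hpos)
              (k := (hs'.data hpos).mkEdge h 0 (Nat.succ_pos _))
              (h := (hs'.data hpos).mkEdge h 1 (Nat.succ_lt_succ hi)) rfl (e'.trans e.symm) hw]
          change (0 : ℤ) - (s' h + ((0 : ℕ) : ℤ) - (s' h + ((1 : ℕ) : ℤ))) = 1
          push_cast
          ring
        exact key _ e.symm hv
  · have hex : ∀ v, ∃ j, (hs'.plFunction hpos).val v = potentialValue C a s j := by
      rintro (v | x)
      · exact ⟨Sum.inl v, rfl⟩
      · induction x using Quotient.inductionOn with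
        | h x => exact hval (Sum.inr x.1)
    intro v w
    obtain ⟨i, hi⟩ := hex v
    obtain ⟨j, hj⟩ := hex w
    rw [hi, hj]
    exact htot i j

end IsSolution
end TropRub

namespace TropRub

/-! ### Uniqueness and functoriality of potentials -/

namespace DualGraph.Contraction

variable {n : ℕ} {Γ Γ' : DualGraph n} (f : Contraction Γ Γ')

theorem mem_range_of_onV_ne {h : Γ.D} (hh : f.onV (Γ.src h) ≠ f.onV (Γ.tgt h)) :
    h ∈ Set.range f.onD := by
  by_contra hc
  exact hh (f.onV_contracted hc)

open Classical in
theorem sum_inEdges_preimage {R : Type*} [AddCommMonoid R] (S : Finset Γ.V) (S' : Finset Γ'.V)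
    (hS : ∀ v, v ∈ S ↔ f.onV v ∈ S') (F : Γ.D → R) :
    ∑ h ∈ Γ.inEdges S, F h = ∑ k ∈ Γ'.inEdges S', F (f.onD k) := by
  have : Γ.inEdges S = (Γ'.inEdges S').image f.onD := by
    ext h
    simp only [mem_inEdges, Finset.mem_image, hS]
    constructor
    · intro hh
      obtain ⟨k, rfl⟩ := f.mem_range_of_onV_ne (h := h) fun e => hh.1 (e ▸ hh.2)
      rw [f.onV_src, f.onV_tgt] at hh
      exact ⟨k, hh, rfl⟩
    · rintro ⟨k, hk, rfl⟩
      rwa [f.onV_src, f.onV_tgt]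
  rw [this, Finset.sum_image f.onD_injective.injOn]

open Classical in
theorem sum_preimage {R : Type*} [AddCommMonoid R] (S : Finset Γ.V) (S' : Finset Γ'.V)
    (hS : ∀ v, v ∈ S ↔ f.onV v ∈ S') (F : Γ.V → R) :
    ∑ v ∈ S, F v = ∑ v' ∈ S', ∑ v with f.onV v = v', F v := by
  rw [← Finset.sum_fiberwise_of_maps_to (s := S) (t := S') (g := f.onV) fun v hv => (hS v).1 hv]
  refine Finset.sum_congr rfl fun v' hv => Finset.sum_congr ?_ fun _ _ => rfl
  ext v
  simp only [Finset.mem_filter, Finset.mem_univ, true_and, hS]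
  exact ⟨fun e => e.2, fun e => ⟨e ▸ hv, e⟩⟩

end DualGraph.Contraction

variable {g n : ℕ} {A : UniversalFunction g n ℤ} {θ : UniversalFunction g n ℝ}

theorem sum_charge_preimage {Γ Γ' : DualGraph n} (hΓ : Γ.IsStable g) (hΓ' : Γ'.IsStable g)
    (f : Γ.Contraction Γ') (S : Finset Γ.V) (S' : Finset Γ'.V) (hS : ∀ v, v ∈ S ↔ f.onV v ∈ S') :
    ∑ v ∈ S, charge A θ Γ hΓ v = ∑ v ∈ S', charge A θ Γ' hΓ' v := by
  rw [f.sum_preimage S S' hS]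
  refine Finset.sum_congr rfl fun v _ => ?_
  simp only [charge]
  rw [A.specialize Γ Γ' hΓ hΓ' f, θ.specialize Γ Γ' hΓ hΓ' f, Finset.sum_sub_distrib]
  push_cast
  rfl

theorem sum_charge_eq_zero {Γ : DualGraph n} (hΓ : Γ.IsStable g)
    (hdeg : ∑ v, θ.toFun Γ hΓ v = ((∑ v, A.toFun Γ hΓ v : ℤ) : ℝ)) :
    ∑ v, charge A θ Γ hΓ v = 0 := by
  simp only [charge]
  rw [Finset.sum_sub_distrib, hdeg]
  push_cast
  exact sub_self _

theorem UniversalFunction.IsNondegenerate.sum_charge_ne (hθ : θ.IsNondegenerate) {Γ : DualGraph n}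
    (hΓ : Γ.IsStable g) (S : Finset Γ.V) (h1 : S.Nonempty) (h2 : S ≠ Finset.univ) (m : ℤ) :
    ∑ v ∈ S, charge A θ Γ hΓ v - (Γ.cut S : ℝ) / 2 ≠ m := by
  intro h
  refine (hθ Γ hΓ S h1 h2 (∑ v ∈ S, A.toFun Γ hΓ v - m)).1 ?_
  simp only [charge, Finset.sum_sub_distrib] at h
  push_cast
  linarith

variable [NeZero n]

/-- A set `S` that no edge of length zero enters is a union of fibres of `f`, so both sides of the
inequality descend to `C₂`; there `s k` is at most the floor of the slope at `x`. Edges contracted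
by `f` are allowed, so that potentials of `C₁` and of `C₂` become comparable on the same metric
graph. -/
theorem IsSolution.isRealSolution {M₁ M₂ : ToricMonoid} {φ : M₁ ⟶ M₂} {C₁ : TropicalCurve M₁ n}
    {C₂ : TropicalCurve M₂ n} {h₁ : C₁.IsStable g} {h₂ : C₂.IsStable g} (f : TropicalHom φ C₁ C₂)
    {a : C₂.V → M₂.gp} {s : C₂.D → ℤ} (hs : IsSolution A θ C₂ h₂ a s) {x : M₂.gp →+ ℝ}
    (hx : x ∈ M₂.cone) :
    C₁.IsRealSolution (charge A θ C₁.toDualGraph h₁) (fun h => x (φ.toFun (C₁.len h)))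
      fun v => x (a (f.onV v)) := by
  classical
  have low : ∀ k, s k * x (C₂.len k) ≤ x (a (C₂.tgt k)) - x (a (C₂.src k)) := by
    intro k
    have := M₂.cone_apply_mono hx (hs.smul_le k)
    rwa [map_zsmul, map_sub, zsmul_eq_mul] at this
  have high : ∀ k, x (a (C₂.tgt k)) - x (a (C₂.src k)) ≤ (s k + 1) * x (C₂.len k) := by
    intro k
    have := M₂.cone_apply_mono hx (hs.le_smul k)
    rw [map_zsmul, map_sub, zsmul_eq_mul] at this
    exact_mod_cast this
  constructor
  · intro h h0
    by_cases hh : h ∈ Set.range f.onD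
    · obtain ⟨k, rfl⟩ := hh
      simp only [f.len_onD] at h0
      rw [f.onV_src, f.onV_tgt]
      have h3 := low k
      have h4 := high k
      rw [h0] at h3 h4
      linarith
    · rw [f.onV_contracted hh]
  · intro S hS
    have hne : ∀ h, h ∉ Set.range f.onD → (C₁.src h ∈ S ↔ C₁.tgt h ∈ S) := by
      intro h hh
      have e : x (φ.toFun (C₁.len h)) = 0 := by rw [f.len_contracted h hh, map_zero]
      constructor
      · intro hsrc
        by_contra ht
        exact hS (C₁.inv h) (by simp [hsrc, ht]) (by simp only [C₁.len_inv, e])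
      · intro ht
        by_contra hsrc
        exact hS h (by simp [hsrc, ht]) e
    have hmem : ∀ v, v ∈ S ↔ f.onV v ∈ S.image f.onV := by
      intro v
      refine ⟨Finset.mem_image_of_mem _, fun hv => ?_⟩
      obtain ⟨w, hw, hwv⟩ := Finset.mem_image.1 hv
      have := (f.onV_eq_iff w v).1 hwv
      clear hwv hv
      induction this with
      | refl => exact hw
      | tail _ h ih =>
        obtain ⟨h, hh, rfl, rfl⟩ := h
        exact (hne h hh).1 ih
    rw [sum_charge_preimage h₁ h₂ f.toContraction S _ hmem,
      f.sum_inEdges_preimage S _ hmem]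
    refine (hs.sum_le _).trans (Finset.sum_le_sum fun k hk => ?_)
    have hk' : f.onD k ∈ C₁.inEdges S := by
      simp only [DualGraph.mem_inEdges] at hk ⊢
      rwa [hmem, hmem, f.onV_src, f.onV_tgt]
    have h0 := hS _ hk'
    rw [f.len_onD] at h0
    have hp : 0 < x (C₂.len k) :=
      lt_of_le_of_ne (M₂.cone_apply_nonneg hx (C₂.len_nonneg k)) (Ne.symm h0)
    simp only [f.len_onD, f.onV_src, f.onV_tgt]
    have : s k ≤ ⌊(x (a (C₂.tgt k)) - x (a (C₂.src k))) / x (C₂.len k)⌋ := by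
      rw [Int.le_floor, le_div_iff₀ hp]
      exact low k
    have := (Int.cast_le (R := ℝ)).2 this
    linarith

theorem DualGraph.IsRealSolution.eq_of_leg {Γ : DualGraph n} (hθ : θ.IsNondegenerate)
    {hΓ : Γ.IsStable g} (hdeg : ∑ v, θ.toFun Γ hΓ v = ((∑ v, A.toFun Γ hΓ v : ℤ) : ℝ))
    {len : Γ.D → ℝ} (hlen : ∀ h, 0 ≤ len h) (hinv : ∀ h, len (Γ.inv h) = len h) {a b : Γ.V → ℝ}
    (ha : Γ.IsRealSolution (charge A θ Γ hΓ) len a) (hb : Γ.IsRealSolution (charge A θ Γ hΓ) len b)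
    (h0 : a (Γ.leg 0) = b (Γ.leg 0)) : a = b := by
  funext v
  have := ha.sub_eq_sub hlen hinv (sum_charge_eq_zero hΓ hdeg) (hθ.sum_charge_ne hΓ) hb v (Γ.leg 0)
  linarith

/-- At each point of the cone of `M₂` both sides give normalized semistable potentials on the same
real metric graph, so they agree there, and points of the cone separate elements of `M₂.gp`. -/
theorem IsSolution.map_eq (hθ : θ.IsNondegenerate) {M₁ M₂ : ToricMonoid} {φ : M₁ ⟶ M₂}
    {C₁ : TropicalCurve M₁ n} {C₂ : TropicalCurve M₂ n} {h₁ : C₁.IsStable g} {h₂ : C₂.IsStable g}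
    (hdeg : ∑ v, θ.toFun C₁.toDualGraph h₁ v = ((∑ v, A.toFun C₁.toDualGraph h₁ v : ℤ) : ℝ))
    (f : TropicalHom φ C₁ C₂) {a₁ : C₁.V → M₁.gp} {s₁ : C₁.D → ℤ}
    (hs₁ : IsSolution A θ C₁ h₁ a₁ s₁) {a₂ : C₂.V → M₂.gp} {s₂ : C₂.D → ℤ}
    (hs₂ : IsSolution A θ C₂ h₂ a₂ s₂) (v : C₁.V) : φ.toFun (a₁ v) = a₂ (f.onV v) := by
  refine M₂.eq_of_forall_cone fun x hx => ?_
  have hx' : x.comp φ.toFun ∈ M₁.cone := fun m hm => hx _ (φ.map_mem m hm)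
  have e1 := hs₂.isRealSolution (h₁ := h₁) f hx
  have e2 := hs₁.isRealSolution (h₁ := h₁) (TropicalHom.id C₁) hx'
  have := DualGraph.IsRealSolution.eq_of_leg hθ hdeg
    (fun h => M₂.cone_apply_nonneg hx (ToricMonoid.Hom.map_nonneg φ (C₁.len_nonneg h)))
    (fun h => by simp only [C₁.len_inv]) e2 e1 (by
      change x (φ.toFun (a₁ (C₁.leg 0))) = x (a₂ (f.onV (C₁.leg 0)))
      rw [f.onV_leg, hs₁.leg, hs₂.leg, map_zero])
  exact congrFun this v

end TropRub

namespace TropRub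

/-! ### Functoriality of models and of equidimensional lifts -/

/-- An element comparable with `a` and `b` that is not between them lies on the same side of both;
its image can be between the images only by coinciding with one of them. Thus no essentially new
incidences appear along `φ`. -/
theorem ToricMonoid.isBetween_or_eq_of_map {M N : ToricMonoid} (φ : M ⟶ N) {a b y : M.gp}
    (ha : a ≤ y ∨ y ≤ a) (hb : b ≤ y ∨ y ≤ b)
    (h : IsBetween (φ.toFun a) (φ.toFun b) (φ.toFun y)) :
    IsBetween a b y ∨ φ.toFun y = φ.toFun a ∨ φ.toFun y = φ.toFun b := by
  rcases ha with ha | ha <;> rcases hb with hb | hb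
  · have h1 := Hom.map_mono φ ha
    have h2 := Hom.map_mono φ hb
    rcases h with h | h
    · exact Or.inr (Or.inr (le_antisymm h.2 h2))
    · exact Or.inr (Or.inl (le_antisymm h.2 h1))
  · exact Or.inl (Or.inl ⟨ha, hb⟩)
  · exact Or.inl (Or.inr ⟨hb, ha⟩)
  · have h1 := Hom.map_mono φ ha
    have h2 := Hom.map_mono φ hb
    rcases h with h | h
    · exact Or.inr (Or.inl (le_antisymm h1 h.1))
    · exact Or.inr (Or.inr (le_antisymm h2 h.1))

theorem PLFunction.isBetween_val {n : ℕ} {M : ToricMonoid} {C : TropicalCurve M n}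
    (α : PLFunction C) {h : C.D} {p : M.gp} (hp : 0 ≤ p) (hl : p ≤ C.len h) :
    ToricMonoid.IsBetween (α.val (C.src h)) (α.val (C.tgt h))
      (α.val (C.src h) + α.slope h • p) := by
  rw [α.val_tgt]
  rcases le_total 0 (α.slope h) with h0 | h0
  · left
    refine ⟨le_add_of_nonneg_right (zsmul_nonneg hp h0), add_le_add_right ?_ _⟩
    rw [← sub_nonneg, ← smul_sub]
    exact zsmul_nonneg (sub_nonneg.2 hl) h0
  · right
    have h1 : 0 ≤ -α.slope h := by omega
    constructor
    · refine add_le_add_right ?_ _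
      rw [← sub_nonneg, ← smul_sub, ← neg_sub, smul_neg, ← neg_smul]
      exact zsmul_nonneg (sub_nonneg.2 hl) h1
    · refine add_le_of_nonpos_right ?_
      rw [← neg_nonneg, ← neg_smul]
      exact zsmul_nonneg hp h1

theorem PLFunction.slope_onD {n : ℕ} {M₁ M₂ : ToricMonoid} {φ : M₁ ⟶ M₂} {C₁ : TropicalCurve M₁ n}
    {C₂ : TropicalCurve M₂ n} {f : TropicalHom φ C₁ C₂} {α₁ : PLFunction C₁} {α₂ : PLFunction C₂}
    (hα : ∀ v, φ.toFun (α₁.val v) = α₂.val (f.onV v)) (k : C₂.D) :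
    α₁.slope (f.onD k) = α₂.slope k := by
  refine ToricMonoid.zsmul_right_cancel (C₂.len_ne_zero k) ?_
  rw [← α₂.val_tgt_sub, ← f.len_onD, ← map_zsmul, ← α₁.val_tgt_sub, map_sub, hα, hα, f.onV_src,
    f.onV_tgt]

theorem PLFunction.IsLift.val_vertexAt {n : ℕ} {M : ToricMonoid} {C' C : TropicalCurve M n}
    {q : CurveSubdivision C' C} {α' : PLFunction C'} {α : PLFunction C} (hl : α'.IsLift q α)
    {h : C.D} {p : M.gp} (hp : p ∈ q.points h) :
    α'.val (q.vertexAt h p) = α.val (C.src h) + α.slope h • p := by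
  rcases hp with rfl | ⟨k, rfl, rfl⟩
  · rw [q.vertexAt_len, hl.1, α.val_tgt]
  · rw [q.vertexAt_pos, hl.val_src]

theorem PLFunction.IsLift.map_val {n : ℕ} {M₁ M₂ : ToricMonoid} {φ : M₁ ⟶ M₂}
    {C₁' C₁ : TropicalCurve M₁ n} {C₂' C₂ : TropicalCurve M₂ n} {q₁ : CurveSubdivision C₁' C₁}
    {q₂ : CurveSubdivision C₂' C₂} {f' : TropicalHom φ C₁' C₂'} {f : TropicalHom φ C₁ C₂}
    (hf : q₁.Compatible q₂ f' f) {α₁' : PLFunction C₁'} {α₁ : PLFunction C₁}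
    {α₂' : PLFunction C₂'} {α₂ : PLFunction C₂} (h₁ : α₁'.IsLift q₁ α₁) (h₂ : α₂'.IsLift q₂ α₂)
    (hα : ∀ v, φ.toFun (α₁.val v) = α₂.val (f.onV v)) (v' : C₁'.V) :
    φ.toFun (α₁'.val v') = α₂'.val (f'.onV v') := by
  by_cases hv : v' ∈ Set.range q₁.onV
  · obtain ⟨v, rfl⟩ := hv
    rw [h₁.1, hf.1, h₂.1, hα]
  · obtain ⟨h', rfl⟩ := q₁.exists_src_eq hv
    rw [h₁.val_src, map_add, map_zsmul, hα]
    by_cases hh : q₁.onD h' ∈ Set.range f.onD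
    · obtain ⟨k, hk⟩ := hh
      obtain ⟨h3, h4⟩ := hf.onV_src hk.symm
      rw [← h4, h₂.val_vertexAt h3, ← hk, f.onV_src, slope_onD hα]
    · rw [hf.onV_src_of_contracted hh, h₂.1, q₁.map_pos_eq_zero (f := f) hh, smul_zero, add_zero]

variable {g n : ℕ} [NeZero n] {A : UniversalFunction g n ℤ} {θ : UniversalFunction g n ℝ}

namespace Model

section

variable {M₁ M₂ : ToricMonoid} {φ : M₁ ⟶ M₂} {C₁ : TropicalCurve M₁ n} {C₂ : TropicalCurve M₂ n}
  {h₁ : C₁.IsStable g} {h₂ : C₂.IsStable g} (m₁ : Model A θ C₁ h₁) (m₂ : Model A θ C₂ h₂)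
  (f : TropicalHom φ C₁ C₂) (hpot : ∀ v, φ.toFun (m₁.pot v) = m₂.pot (f.onV v))
include hpot

/-- Both integers bound the same slope, `m₂.slope` from below and strictly from above. After
applying `φ` the upper bound for `m₁` may become an equality; this is when the break point runs into
the initial vertex and the edge of the target is not subdivided. -/
theorem slope_cases (k : C₂.D) :
    (m₂.slope k = m₁.slope (f.onD k) ∧
      φ.toFun (breakPos C₁ m₁.pot m₁.slope (f.onD k)) = breakPos C₂ m₂.pot m₂.slope k) ∨
    (m₂.slope k = m₁.slope (f.onD k) + 1 ∧
      φ.toFun (breakPos C₁ m₁.pot m₁.slope (f.onD k)) = 0 ∧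
      breakPos C₂ m₂.pot m₂.slope k = C₂.len k) := by
  have e1 : φ.toFun (m₁.pot (C₁.tgt (f.onD k)) - m₁.pot (C₁.src (f.onD k))) =
      m₂.pot (C₂.tgt k) - m₂.pot (C₂.src k) := by
    rw [map_sub, hpot, hpot, f.onV_src, f.onV_tgt]
  have e2 := ToricMonoid.Hom.map_mono φ (m₁.isSolution.smul_le (f.onD k))
  have e3 := ToricMonoid.Hom.map_mono φ (m₁.isSolution.le_smul (f.onD k))
  rw [e1, map_zsmul, f.len_onD] at e2 e3
  have e4 := m₂.isSolution.smul_le k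
  have e5 := sub_pos.1 (m₂.breakPos_pos k)
  have e6 := ToricMonoid.lt_of_zsmul_lt_zsmul (C₂.len_nonneg k) (e2.trans_lt e5)
  have e7 : m₂.slope k < m₁.slope (f.onD k) + 1 + 1 := by
    refine ToricMonoid.lt_of_zsmul_lt_zsmul (C₂.len_nonneg k) ((e4.trans e3).trans_lt ?_)
    rw [add_smul (m₁.slope (f.onD k) + 1) 1, one_smul]
    exact lt_add_of_pos_right _ (C₂.len_pos k)
  unfold breakPos
  rw [map_sub, e1, map_zsmul, f.len_onD]
  rcases (by omega : m₂.slope k = m₁.slope (f.onD k) ∨ m₂.slope k = m₁.slope (f.onD k) + 1) with h | h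
  · exact Or.inl ⟨h, by rw [h]⟩
  · right
    rw [h] at e4 ⊢
    have e8 := le_antisymm e3 e4
    rw [e8]
    refine ⟨rfl, sub_self _, ?_⟩
    rw [add_smul (m₁.slope (f.onD k) + 1) 1, one_smul]
    abel

theorem exists_compatible : ∃ f' : TropicalHom φ m₁.C' m₂.C', m₁.q.Compatible m₂.q f' f := by
  refine CurveSubdivision.exists_compatible fun k p => ?_
  simp only [mem_points_iff]
  have e := f.len_onD k
  rcases m₁.slope_cases m₂ f hpot k with ⟨-, h⟩ | ⟨-, h, h'⟩
  · simp [e, h, eq_comm]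
  · simp [e, h, h', eq_comm]

theorem map_val {f' : TropicalHom φ m₁.C' m₂.C'} (hf : m₁.q.Compatible m₂.q f' f) (v' : m₁.C'.V) :
    φ.toFun (m₁.α.val v') = m₂.α.val (f'.onV v') := by
  by_cases hv : v' ∈ Set.range m₁.q.onV
  · obtain ⟨v, rfl⟩ := hv
    rw [hf.1]
    exact hpot v
  · obtain ⟨h', rfl⟩ := m₁.q.exists_src_eq hv
    rw [m₁.val_src, map_add, map_zsmul, hpot]
    by_cases hh : m₁.q.onD h' ∈ Set.range f.onD
    · obtain ⟨k, hk⟩ := hh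
      obtain ⟨h3, h4⟩ := hf.onV_src hk.symm
      have h5 : m₁.q.pos h' = breakPos C₁ m₁.pot m₁.slope (m₁.q.onD h') :=
        (m₁.pos_eq h').resolve_left fun h => hv (m₁.q.pos_eq_zero_iff.1 h)
      rw [← h4, h5, ← hk, f.onV_src]
      rcases m₁.slope_cases m₂ f hpot k with ⟨h6, h7⟩ | ⟨h6, h7, h8⟩
      · rw [h7, ← h6]
        by_cases h9 : breakPos C₂ m₂.pot m₂.slope k = C₂.len k
        · rw [h9, m₂.q.vertexAt_len]
          change _ = m₂.pot _
          have h10 := h9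
          rw [breakPos, add_smul, one_smul, sub_eq_iff_eq_add, add_comm] at h10
          rw [add_left_cancel h10]
          abel
        · obtain ⟨k', rfl, h10⟩ := m₂.q.exists_pos_eq (h := k) (m₂.mem_points_iff.2
            (Or.inr (Or.inl rfl))) h9
          rw [← h10, m₂.q.vertexAt_pos, m₂.val_src]
      · rw [h7, smul_zero, add_zero, m₂.q.vertexAt_zero]
        rfl
    · rw [hf.onV_src_of_contracted hh, m₁.q.map_pos_eq_zero (f := f) hh, smul_zero, add_zero]
      rfl

end

end Model

namespace PLFunction

variable {n : ℕ} {M : ToricMonoid} {C' C : TropicalCurve M n} {q : CurveSubdivision C' C}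
  {α' : PLFunction C'} {α : PLFunction C} {X : TropicalLine M}

/-- Walk along the edge with increasing values of `α'`. The value `y` is comparable with each of
them and cannot lie strictly inside a piece, so it is met at a vertex. -/
theorem IsEquidimensional.exists_mem_points_of_pos (hX : α'.IsEquidimensional X)
    (hl : α'.IsLift q α) {h : C.D} (hs : 0 < α.slope h) {y : M.gp} (hy : y ∈ X.vertices)
    (h1 : α.val (C.src h) ≤ y) (h2 : y ≤ α.val (C.tgt h)) :
    ∃ p ∈ q.points h, α.val (C.src h) + α.slope h • p = y := by
  have step : ∀ k, q.onD k = h → α'.val (C'.src k) ≤ y →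
      (∃ p ∈ q.points h, α.val (C.src h) + α.slope h • p = y) ∨ α'.val (C'.tgt k) ≤ y := by
    rintro k rfl hk
    rcases X.total _ (hX.1 (C'.tgt k)) _ hy with h3 | h3
    · exact Or.inr h3
    · left
      rcases hX.2 k y hy hk h3 with h4 | h4
      · exact ⟨_, q.pos_mem_points k, by rw [h4, hl.val_src]⟩
      · exact ⟨_, q.pos_add_len_mem_points k, by rw [h4, hl.val_tgt]⟩
  have main : ∀ k, q.onD k = h →
      (∃ p ∈ q.points h, α.val (C.src h) + α.slope h • p = y) ∨ α'.val (C'.src k) ≤ y := by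
    refine q.edge_induction ?_ ?_
    · intro k _ _ hk
      rw [hk, hl.1]
      exact Or.inr h1
    · intro k k' hk _ ht _ _ ih
      rcases ih with ih | ih
      · exact Or.inl ih
      · rw [← ht]
        exact step k hk ih
  have hlast := q.edge_spec h
  have ht := hlast.2.2.2.1
  rcases main _ (q.onD_edge h (Fin.last _)) with h3 | h3
  · exact h3
  · rcases step _ (q.onD_edge h (Fin.last _)) h3 with h4 | h4
    · exact h4
    · rw [ht, hl.1] at h4
      exact ⟨_, q.len_mem_points h, by rw [← α.val_tgt]; exact le_antisymm h4 h2⟩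

theorem IsEquidimensional.exists_mem_points (hX : α'.IsEquidimensional X)
    (hl : α'.IsLift q α) {h : C.D} (hs : α.slope h ≠ 0) {y : M.gp} (hy : y ∈ X.vertices)
    (hb : ToricMonoid.IsBetween (α.val (C.src h)) (α.val (C.tgt h)) y) :
    ∃ p ∈ q.points h, α.val (C.src h) + α.slope h • p = y := by
  have key : ∀ h, 0 < α.slope h →
      ToricMonoid.IsBetween (α.val (C.src h)) (α.val (C.tgt h)) y →
      ∃ p ∈ q.points h, α.val (C.src h) + α.slope h • p = y := by
    rintro h hs (⟨h1, h2⟩ | ⟨h1, h2⟩)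
    · exact hX.exists_mem_points_of_pos hl hs hy h1 h2
    · have h3 : α.val (C.src h) ≤ α.val (C.tgt h) := by
        rw [α.val_tgt]
        exact le_add_of_nonneg_right (zsmul_nonneg (C.len_nonneg h) hs.le)
      exact hX.exists_mem_points_of_pos hl hs hy (h3.trans h1) (h2.trans h3)
  rcases lt_or_gt_of_ne hs with hs | hs
  · obtain ⟨p, hp, hpy⟩ := key (C.inv h) (by rw [slope_inv]; omega) (by
      rw [DualGraph.src_inv, DualGraph.tgt_inv]; exact hb.symm)
    refine ⟨C.len h - p, ?_, ?_⟩
    · have := q.len_sub_mem_points hp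
      rwa [C.inv_inv, C.len_inv] at this
    · rw [← hpy, slope_inv, DualGraph.src_inv, α.val_tgt, smul_sub, neg_smul]
      abel
  · exact key h hs hb

end PLFunction

namespace Rub

variable (x : Rub A θ)

theorem val_mem (v : x.C'.V) : x.α.val v ∈ x.X.vertices := by
  rw [← x.isLift.1]
  exact x.equidimensional.1 _

theorem total (v w : x.C'.V) : x.α.val v ≤ x.α.val w ∨ x.α.val w ≤ x.α.val v :=
  x.X.total _ (x.val_mem v) _ (x.val_mem w)

/-- The model underlying an object of the stack of equidimensional lifts. -/
def model : Model A θ x.C x.stable :=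
  ⟨x.C', x.q, x.quasiStable, x.α, x.α_leg, x.admissible, x.semistable, x.total⟩

theorem mem_points_of_val {h : x.C'.D} (hs : x.α.slope h ≠ 0) {p : x.M.gp} (hp : 0 ≤ p)
    (hl : p ≤ x.C'.len h) {v : x.C'.V} (hv : x.α.val (x.C'.src h) + x.α.slope h • p = x.α.val v) :
    p ∈ x.r.points h := by
  have hb := x.α.isBetween_val hp hl
  rw [hv] at hb
  obtain ⟨p', hp', h1⟩ := x.equidimensional.exists_mem_points x.isLift hs (x.val_mem v) hb
  rw [← x.M.zsmul_left_cancel hs (add_left_cancel (h1.trans hv.symm))]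
  exact hp'

/-- Together with `mem_points_of_val` this shows that stability leaves no choice in `C''`: apart
from the endpoints, its vertices are the positions on edges of nonzero slope at which `α` takes the
value of some vertex of `C'`. -/
theorem mem_points_cases {h : x.C'.D} {p : x.M.gp} (hp : p ∈ x.r.points h) :
    p = 0 ∨ p = x.C'.len h ∨ (x.α.slope h ≠ 0 ∧ ∃ v, x.α.val (x.C'.src h) + x.α.slope h • p =
      x.α.val v) := by
  rcases hp with rfl | ⟨k, rfl, rfl⟩
  · exact Or.inr (Or.inl rfl)
  · by_cases h0 : x.C''.src k ∈ Set.range x.r.onV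
    · exact Or.inl (x.r.pos_eq_zero_iff.2 h0)
    · right; right
      have h1 := x.slope_ne_zero k h0
      rw [x.isLift.2] at h1
      obtain ⟨v, hv⟩ := x.vertices_eq _ (x.equidimensional.1 (x.C''.src k))
      exact ⟨h1, v, by rw [hv, x.isLift.val_src]⟩

theorem map_pot (hθ : θ.IsNondegenerate) {x y : Rub A θ}
    (hdeg : ∑ v, θ.toFun x.C.toDualGraph x.stable v =
      ((∑ v, A.toFun x.C.toDualGraph x.stable v : ℤ) : ℝ)) {φ : x.M ⟶ y.M}
    (f : TropicalHom φ x.C y.C) (v : x.C.V) : φ.toFun (x.model.pot v) = y.model.pot (f.onV v) :=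
  x.model.isSolution.map_eq hθ hdeg f y.model.isSolution v

/-- The positions of the vertices of `C''` are characterized by values and slopes of `α`, and these
correspond under `f'`; a value that comes to lie between two others only after applying `φ` produces
an endpoint. -/
theorem exists_compatible_r {x y : Rub A θ} {φ : x.M ⟶ y.M} (f' : TropicalHom φ x.C' y.C')
    (hα : ∀ v, φ.toFun (x.α.val v) = y.α.val (f'.onV v)) :
    ∃ f'' : TropicalHom φ x.C'' y.C'', x.r.Compatible y.r f'' f' := by
  refine CurveSubdivision.exists_compatible fun k p => ⟨fun hp => ?_, ?_⟩
  · rcases y.mem_points_cases hp with rfl | rfl | ⟨hs, w, hw⟩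
    · exact ⟨0, x.r.zero_mem_points _, map_zero _⟩
    · exact ⟨_, x.r.len_mem_points _, f'.len_onD k⟩
    · obtain ⟨v, rfl⟩ := f'.onV_surjective w
      have hs' : x.α.slope (f'.onD k) = y.α.slope k := PLFunction.slope_onD hα k
      have e1 : φ.toFun (x.α.val (x.C'.src (f'.onD k))) = y.α.val (y.C'.src k) := by
        rw [hα, f'.onV_src]
      have e2 : φ.toFun (x.α.val (x.C'.tgt (f'.onD k))) = y.α.val (y.C'.tgt k) := by
        rw [hα, f'.onV_tgt]
      have p0 : y.α.val (f'.onV v) = y.α.val (y.C'.src k) → p = 0 := fun h => by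
        rw [h, add_eq_left] at hw
        exact y.M.zsmul_left_cancel hs (by rw [hw, smul_zero])
      have p1 : y.α.val (f'.onV v) = y.α.val (y.C'.tgt k) → p = y.C'.len k := fun h => by
        rw [h, y.α.val_tgt] at hw
        exact y.M.zsmul_left_cancel hs (add_left_cancel hw)
      have hb := y.α.isBetween_val (y.r.nonneg_of_mem_points hp) (y.r.le_len_of_mem_points hp)
      rw [hw, ← e1, ← e2, ← hα] at hb
      rcases ToricMonoid.isBetween_or_eq_of_map φ (x.total _ _) (x.total _ _) hb with h | h | h
      · obtain ⟨p₁, hp₁, h1⟩ := x.equidimensional.exists_mem_points x.isLift (hs' ▸ hs)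
          (x.val_mem v) h
        refine ⟨p₁, hp₁, y.M.zsmul_left_cancel hs ?_⟩
        rw [← hα, ← h1, map_add, map_zsmul, hs', e1] at hw
        exact (add_left_cancel hw).symm
      · rw [hα, e1] at h
        exact ⟨0, x.r.zero_mem_points _, by rw [map_zero, p0 h]⟩
      · rw [hα, e2] at h
        exact ⟨_, x.r.len_mem_points _, by rw [f'.len_onD, p1 h]⟩
  · rintro ⟨p₁, hp₁, rfl⟩
    rcases x.mem_points_cases hp₁ with rfl | rfl | ⟨hs, v, hv⟩
    · rw [map_zero]; exact y.r.zero_mem_points _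
    · rw [f'.len_onD]; exact y.r.len_mem_points _
    · rw [PLFunction.slope_onD hα k] at hs hv
      refine y.mem_points_of_val hs (v := f'.onV v) (ToricMonoid.Hom.map_nonneg φ
        (x.r.nonneg_of_mem_points hp₁)) ?_ ?_
      · rw [← f'.len_onD]
        exact ToricMonoid.Hom.map_mono φ (x.r.le_len_of_mem_points hp₁)
      · rw [← hα, ← hv, map_add, map_zsmul, hα, f'.onV_src]

/-- Every map between the stabilizations lifts. -/
theorem stabilization_full (hθ : θ.IsNondegenerate)
    (hdeg : ∀ (Γ : DualGraph n) (hΓ : Γ.IsStable g),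
      ∑ v, θ.toFun Γ hΓ v = ((∑ v, A.toFun Γ hΓ v : ℤ) : ℝ)) : (stabilization A θ).Full := by
  refine ⟨fun {x y} a => ?_⟩
  have hpot := map_pot hθ (hdeg _ _) a.f
  obtain ⟨f', hf'⟩ := x.model.exists_compatible y.model a.f hpot
  have hα := x.model.map_val y.model a.f hpot hf'
  obtain ⟨f'', hf''⟩ := exists_compatible_r f' hα
  refine ⟨⟨a.φ, a.f, f', f'', hf', hf'', hα, PLFunction.IsLift.map_val hf'' x.isLift y.isLift hα,
    fun t ht => ?_⟩, rfl⟩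
  obtain ⟨v, rfl⟩ := x.vertices_eq t ht
  refine (hα v).symm ▸ y.val_mem _

/-- Lifts of maps between the stabilizations are unique. -/
theorem stabilization_faithful : (stabilization A θ).Faithful := by
  refine ⟨fun {x y} a b hab => ?_⟩
  obtain ⟨φ, f, f', f'', hq, hr, _, _, _⟩ := a
  obtain ⟨φ₂, f₂, f₂', f₂'', hq₂, hr₂, _, _, _⟩ := b
  obtain ⟨rfl, hf⟩ := Mbar.Hom.mk.inj hab
  obtain rfl := eq_of_heq hf
  obtain rfl := hq.unique hq₂
  obtain rfl := hr.unique hr₂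
  rfl

end Rub
end TropRub

namespace TropRub

/-! ### Construction of equidimensional lifts -/

theorem exists_enumeration {P : Type*} [PartialOrder P] [Nonempty P] (Y : Finset P)
    (htot : ∀ x ∈ Y, ∀ y ∈ Y, x ≤ y ∨ y ≤ x) :
    ∃ (N : ℕ) (e : ℕ → P), (∀ i j, i < j → j < N → e i < e j) ∧ ∀ y, y ∈ Y ↔ ∃ i < N, e i = y := by
  classical
  let : LinearOrder Y :=
    { (inferInstance : PartialOrder Y) with
      le_total := fun x y => htot x.1 x.2 y.1 y.2
      toDecidableLE := Classical.decRel _ }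
  let o := (Finset.univ : Finset Y).orderIsoOfFin rfl
  refine ⟨(Finset.univ : Finset Y).card, fun i => if hi : i < (Finset.univ : Finset Y).card then
    ((o ⟨i, hi⟩ : Finset.univ) : Y) else Classical.arbitrary P, ?_, ?_⟩
  · intro i j hij hj
    simp only [dif_pos hj, dif_pos (hij.trans hj)]
    exact o.lt_iff_lt.2 (show (⟨i, hij.trans hj⟩ : Fin _) < ⟨j, hj⟩ from hij)
  · intro y
    constructor
    · intro hy
      refine ⟨o.symm ⟨⟨y, hy⟩, Finset.mem_univ _⟩, (o.symm _).2, ?_⟩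
      simp only [dif_pos (o.symm _).2, Fin.eta, OrderIso.apply_symm_apply]
    · rintro ⟨i, hi, rfl⟩
      simp only [dif_pos hi]
      exact Subtype.property _

namespace PLFunction

variable {n : ℕ} {M : ToricMonoid} {C : TropicalCurve M n} (α : PLFunction C)

/-- The slopes of `α` divide the differences of its values wherever the equidimensional lift
requires it. -/
def IsDivisible : Prop := ∀ h, α.slope h ≠ 0 → ∀ v,
  ToricMonoid.IsBetween (α.val (C.src h)) (α.val (C.tgt h)) (α.val v) →
  ∃ p, α.slope h • p = α.val v - α.val (C.src h)

/-- Enumerate the values of `α` in increasing order. An edge of nonzero slope passes through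
consecutive values, from that of its initial to that of its final vertex, and divisibility supplies
the position at which each is attained. -/
theorem exists_subdivisionData (htot : ∀ v w, α.val v ≤ α.val w ∨ α.val w ≤ α.val v)
    (hdiv : α.IsDivisible) : ∃ d : SubdivisionData C,
      (∀ h, α.slope h = 0 → d.num h = 0) ∧
      (∀ h i, i ≤ d.num h + 1 → ∃ v, α.val (C.src h) + α.slope h • d.p h i = α.val v) ∧
      ∀ h i, i ≤ d.num h → ∀ v, α.val (C.src h) + α.slope h • d.p h i ≤ α.val v →
        α.val v ≤ α.val (C.src h) + α.slope h • d.p h (i + 1) →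
        α.val v = α.val (C.src h) + α.slope h • d.p h i ∨
          α.val v = α.val (C.src h) + α.slope h • d.p h (i + 1) := by
  classical
  obtain ⟨N, e, he, hY⟩ := exists_enumeration (Finset.univ.image α.val) (by
    simp only [Finset.mem_image, Finset.mem_univ, true_and]
    rintro _ ⟨v, rfl⟩ _ ⟨w, rfl⟩
    exact htot v w)
  simp only [Finset.mem_image, Finset.mem_univ, true_and] at hY
  have he' : ∀ i j, i ≤ j → j < N → e i ≤ e j := fun i j hij hj => by
    rcases hij.eq_or_lt with rfl | h
    · exact le_rfl
    · exact (he i j h hj).le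
  have hidx : ∀ v, ∃ i < N, e i = α.val v := fun v => (hY _).1 ⟨v, rfl⟩
  choose idx hidx1 hidx2 using hidx
  have lt_of : ∀ i j, j < N → i < N → e i < e j → i < j := fun i j hj hi h => by
    by_contra hc
    exact absurd h (not_lt_of_ge (he' _ _ (not_lt.1 hc) hi))
  have le_of : ∀ i j, j < N → i < N → e i ≤ e j → i ≤ j := fun i j hj hi h => by
    by_contra hc
    exact absurd h (not_le_of_gt (he _ _ (not_le.1 hc) hi))
  have hpos : ∀ h, 0 < α.slope h → idx (C.src h) < idx (C.tgt h) := by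
    intro h hs
    refine lt_of _ _ (hidx1 _) (hidx1 _) ?_
    rw [hidx2, hidx2, α.val_tgt]
    exact lt_add_of_pos_right _ (zsmul_pos (C.len_pos h) hs)
  have hneg : ∀ h, α.slope h < 0 → idx (C.tgt h) < idx (C.src h) := by
    intro h hs
    have := hpos (C.inv h) (by rw [slope_inv]; omega)
    rwa [DualGraph.src_inv, DualGraph.tgt_inv] at this
  have hzero : ∀ h, α.slope h = 0 → idx (C.tgt h) = idx (C.src h) := by
    intro h hs
    have e1 : α.val (C.tgt h) = α.val (C.src h) := by rw [α.val_tgt, hs, zero_smul, add_zero]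
    refine le_antisymm (le_of _ _ (hidx1 _) (hidx1 _) ?_) (le_of _ _ (hidx1 _) (hidx1 _) ?_) <;>
      rw [hidx2, hidx2, e1]
  -- The distance of two indices, written with truncated subtraction, minus one for the interior. On
  -- edges of slope zero the truncation yields `0`.
  set num : C.D → ℕ := fun h =>
    (idx (C.src h) - idx (C.tgt h)) + (idx (C.tgt h) - idx (C.src h)) - 1 with hnum
  -- The index of the `i`-th value met along `h`, counted upwards or downwards according to the
  -- direction of the edge.
  set j : C.D → ℕ → ℕ := fun h i =>
    if idx (C.src h) ≤ idx (C.tgt h) then idx (C.src h) + i else idx (C.src h) - i with hj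
  have hp : ∀ h, ∃ p : ℕ → M.gp, p 0 = 0 ∧ p (num h + 1) = C.len h ∧
      (α.slope h ≠ 0 → ∀ i ≤ num h + 1, α.val (C.src h) + α.slope h • p i = e (j h i)) := by
    intro h
    by_cases hs : α.slope h = 0
    · exact ⟨fun i => if i = 0 then 0 else C.len h, by simp, by simp, fun h => absurd hs h⟩
    · have hex : ∀ i, ∃ p, i ≤ num h + 1 → α.val (C.src h) + α.slope h • p = e (j h i) := by
        intro i
        by_cases hi : i ≤ num h + 1
        · have hjN : j h i < N ∧ ((idx (C.src h) ≤ j h i ∧ j h i ≤ idx (C.tgt h)) ∨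
              (idx (C.tgt h) ≤ j h i ∧ j h i ≤ idx (C.src h))) := by
            have h1 := hidx1 (C.src h)
            have h2 := hidx1 (C.tgt h)
            simp only [hj]
            simp only [hnum] at hi
            rcases lt_or_gt_of_ne hs with h3 | h3
            · have := hneg h h3
              rw [if_neg (by omega)]
              omega
            · have := hpos h h3
              rw [if_pos (by omega)]
              omega
          obtain ⟨v, hv⟩ := (hY _).2 ⟨j h i, hjN.1, rfl⟩
          obtain ⟨p, hp⟩ := hdiv h hs v (by
            rw [hv, ← hidx2, ← hidx2]
            rcases hjN.2 with h1 | h1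
            · exact Or.inl ⟨he' _ _ h1.1 hjN.1, he' _ _ h1.2 (hidx1 _)⟩
            · exact Or.inr ⟨he' _ _ h1.1 hjN.1, he' _ _ h1.2 (hidx1 _)⟩)
          exact ⟨p, fun _ => by rw [hp, hv]; abel⟩
        · exact ⟨0, fun h => absurd h hi⟩
      choose p hp using hex
      refine ⟨p, ?_, ?_, fun _ => hp⟩
      · refine M.zsmul_left_cancel hs ?_
        have h1 := hp 0 (Nat.zero_le _)
        have : j h 0 = idx (C.src h) := by simp [hj]
        rw [this, hidx2, add_eq_left] at h1
        rw [h1, smul_zero]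
      · refine M.zsmul_left_cancel hs ?_
        have h1 := hp (num h + 1) le_rfl
        have : j h (num h + 1) = idx (C.tgt h) := by
          simp only [hj, hnum]
          rcases lt_or_gt_of_ne hs with h3 | h3
          · have := hneg h h3
            rw [if_neg (by omega)]
            omega
          · have := hpos h h3
            rw [if_pos (by omega)]
            omega
        rw [this, hidx2, α.val_tgt] at h1
        exact add_left_cancel h1
  choose p hp0 hp1 hp2 using hp
  have hnum0 : ∀ h, α.slope h = 0 → num h = 0 := by
    intro h hs
    have := hzero h hs
    simp only [hnum]
    omega
  have hjlt : ∀ h i, i ≤ num h + 1 → α.slope h ≠ 0 → j h i < N := by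
    intro h i hi hs
    have h1 := hidx1 (C.src h)
    have h2 := hidx1 (C.tgt h)
    simp only [hj]
    simp only [hnum] at hi
    split_ifs
    · rcases lt_or_gt_of_ne hs with h3 | h3
      · have := hneg h h3
        omega
      · have := hpos h h3
        omega
    · omega
  refine ⟨⟨num, p, fun h => ?_, hp0, hp1, fun h i hi => ?_, fun h i hi => ?_⟩, hnum0,
    fun h i hi => ?_, fun h i hi v h1 h2 => ?_⟩
  · simp only [hnum, DualGraph.src_inv, DualGraph.tgt_inv]
    omega
  · rcases lt_trichotomy (α.slope h) 0 with hs | hs | hs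
    · have h3 := hneg h hs
      have hlt : e (j h (i + 1)) < e (j h i) := by
        refine he _ _ ?_ (hjlt h _ (by omega) hs.ne)
        simp only [hj]
        rw [if_neg (by omega), if_neg (by omega)]
        simp only [hnum] at hi
        omega
      rw [← hp2 h hs.ne _ (by omega), ← hp2 h hs.ne _ (by omega)] at hlt
      have h4 := lt_of_add_lt_add_left hlt
      rw [← sub_pos, ← smul_sub, ← neg_sub, smul_neg, ← neg_smul] at h4
      refine lt_of_le_of_ne (sub_nonneg.1 (ToricMonoid.nonneg_of_zsmul_nonneg (by omega) h4.le)) ?_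
      intro h5
      rw [h5, sub_self, smul_zero] at h4
      exact lt_irrefl _ h4
    · have := hnum0 h hs
      obtain rfl : i = 0 := by omega
      have h1 := hp1 h
      rw [this] at h1
      rw [hp0, h1]
      exact C.len_pos h
    · have h3 := hpos h hs
      have hlt : e (j h i) < e (j h (i + 1)) := by
        refine he _ _ ?_ (hjlt h _ (by omega) hs.ne')
        simp only [hj]
        rw [if_pos (by omega), if_pos (by omega)]
        omega
      rw [← hp2 h hs.ne' _ (by omega), ← hp2 h hs.ne' _ (by omega)] at hlt
      have h4 := lt_of_add_lt_add_left hlt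
      rw [← sub_pos, ← smul_sub] at h4
      refine lt_of_le_of_ne (sub_nonneg.1 (ToricMonoid.nonneg_of_zsmul_nonneg hs h4.le)) ?_
      intro h5
      rw [h5, sub_self, smul_zero] at h4
      exact lt_irrefl _ h4
  · have hni : num (C.inv h) = num h := by
      simp only [hnum, DualGraph.src_inv, DualGraph.tgt_inv]
      omega
    by_cases hs : α.slope h = 0
    · have h0 := hnum0 h hs
      have h1 := hp1 h
      have h2 := hp1 (C.inv h)
      rw [hni] at h2
      rw [h0] at hi h1 h2 ⊢
      rcases (by omega : i = 0 ∨ i = 1) with rfl | rfl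
      · rw [hp0, h1, sub_self]
      · rw [h2, hp0, C.len_inv, sub_zero]
    · refine M.zsmul_left_cancel hs ?_
      have hs' : α.slope (C.inv h) ≠ 0 := by rw [slope_inv]; omega
      have h1 := hp2 (C.inv h) hs' i (by rw [hni]; exact hi)
      have h2 := hp2 h hs (num h + 1 - i) (by omega)
      have h3 : j (C.inv h) i = j h (num h + 1 - i) := by
        simp only [hj, hnum, DualGraph.src_inv, DualGraph.tgt_inv] at hi ⊢
        rcases lt_or_gt_of_ne hs with h3 | h3
        · have := hneg h h3
          rw [if_pos (by omega), if_neg (by omega)]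
          omega
        · have := hpos h h3
          rw [if_neg (by omega), if_pos (by omega)]
          omega
      rw [h3, ← h2, slope_inv, DualGraph.src_inv, α.val_tgt, neg_smul] at h1
      rw [smul_sub, eq_sub_iff_add_eq]
      have h4 : α.slope h • C.len h = α.slope h • p h (num h + 1 - i) +
          α.slope h • p (C.inv h) i := by
        rw [add_assoc] at h1
        rw [← add_left_cancel h1]
        abel
      rw [h4, add_comm]
  · by_cases hs : α.slope h = 0
    · exact ⟨C.src h, by rw [hs, zero_smul, add_zero]⟩
    · obtain ⟨v, hv⟩ := (hY _).2 ⟨_, hjlt h i hi hs, rfl⟩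
      exact ⟨v, by rw [hv]; exact hp2 h hs i hi⟩
  · change α.val (C.src h) + α.slope h • p h i ≤ _ at h1
    change _ ≤ α.val (C.src h) + α.slope h • p h (i + 1) at h2
    change _ = α.val (C.src h) + α.slope h • p h i ∨ _ = α.val (C.src h) + α.slope h • p h (i + 1)
    change i ≤ num h at hi
    by_cases hs : α.slope h = 0
    · rw [hs, zero_smul, add_zero] at h1 h2 ⊢
      exact Or.inl (le_antisymm h2 h1)
    · rw [hp2 h hs i (by omega)] at h1 ⊢
      rw [hp2 h hs (i + 1) (by omega)] at h2 ⊢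
      have a1 := hjlt h i (by omega) hs
      have a2 := hjlt h (i + 1) (by omega) hs
      rw [← hidx2 v] at h1 h2 ⊢
      have b1 := le_of _ _ (hidx1 v) a1 h1
      have b2 := le_of _ _ a2 (hidx1 v) h2
      have b3 : j h (i + 1) ≤ j h i + 1 := by
        simp only [hj]
        split_ifs <;> omega
      rcases (by omega : idx v = j h i ∨ idx v = j h (i + 1)) with h5 | h5
      · exact Or.inl (congrArg e h5)
      · exact Or.inr (congrArg e h5)

end PLFunction

variable {g n : ℕ} [NeZero n] {A : UniversalFunction g n ℤ} {θ : UniversalFunction g n ℝ}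
  {M : ToricMonoid} {C : TropicalCurve M n} {hC : C.IsStable g}

theorem Model.exists_rub (m : Model A θ C hC) (hdiv : m.α.IsDivisible) :
    ∃ x : Rub A θ, (Rub.stabilization A θ).obj x = ⟨M, C, hC⟩ := by
  classical
  obtain ⟨d, hd0, hd1, hd2⟩ := m.α.exists_subdivisionData m.total hdiv
  obtain ⟨α', hl⟩ := PLFunction.exists_isLift d.subdivision m.α
  have hsrc : ∀ k : d.curve.D, α'.val (d.curve.src k) =
      m.α.val (m.C'.src k.1) + m.α.slope k.1 • d.p k.1 k.2 := by
    intro k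
    rw [hl.val_src]
    have := d.pos_subdivision k.1 k.2 k.2.2
    exact congrArg (fun p => m.α.val (m.C'.src k.1) + m.α.slope k.1 • p) this
  have htgt : ∀ k : d.curve.D, α'.val (d.curve.tgt k) =
      m.α.val (m.C'.src k.1) + m.α.slope k.1 • d.p k.1 (k.2 + 1) := by
    intro k
    rw [α'.val_tgt, hsrc, hl.2]
    change _ + m.α.slope k.1 • (d.p k.1 (k.2 + 1) - d.p k.1 k.2) = _
    rw [smul_sub]
    abel
  refine ⟨{ M := M, C := C, stable := hC, C' := m.C', q := m.q, quasiStable := m.quasiStable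
            α := m.α, α_leg := m.α_leg, admissible := m.admissible, semistable := m.semistable
            C'' := d.curve, r := d.subdivision, α' := α', isLift := hl
            X := ⟨Finset.univ.image m.α.val, ?_⟩, equidimensional := ⟨fun v' => ?_, ?_⟩
            vertices_eq := ?_, slope_ne_zero := ?_ }, rfl⟩
  · simp only [Finset.mem_image, Finset.mem_univ, true_and]
    rintro _ ⟨v, rfl⟩ _ ⟨w, rfl⟩
    exact m.total v w
  · simp only [Finset.mem_image, Finset.mem_univ, true_and]
    by_cases hv : v' ∈ Set.range d.subdivision.onV
    · obtain ⟨v, rfl⟩ := hv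
      exact ⟨v, (hl.1 v).symm⟩
    · obtain ⟨k, rfl⟩ := d.subdivision.exists_src_eq hv
      obtain ⟨v, hv⟩ := hd1 k.1 k.2 k.2.2.le
      exact ⟨v, by rw [hsrc, hv]⟩
  · simp only [Finset.mem_image, Finset.mem_univ, true_and]
    rintro k _ ⟨v, rfl⟩ h1 h2
    rw [hsrc] at h1 ⊢
    rw [htgt] at h2 ⊢
    exact hd2 k.1 k.2 (Nat.lt_succ_iff.1 k.2.2) v h1 h2
  · simp only [Finset.mem_image, Finset.mem_univ, true_and]
    exact fun _ h => h
  · intro k hk hs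
    rw [hl.2] at hs
    have h0 := hd0 _ hs
    refine hk (d.subdivision.pos_eq_zero_iff.1 ?_)
    have hk0 : (k.2 : ℕ) = 0 := by
      have := k.2.2
      change d.num k.1 = 0 at h0
      omega
    exact (d.pos_subdivision k.1 k.2 k.2.2).trans (by rw [hk0, d.p_zero])

/-- The piecewise linear function of an equidimensional lift is divisible. -/
theorem Rub.isDivisible (x : Rub A θ) : x.α.IsDivisible := by
  intro h hs v hb
  obtain ⟨p, -, hp⟩ := x.equidimensional.exists_mem_points x.isLift hs (x.val_mem v) hb
  exact ⟨p, by rw [← hp]; abel⟩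

end TropRub

namespace TropRub

/-! ### Divisibility and the sublattice -/

variable {g n : ℕ} [NeZero n] {A : UniversalFunction g n ℤ} {θ : UniversalFunction g n ℝ}

/-- Divisibility over the target is read off a single model on the source, so that one finite list
of conditions serves all maps out of it. Contracted edges only require dividing zero. An incidence
that appears only after applying `φ` concerns a value at an endpoint, where divisibility is
automatic. -/
theorem Model.isDivisible_iff {M₁ M₂ : ToricMonoid} {φ : M₁ ⟶ M₂} {C₁ : TropicalCurve M₁ n}
    {C₂ : TropicalCurve M₂ n} {h₁ : C₁.IsStable g} {h₂ : C₂.IsStable g} (m₁ : Model A θ C₁ h₁)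
    (m₂ : Model A θ C₂ h₂) (f : TropicalHom φ C₁ C₂)
    (hpot : ∀ v, φ.toFun (m₁.pot v) = m₂.pot (f.onV v)) :
    m₂.α.IsDivisible ↔ ∀ h v, m₁.α.slope h ≠ 0 →
      ToricMonoid.IsBetween (m₁.α.val (m₁.C'.src h)) (m₁.α.val (m₁.C'.tgt h)) (m₁.α.val v) →
      ∃ p, m₁.α.slope h • p = φ.toFun (m₁.α.val v - m₁.α.val (m₁.C'.src h)) := by
  obtain ⟨f', hf'⟩ := m₁.exists_compatible m₂ f hpot
  have hα := m₁.map_val m₂ f hpot hf'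
  constructor
  · intro hd h v hs hb
    have hb' : ToricMonoid.IsBetween (φ.toFun (m₁.α.val (m₁.C'.src h)))
        (φ.toFun (m₁.α.val (m₁.C'.tgt h))) (φ.toFun (m₁.α.val v)) :=
      hb.imp (And.imp (ToricMonoid.Hom.map_mono φ) (ToricMonoid.Hom.map_mono φ))
        (And.imp (ToricMonoid.Hom.map_mono φ) (ToricMonoid.Hom.map_mono φ))
    by_cases hh : h ∈ Set.range f'.onD
    · obtain ⟨k, rfl⟩ := hh
      rw [PLFunction.slope_onD hα] at hs ⊢
      rw [hα, hα, hα, f'.onV_src, f'.onV_tgt] at hb'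
      obtain ⟨p, hp⟩ := hd k hs _ hb'
      exact ⟨p, by rw [hp, map_sub, hα, hα, f'.onV_src]⟩
    · have e : φ.toFun (m₁.α.val (m₁.C'.tgt h)) = φ.toFun (m₁.α.val (m₁.C'.src h)) := by
        rw [hα, hα, f'.onV_contracted hh]
      rw [e] at hb'
      refine ⟨0, ?_⟩
      rw [smul_zero, map_sub]
      rcases hb' with ⟨h1, h2⟩ | ⟨h1, h2⟩
      · rw [le_antisymm h2 h1, sub_self]
      · rw [le_antisymm h2 h1, sub_self]
  · intro hd k hs w hb
    obtain ⟨v, rfl⟩ := f'.onV_surjective w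
    rw [← f'.onV_src, ← f'.onV_tgt, ← hα, ← hα, ← hα] at hb
    rcases ToricMonoid.isBetween_or_eq_of_map φ (m₁.total _ _) (m₁.total _ _) hb with h | h | h
    · obtain ⟨p, hp⟩ := hd (f'.onD k) v (by rwa [PLFunction.slope_onD hα]) h
      refine ⟨p, ?_⟩
      rw [← PLFunction.slope_onD hα, hp, map_sub, hα, hα, f'.onV_src]
    · refine ⟨0, ?_⟩
      rw [← hα, h, hα, f'.onV_src, sub_self, smul_zero]
    · refine ⟨m₂.C'.len k, ?_⟩
      rw [← hα, h, hα, f'.onV_tgt, m₂.α.val_tgt]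
      abel

variable (A θ) in
/-- The stable tropical curves with a model whose values are totally ordered. -/
def HasModel : ObjectProperty (Mbar g n) := fun z => Nonempty (Model A θ z.C z.stable)

variable (A θ) in
/-- The stack of equidimensional lifts over the stack of curves with a model. -/
def toHasModel : Rub A θ ⥤ (HasModel A θ).FullSubcategory :=
  (HasModel A θ).lift (Rub.stabilization A θ) fun x => ⟨x.model⟩

/-- A model `m` over the source fixes finitely many pairs of a nonzero slope and a difference of
values. The sublattice `L` consists of the functionals for which all these slopes divide; an
equidimensional lift exists over `z` exactly if every lattice point of `z` restricts into `L`. -/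
theorem isFiniteIndexInclusion_toHasModel (hθ : θ.IsNondegenerate)
    (hdeg : ∀ (Γ : DualGraph n) (hΓ : Γ.IsStable g),
      ∑ v, θ.toFun Γ hΓ v = ((∑ v, A.toFun Γ hΓ v : ℤ) : ℝ)) :
    IsFiniteIndexInclusion ((HasModel A θ).ι ⋙ Mbar.base g n) (toHasModel A θ) := by
  have hfull := Rub.stabilization_full (A := A) hθ hdeg
  have hfaith := Rub.stabilization_faithful (A := A) (θ := θ)
  have hcomp : toHasModel A θ ⋙ (HasModel A θ).ι = Rub.stabilization A θ :=
    rfl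
  refine ⟨?_, ?_, fun y => ?_⟩
  · have : (toHasModel A θ ⋙ (HasModel A θ).ι).Full := hcomp ▸ hfull
    exact Functor.Full.of_comp_faithful _ (HasModel A θ).ι
  · have : (toHasModel A θ ⋙ (HasModel A θ).ι).Faithful := hcomp ▸ hfaith
    exact Functor.Faithful.of_comp _ (HasModel A θ).ι
  obtain ⟨m⟩ := y.property
  obtain ⟨L, hL, hmem⟩ := finiteIndex_forall_dvd
    (ι := {i : m.C'.D × m.C'.V // m.α.slope i.1 ≠ 0 ∧ ToricMonoid.IsBetween
      (m.α.val (m.C'.src i.1)) (m.α.val (m.C'.tgt i.1)) (m.α.val i.2)})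
    (fun i => m.α.slope i.1.1) (fun i => m.α.val i.1.2 - m.α.val (m.C'.src i.1.1))
    fun i => i.2.1
  refine ⟨L, hL, fun z f => ?_⟩
  have hiff : (∀ x : z.obj.M.gp →+ ℤ, x.comp f.hom.φ.toFun ∈ L) ↔ ∀ h v, m.α.slope h ≠ 0 →
      ToricMonoid.IsBetween (m.α.val (m.C'.src h)) (m.α.val (m.C'.tgt h)) (m.α.val v) →
      ∃ p, m.α.slope h • p = f.hom.φ.toFun (m.α.val v - m.α.val (m.C'.src h)) := by
    simp only [hmem, ToricMonoid.exists_zsmul_eq_iff, AddMonoidHom.comp_apply]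
    exact ⟨fun H h v h1 h2 x => H x ⟨(h, v), h1, h2⟩, fun H x i => H _ _ i.2.1 i.2.2 x⟩
  refine Iff.trans ?_ hiff.symm
  constructor
  -- The essential image is closed under isomorphism only, so the quotient is found over `x` and
  -- carried to `z` along `e`.
  · rintro ⟨x, ⟨e⟩⟩ h v h1 h2
    have e1 := (m.isDivisible_iff x.model (f ≫ e.inv).hom.f
      (m.isSolution.map_eq hθ (hdeg _ _) _ x.model.isSolution)).1 x.isDivisible h v h1 h2
    obtain ⟨p, hp⟩ := e1
    refine ⟨e.hom.hom.φ.toFun p, ?_⟩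
    refine (map_zsmul e.hom.hom.φ.toFun _ _).symm.trans ((congrArg e.hom.hom.φ.toFun hp).trans ?_)
    have e2 : (f ≫ e.inv) ≫ e.hom = f := by simp
    exact congrArg (fun f : y ⟶ z => f.hom.φ.toFun (m.α.val v - m.α.val (m.C'.src h))) e2
  · intro H
    obtain ⟨mz⟩ := z.property
    obtain ⟨x, hx⟩ := mz.exists_rub ((m.isDivisible_iff mz f.hom.f
      (m.isSolution.map_eq hθ (hdeg _ _) _ mz.isSolution)).2 H)
    refine ⟨x, ⟨eqToIso ?_⟩⟩
    exact ObjectProperty.FullSubcategory.ext hx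

/-- Full faithfulness is automatic for a full subcategory. Its essential image is the property
itself, since by the fan criterion having a model is inherited along arrows, in particular along
isomorphisms. -/
theorem isSubdivision_ι (hfan : ∀ y : Mbar g n, ∃ Δ : ConeSubdivision y.M, ∀ (z : Mbar g n)
      (f : y ⟶ z), Nonempty (Model A θ z.C z.stable) ↔
        ∃ τ ∈ Δ.cones, ∀ x ∈ z.M.cone, x.comp f.φ.toFun ∈ τ) :
    IsSubdivision (Mbar.base g n) (HasModel A θ).ι := by
  have hmap : ∀ {y z : Mbar g n}, (y ⟶ z) → HasModel A θ y → HasModel A θ z := by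
    intro y z f hy
    obtain ⟨Δ, hΔ⟩ := hfan y
    obtain ⟨τ, hτ, h⟩ := (hΔ y (𝟙 y)).1 hy
    refine (hΔ z f).2 ⟨τ, hτ, fun x hx => h (x.comp f.φ.toFun) fun m hm => ?_⟩
    exact hx _ (f.φ.map_mem m hm)
  refine ⟨inferInstance, inferInstance, fun y => ?_⟩
  obtain ⟨Δ, hΔ⟩ := hfan y
  refine ⟨Δ, fun z f => Iff.trans ?_ (hΔ z f)⟩
  constructor
  · rintro ⟨x, ⟨e⟩⟩
    exact hmap e.hom x.property
  · intro h
    exact ⟨⟨z, h⟩, ⟨Iso.refl _⟩⟩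

end TropRub

namespace TropRub

/-! ### The fan of a stable tropical curve -/

/-- The value at the subdivision point of an edge of length `l` which is subdivided so that the
slopes are `k` and `k + 1`; if there is no such point, the value at an endpoint. -/
noncomputable def breakValue (k : ℤ) (p q l : ℝ) : ℝ :=
  if (k + 1) * l ≤ q - p then p else if q - p ≤ k * l then q else p + k * ((k + 1) * l - (q - p))

theorem breakValue_of_ge {k : ℤ} {p q l : ℝ} (h : (k + 1) * l ≤ q - p) : breakValue k p q l = p :=
  if_pos h

theorem breakValue_of_le {k : ℤ} {p q l : ℝ} (hl : 0 ≤ l) (h : q - p ≤ k * l) :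
    breakValue k p q l = q := by
  unfold breakValue
  split_ifs with h1
  · have h2 : l = 0 := by linarith
    rw [h2, mul_zero] at h h1
    linarith
  · rfl

theorem breakValue_of_mem {k : ℤ} {p q l : ℝ} (h1 : k * l ≤ q - p) (h2 : q - p ≤ (k + 1) * l) :
    breakValue k p q l = p + k * ((k + 1) * l - (q - p)) := by
  unfold breakValue
  split_ifs with h3 h4
  · rw [le_antisymm h2 h3, sub_self, mul_zero, add_zero]
  · have h5 := le_antisymm h4 h1
    rw [h5]
    linarith
  · rfl

/-- A point of the cone is nonnegative on `M`, so if it kills a sum it kills each summand. -/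
theorem ToricMonoid.apply_eq_zero_of_generators {M : ToricMonoid} {s : Finset M.gp}
    (hs : AddSubmonoid.closure (s : Set M.gp) = M.mon) {x₀ x : M.gp →+ ℝ} (hx₀ : x₀ ∈ M.cone)
    (hx : ∀ m ∈ s, x₀ m = 0 → x m = 0) {m : M.gp} (hm : m ∈ M.mon) (h0 : x₀ m = 0) : x m = 0 := by
  have hsub : ∀ m ∈ AddSubmonoid.closure (s : Set M.gp), m ∈ M.mon := fun m hm => hs ▸ hm
  rw [← hs] at hm
  induction hm using AddSubmonoid.closure_induction with
  | mem m hm => exact hx m hm h0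
  | zero => exact map_zero x
  | add a b ha hb iha ihb =>
    have h1 := hx₀ a (hsub a ha)
    have h2 := hx₀ b (hsub b hb)
    rw [map_add] at h0 ⊢
    rw [iha (by linarith), ihb (by linarith), add_zero]

variable {g n : ℕ} [NeZero n] (A : UniversalFunction g n ℤ) (θ : UniversalFunction g n ℝ)
  {M : ToricMonoid} (C : TropicalCurve M n) (hC : C.IsStable g)

open Classical in
/-- The semistable potential of the metric graph at a point of the cone. -/
noncomputable def realPot (x : M.gp →+ ℝ) : C.V → ℝ :=
  if h : ∃ a : C.V → ℝ, a (C.leg 0) = 0 ∧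
      C.IsRealSolution (charge A θ C.toDualGraph hC) (fun h => x (C.len h)) a then h.choose else 0

/-- The slopes that occur. -/
noncomputable def slopeRange : Finset ℤ :=
  Finset.Icc (-⌈∑ v, |charge A θ C.toDualGraph hC v| + 1 / 2⌉ - 1)
    ⌈∑ v, |charge A θ C.toDualGraph hC v| + 1 / 2⌉

/-- The values of the potential at the vertices and at the possible subdivision points. -/
noncomputable def realValue (x : M.gp →+ ℝ) : C.V ⊕ C.D × slopeRange A θ C hC → ℝ :=
  Sum.elim (realPot A θ C hC x) fun i => breakValue i.2 (realPot A θ C hC x (C.src i.1))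
    (realPot A θ C hC x (C.tgt i.1)) (x (C.len i.1))

/-- The difference of the slope along an edge and a possible slope, times the length. -/
noncomputable def slopeDefect (x : M.gp →+ ℝ) (h : C.D) (k : ℤ) : ℝ :=
  realPot A θ C hC x (C.tgt h) - realPot A θ C hC x (C.src h) - k * x (C.len h)

/-- The functions whose signs define the fan. -/
noncomputable def fanFunction (s : Finset M.gp) : s ⊕ (C.D × slopeRange A θ C hC) ⊕
    (C.D × slopeRange A θ C hC) ⊕ ((C.V ⊕ C.D × slopeRange A θ C hC) ×
      (C.V ⊕ C.D × slopeRange A θ C hC)) → (M.gp →+ ℝ) → ℝ :=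
  -- Generators of `M` record which lengths vanish, the defects for `k` and `k + 1` the integral
  -- parts of the slopes, and the differences of values the order of the vertices and break points.
  Sum.elim (fun m x => x m) <| Sum.elim (fun i x => slopeDefect A θ C hC x i.1 i.2) <|
    Sum.elim (fun i x => slopeDefect A θ C hC x i.1 (i.2 + 1)) fun i x =>
      realValue A θ C hC x i.1 - realValue A θ C hC x i.2

/-- The integral part of the slope along an edge. -/
noncomputable def floorSlope (x : M.gp →+ ℝ) (h : C.D) : ℤ :=
  ⌊(realPot A θ C hC x (C.tgt h) - realPot A θ C hC x (C.src h)) / x (C.len h)⌋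

variable {A θ C hC} (hθ : θ.IsNondegenerate)
  (hdeg : ∑ v, θ.toFun C.toDualGraph hC v = ((∑ v, A.toFun C.toDualGraph hC v : ℤ) : ℝ))

section

include hdeg

theorem realPot_spec {x : M.gp →+ ℝ} (hx : x ∈ M.cone) : realPot A θ C hC x (C.leg 0) = 0 ∧
    C.IsRealSolution (charge A θ C.toDualGraph hC) (fun h => x (C.len h))
      (realPot A θ C hC x) := by
  have hex := DualGraph.exists_isRealSolution (Γ := C.toDualGraph)
    (c := charge A θ C.toDualGraph hC) (len := fun h => x (C.len h))
    (fun h => M.cone_apply_nonneg hx (C.len_nonneg h)) (fun h => by simp only [C.len_inv])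
    (sum_charge_eq_zero hC hdeg) (v₀ := C.leg 0) (hC.connected _)
  rw [realPot, dif_pos hex]
  exact hex.choose_spec

theorem floorSlope_le {x : M.gp →+ ℝ} (hx : x ∈ M.cone) (h : C.D) :
    0 ≤ slopeDefect A θ C hC x h (floorSlope A θ C hC x h) := by
  have hl := M.cone_apply_nonneg hx (C.len_nonneg h)
  unfold slopeDefect floorSlope
  rcases hl.eq_or_lt with h0 | h0
  · rw [(realPot_spec hdeg hx).2.eq_of_len_eq_zero h h0.symm, ← h0]
    simp
  · have := Int.floor_le ((realPot A θ C hC x (C.tgt h) - realPot A θ C hC x (C.src h)) /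
      x (C.len h))
    rw [le_div_iff₀ h0] at this
    linarith

theorem le_floorSlope {x : M.gp →+ ℝ} (hx : x ∈ M.cone) (h : C.D) :
    slopeDefect A θ C hC x h (floorSlope A θ C hC x h + 1) ≤ 0 := by
  have hl := M.cone_apply_nonneg hx (C.len_nonneg h)
  unfold slopeDefect floorSlope
  rcases hl.eq_or_lt with h0 | h0
  · rw [(realPot_spec hdeg hx).2.eq_of_len_eq_zero h h0.symm, ← h0]
    simp
  · have := (Int.lt_floor_add_one ((realPot A θ C hC x (C.tgt h) -
      realPot A θ C hC x (C.src h)) / x (C.len h))).le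
    rw [div_le_iff₀ h0] at this
    push_cast
    linarith

theorem floorSlope_mem {x : M.gp →+ ℝ} (hx : x ∈ M.cone) (h : C.D) :
    floorSlope A θ C hC x h ∈ slopeRange A θ C hC := by
  have h1 := (realPot_spec hdeg hx).2.abs_div_le
    (fun h => M.cone_apply_nonneg hx (C.len_nonneg h)) (fun h => by simp only [C.len_inv]) h
  rw [abs_le] at h1
  have h2 := Int.le_ceil (∑ v, |charge A θ C.toDualGraph hC v| + 1 / 2)
  rw [slopeRange, Finset.mem_Icc, floorSlope]
  constructor
  · rw [Int.le_floor]
    push_cast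
    linarith
  · refine Int.floor_le_iff.2 ?_
    linarith

include hθ

theorem realPot_eq {x : M.gp →+ ℝ} (hx : x ∈ M.cone) {b : C.V → ℝ} (h0 : b (C.leg 0) = 0)
    (hb : C.IsRealSolution (charge A θ C.toDualGraph hC) (fun h => x (C.len h)) b) :
    realPot A θ C hC x = b :=
  DualGraph.IsRealSolution.eq_of_leg hθ hdeg
    (fun h => M.cone_apply_nonneg hx (C.len_nonneg h)) (fun h => by simp only [C.len_inv])
    (realPot_spec hdeg hx).2 hb ((realPot_spec hdeg hx).1.trans h0.symm)

/-- The edges with integral slope connect the graph. -/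
theorem connected_by_integral_slopes {x : M.gp →+ ℝ} (hx : x ∈ M.cone) (v : C.V) :
    Relation.ReflTransGen (fun a b => ∃ h, slopeDefect A θ C hC x h (floorSlope A θ C hC x h) = 0 ∧
      C.src h = a ∧ C.tgt h = b) (C.leg 0) v := by
  classical
  by_contra hv
  -- On every edge leaving this component the slope is not integral, so the floors for the two
  -- orientations add up to `-1`. The inequalities for `S` and its complement are then opposite to
  -- each other, and equality contradicts non-degeneracy.
  set S : Finset C.V := Finset.univ.filter fun v => Relation.ReflTransGen (fun a b => ∃ h,
    slopeDefect A θ C hC x h (floorSlope A θ C hC x h) = 0 ∧ C.src h = a ∧ C.tgt h = b)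
      (C.leg 0) v with hS
  have hsol := (realPot_spec hdeg hx).2
  have hout : ∀ h, C.src h ∈ S → C.tgt h ∉ S →
      slopeDefect A θ C hC x h (floorSlope A θ C hC x h) ≠ 0 := by
    intro h h1 h2 h3
    simp only [hS, Finset.mem_filter, Finset.mem_univ, true_and] at h1 h2
    exact h2 (h1.tail ⟨h, h3, rfl, rfl⟩)
  have hlen : ∀ h, slopeDefect A θ C hC x h (floorSlope A θ C hC x h) ≠ 0 → x (C.len h) ≠ 0 := by
    intro h h1 h2
    refine h1 ?_
    rw [slopeDefect, hsol.eq_of_len_eq_zero h h2, h2]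
    simp
  have hfl : ∀ h ∈ C.inEdges S, x (C.len h) ≠ 0 ∧
      floorSlope A θ C hC x (C.inv h) = -floorSlope A θ C hC x h - 1 := by
    intro h hh
    rw [DualGraph.mem_inEdges] at hh
    have h1 := hout (C.inv h) (by simpa using hh.2) (by simpa using hh.1)
    have h2 := hlen _ h1
    have h3 : 0 < slopeDefect A θ C hC x (C.inv h) (floorSlope A θ C hC x (C.inv h)) :=
      lt_of_le_of_ne (floorSlope_le hdeg hx _) (Ne.symm h1)
    have h4 := le_floorSlope hdeg hx (C.inv h)
    rw [C.len_inv] at h2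
    refine ⟨h2, ?_⟩
    have hp : 0 < x (C.len h) :=
      lt_of_le_of_ne (M.cone_apply_nonneg hx (C.len_nonneg h)) (Ne.symm h2)
    simp only [slopeDefect, C.len_inv, DualGraph.tgt_inv, DualGraph.src_inv] at h3 h4
    have : floorSlope A θ C hC x h = -floorSlope A θ C hC x (C.inv h) - 1 := by
      rw [floorSlope, Int.floor_eq_iff]
      push_cast at h3 h4 ⊢
      rw [le_div_iff₀ hp, div_lt_iff₀ hp]
      constructor <;> linarith
    omega
  have h1 := hsol.sum_le S fun h hh => (hfl h hh).1
  have h2 := hsol.sum_le Sᶜ fun h hh => by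
    have := (hfl (C.inv h) (by
      simp only [DualGraph.mem_inEdges, Finset.mem_compl, not_not] at hh ⊢
      simpa using hh.symm)).1
    rwa [C.len_inv] at this
  rw [DualGraph.sum_inEdges_compl] at h2
  have h3 := Finset.sum_add_sum_compl S (charge A θ C.toDualGraph hC)
  rw [sum_charge_eq_zero hC hdeg] at h3
  have h4 : ∑ h ∈ C.inEdges S, ((floorSlope A θ C hC x (C.inv h) : ℝ) + 1 / 2) =
      -∑ h ∈ C.inEdges S, ((floorSlope A θ C hC x h : ℝ) + 1 / 2) := by
    rw [← Finset.sum_neg_distrib]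
    refine Finset.sum_congr rfl fun h hh => ?_
    rw [(hfl h hh).2]
    push_cast
    ring
  change _ ≤ ∑ h ∈ C.inEdges S, ((floorSlope A θ C hC x (C.inv h) : ℝ) + 1 / 2) at h2
  change _ ≤ ∑ h ∈ C.inEdges S, ((floorSlope A θ C hC x h : ℝ) + 1 / 2) at h1
  refine hθ.sum_charge_ne (A := A) hC S ⟨C.leg 0, ?_⟩ (fun h => hv ?_)
    (∑ h ∈ C.inEdges S, floorSlope A θ C hC x h) ?_
  · simp only [hS, Finset.mem_filter, Finset.mem_univ, true_and]
    exact Relation.ReflTransGen.refl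
  · have : v ∈ S := h ▸ Finset.mem_univ v
    simpa only [hS, Finset.mem_filter, Finset.mem_univ, true_and] using this
  · have h5 : ∑ v ∈ S, charge A θ C.toDualGraph hC v =
        ∑ h ∈ C.inEdges S, ((floorSlope A θ C hC x h : ℝ) + 1 / 2) := by linarith
    rw [h5, Finset.sum_add_distrib, Finset.sum_const, DualGraph.card_inEdges]
    push_cast
    rw [nsmul_eq_mul]
    ring

/-- Near a point of the cone, the potential is given by elements of the monoid. -/
theorem exists_linear_pot {x₀ : M.gp →+ ℝ} (hx₀ : x₀ ∈ M.cone) :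
    ∃ c : C.V → M.gp, c (C.leg 0) = 0 ∧ ∀ (x : M.gp →+ ℝ) (b : C.V → ℝ), b (C.leg 0) = 0 →
      (∀ h, slopeDefect A θ C hC x₀ h (floorSlope A θ C hC x₀ h) = 0 →
        b (C.tgt h) - b (C.src h) = floorSlope A θ C hC x₀ h * x (C.len h)) →
      ∀ v, b v = x (c v) := by
  classical
  have hex : ∀ v, ∃ c : M.gp, ∀ (x : M.gp →+ ℝ) (b : C.V → ℝ), b (C.leg 0) = 0 →
      (∀ h, slopeDefect A θ C hC x₀ h (floorSlope A θ C hC x₀ h) = 0 →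
        b (C.tgt h) - b (C.src h) = floorSlope A θ C hC x₀ h * x (C.len h)) → b v = x c := by
    intro v
    -- Integrate along a path of edges with integral slope; integrality keeps the result in `M.gp`.
    induction connected_by_integral_slopes hθ hdeg hx₀ v with
    | refl => exact ⟨0, fun x b h0 _ => by rw [h0, map_zero]⟩
    | tail _ hstep ih =>
      obtain ⟨h, h1, rfl, rfl⟩ := hstep
      obtain ⟨c, hc⟩ := ih
      refine ⟨c + floorSlope A θ C hC x₀ h • C.len h, fun x b h0 hb => ?_⟩
      rw [map_add, map_zsmul, zsmul_eq_mul, ← hc x b h0 hb, ← hb h h1]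
      ring
  choose c hc using hex
  refine ⟨fun v => if v = C.leg 0 then 0 else c v, if_pos rfl, fun x b h0 hb v => ?_⟩
  dsimp only
  split_ifs with hv
  · rw [hv, h0, map_zero]
  · exact hc v x b h0 hb

end

end TropRub

/-! ### Linearity of the defining functions on the sign cones -/

namespace TropRub

variable {g n : ℕ} [NeZero n] {A : UniversalFunction g n ℤ} {θ : UniversalFunction g n ℝ}
  {M : ToricMonoid} {C : TropicalCurve M n} {hC : C.IsStable g} (hθ : θ.IsNondegenerate)
  (hdeg : ∑ v, θ.toFun C.toDualGraph hC v = ((∑ v, A.toFun C.toDualGraph hC v : ℤ) : ℝ))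

theorem slopeDefect_nonneg_iff {x : M.gp →+ ℝ} {h : C.D} {k : ℤ} :
    0 ≤ slopeDefect A θ C hC x h k ↔ k * x (C.len h) ≤
      realPot A θ C hC x (C.tgt h) - realPot A θ C hC x (C.src h) := sub_nonneg

theorem slopeDefect_nonpos_iff {x : M.gp →+ ℝ} {h : C.D} {k : ℤ} :
    slopeDefect A θ C hC x h k ≤ 0 ↔
      realPot A θ C hC x (C.tgt h) - realPot A θ C hC x (C.src h) ≤ k * x (C.len h) := sub_nonpos

section

variable (x₀ : M.gp →+ ℝ) (c : C.V → M.gp)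

open Classical in
variable (A θ hC) in
/-- The elements of the group which give the values of the potential near `x₀`. -/
noncomputable def linearValue : C.V ⊕ C.D × slopeRange A θ C hC → M.gp :=
  Sum.elim c fun i =>
    if 0 ≤ slopeDefect A θ C hC x₀ i.1 (i.2 + 1) then c (C.src i.1) else
    if slopeDefect A θ C hC x₀ i.1 i.2 ≤ 0 then c (C.tgt i.1) else
    c (C.src i.1) + (i.2 : ℤ) • ((((i.2 : ℤ) + 1) • C.len i.1) - (c (C.tgt i.1) - c (C.src i.1)))

variable (A θ hC) in
/-- The elements of the group which give the functions defining the fan near `x₀`. -/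
noncomputable def linearFunction (s : Finset M.gp) : s ⊕ (C.D × slopeRange A θ C hC) ⊕
    (C.D × slopeRange A θ C hC) ⊕ ((C.V ⊕ C.D × slopeRange A θ C hC) ×
      (C.V ⊕ C.D × slopeRange A θ C hC)) → M.gp :=
  Sum.elim (fun m => m) <|
    Sum.elim (fun i => c (C.tgt i.1) - c (C.src i.1) - (i.2 : ℤ) • C.len i.1) <|
    Sum.elim (fun i => c (C.tgt i.1) - c (C.src i.1) - ((i.2 : ℤ) + 1) • C.len i.1) fun i =>
      linearValue A θ hC x₀ c i.1 - linearValue A θ hC x₀ c i.2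

variable {x₀ c}

theorem slopeDefect_eq {x : M.gp →+ ℝ} (hc : ∀ v, realPot A θ C hC x v = x (c v)) (h : C.D)
    (k : ℤ) : slopeDefect A θ C hC x h k = x (c (C.tgt h) - c (C.src h) - k • C.len h) := by
  rw [slopeDefect, hc, hc, map_sub, map_sub, map_zsmul, zsmul_eq_mul]

/-- The signs of the two defects decide which branch of `breakValue` applies, and they degenerate
those at `x₀`; at a boundary the branches agree. -/
theorem realValue_eq {x : M.gp →+ ℝ} (hx : x ∈ M.cone)
    (hc : ∀ v, realPot A θ C hC x v = x (c v))
    (h1 : ∀ (h : C.D) (k : slopeRange A θ C hC),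
      SignCompat (slopeDefect A θ C hC x h k) (slopeDefect A θ C hC x₀ h k))
    (h2 : ∀ (h : C.D) (k : slopeRange A θ C hC),
      SignCompat (slopeDefect A θ C hC x h (k + 1)) (slopeDefect A θ C hC x₀ h (k + 1)))
    (i) : realValue A θ C hC x i = x (linearValue A θ hC x₀ c i) := by
  obtain v | ⟨h, k⟩ := i
  · exact hc v
  · have hl := M.cone_apply_nonneg hx (C.len_nonneg h)
    simp only [realValue, linearValue, Sum.elim_inr]
    split_ifs with h3 h4
    · have h5 := (h2 h k).1 h3
      rw [slopeDefect_nonneg_iff] at h5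
      push_cast at h5
      rw [breakValue_of_ge h5, hc]
    · have h5 := (h1 h k).2 h4
      rw [slopeDefect_nonpos_iff] at h5
      rw [breakValue_of_le hl h5, hc]
    · have h5 := (h2 h k).2 (not_le.1 h3).le
      have h6 := (h1 h k).1 (not_le.1 h4).le
      rw [slopeDefect_nonpos_iff] at h5
      rw [slopeDefect_nonneg_iff] at h6
      push_cast at h5
      rw [breakValue_of_mem h6 h5, hc, hc, map_add, map_zsmul, map_sub, map_zsmul, map_sub,
        zsmul_eq_mul, zsmul_eq_mul]
      push_cast
      ring

-- If the linear forms have compatible signs, then `x ∘ c` is a semistable potential at `x`: its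
-- slopes are at least the floors at `x₀`, and lengths vanishing at `x₀` also vanish at `x`.
-- Uniqueness identifies it with `realPot`. If the functions themselves have compatible signs, then
-- slopes integral at `x₀` stay equal to the same integers, and integration along these edges gives
-- the formula.
include hdeg hθ in
theorem fanFunction_linear {s : Finset M.gp}
    (hs : AddSubmonoid.closure (s : Set M.gp) = M.mon) (hx₀ : x₀ ∈ M.cone)
    (hc0 : c (C.leg 0) = 0) (hc : ∀ (x : M.gp →+ ℝ) (b : C.V → ℝ), b (C.leg 0) = 0 →
      (∀ h, slopeDefect A θ C hC x₀ h (floorSlope A θ C hC x₀ h) = 0 →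
        b (C.tgt h) - b (C.src h) = floorSlope A θ C hC x₀ h * x (C.len h)) →
      ∀ v, b v = x (c v)) {x : M.gp →+ ℝ} (hx : x ∈ M.cone)
    (hsign : (∀ j, SignCompat (x (linearFunction A θ hC x₀ c s j))
      (fanFunction A θ C hC s j x₀)) ∨
      ∀ j, SignCompat (fanFunction A θ C hC s j x) (fanFunction A θ C hC s j x₀)) :
    (∀ v, realPot A θ C hC x v = x (c v)) ∧
      ∀ j, fanFunction A θ C hC s j x = x (linearFunction A θ hC x₀ c s j) := by
  have hpot : ∀ v, realPot A θ C hC x v = x (c v) := by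
    rcases hsign with hsign | hsign
    · refine congrFun (realPot_eq hθ hdeg hx (b := fun v => x (c v)) (by
        rw [hc0, map_zero]) ⟨fun h h0 => ?_, fun S hS => ?_⟩)
      · have h1 := (hsign (Sum.inr (Sum.inl (h, ⟨_, floorSlope_mem hdeg hx₀ h⟩)))).1
          (floorSlope_le hdeg hx₀ h)
        have h2 := (hsign (Sum.inr (Sum.inr (Sum.inl (h, ⟨_, floorSlope_mem hdeg hx₀ h⟩))))).2
          (le_floorSlope hdeg hx₀ h)
        simp only [linearFunction, Sum.elim_inr, Sum.elim_inl] at h1 h2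
        rw [map_sub, map_sub, map_zsmul, h0, smul_zero] at h1 h2
        linarith
      · have hz : ∀ h ∈ C.inEdges S, x₀ (C.len h) ≠ 0 := fun h hh h0 => hS h hh
          (ToricMonoid.apply_eq_zero_of_generators hs hx₀ (fun m hm h0 =>
            (hsign (Sum.inl ⟨m, hm⟩)).eq_zero h0) (C.len_mem h) h0)
        refine ((realPot_spec hdeg hx₀).2.sum_le S hz).trans (Finset.sum_le_sum fun h hh => ?_)
        have h1 := (hsign (Sum.inr (Sum.inl (h, ⟨_, floorSlope_mem hdeg hx₀ h⟩)))).1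
          (floorSlope_le hdeg hx₀ h)
        simp only [linearFunction, Sum.elim_inr, Sum.elim_inl] at h1
        rw [map_sub, map_sub, map_zsmul, zsmul_eq_mul, sub_nonneg] at h1
        have hp : 0 < x (C.len h) :=
          lt_of_le_of_ne (M.cone_apply_nonneg hx (C.len_nonneg h)) (Ne.symm (hS h hh))
        have h2 : floorSlope A θ C hC x₀ h ≤ ⌊(x (c (C.tgt h)) - x (c (C.src h))) / x (C.len h)⌋ := by
          rw [Int.le_floor, le_div_iff₀ hp]
          exact h1
        have h3 := (Int.cast_le (R := ℝ)).2 h2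
        change (floorSlope A θ C hC x₀ h : ℝ) + 1 / 2 ≤ _
        linarith
    · refine hc x _ (realPot_spec hdeg hx).1 fun h h0 => ?_
      have h1 := (hsign (Sum.inr (Sum.inl (h, ⟨_, floorSlope_mem hdeg hx₀ h⟩)))).eq_zero h0
      exact sub_eq_zero.1 h1
  refine ⟨hpot, ?_⟩
  have e1 : ∀ (h : C.D) (k : slopeRange A θ C hC),
      SignCompat (slopeDefect A θ C hC x h k) (slopeDefect A θ C hC x₀ h k) := by
    intro h k
    rcases hsign with hsign | hsign
    · rw [slopeDefect_eq hpot]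
      exact hsign (Sum.inr (Sum.inl (h, k)))
    · exact hsign (Sum.inr (Sum.inl (h, k)))
  have e2 : ∀ (h : C.D) (k : slopeRange A θ C hC),
      SignCompat (slopeDefect A θ C hC x h (k + 1)) (slopeDefect A θ C hC x₀ h (k + 1)) := by
    intro h k
    rcases hsign with hsign | hsign
    · rw [slopeDefect_eq hpot]
      exact hsign (Sum.inr (Sum.inr (Sum.inl (h, k))))
    · exact hsign (Sum.inr (Sum.inr (Sum.inl (h, k))))
  rintro (m | ⟨h, k⟩ | ⟨h, k⟩ | ⟨i, j⟩)
  · rfl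
  · exact slopeDefect_eq hpot h k
  · exact slopeDefect_eq hpot h (k + 1)
  · simp only [fanFunction, linearFunction, Sum.elim_inr]
    rw [realValue_eq hx hpot e1 e2, realValue_eq hx hpot e1 e2, map_sub]

end

/-! ### Sign cones and the existence of models -/

section Restriction

variable {N : ToricMonoid} {φ : M ⟶ N} {C₂ : TropicalCurve N n} {h₂ : C₂.IsStable g}
  (f : TropicalHom φ C C₂)

-- Pulled back to `N`, each function is evaluation at an element of `N.gp` which the model shows to
-- be comparable with zero. Its sign is constant on the cone, and at the interior point `x₀` it
-- vanishes only if the element is zero.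
include hθ hdeg f in
theorem signCompat_of_model (m : Model A θ C₂ h₂) (s : Finset M.gp) (hs : ∀ m ∈ s, m ∈ M.mon)
    {x₀ x : N.gp →+ ℝ} (hx₀ : x₀ ∈ N.cone) (hpos : ∀ m, 0 ≤ m → m ≠ 0 → 0 < x₀ m)
    (hx : x ∈ N.cone) (j) : SignCompat (fanFunction A θ C hC s j (x.comp φ.toFun))
      (fanFunction A θ C hC s j (x₀.comp φ.toFun)) := by
  have hpot : ∀ x ∈ N.cone, ∀ v, realPot A θ C hC (x.comp φ.toFun) v = x (m.pot (f.onV v)) := by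
    intro x hx
    refine congrFun (realPot_eq hθ hdeg (fun m hm => hx _ (φ.map_mem m hm)) ?_
      (m.isSolution.isRealSolution f hx))
    rw [f.onV_leg, m.isSolution.leg, map_zero]
  suffices ∃ y : N.gp, (0 ≤ y ∨ y ≤ 0) ∧ ∀ x ∈ N.cone,
      fanFunction A θ C hC s j (x.comp φ.toFun) = x y by
    obtain ⟨y, hy, he⟩ := this
    rw [he x hx, he x₀ hx₀]
    have hz : x₀ y = 0 → y = 0 := by
      intro h0
      by_contra hne
      rcases hy with hy | hy
      · exact (hpos y hy hne).ne' h0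
      · have := hpos (-y) (neg_nonneg.2 hy) (neg_ne_zero.2 hne)
        rw [map_neg, h0, neg_zero] at this
        exact lt_irrefl _ this
    rcases hy with hy | hy
    · have h1 := N.cone_apply_nonneg hx hy
      have h2 := N.cone_apply_nonneg hx₀ hy
      exact ⟨fun _ => h1, fun h => by rw [hz (le_antisymm h h2), map_zero]⟩
    · have h1 := N.cone_apply_nonneg hx (neg_nonneg.2 hy)
      have h2 := N.cone_apply_nonneg hx₀ (neg_nonneg.2 hy)
      rw [map_neg, neg_nonneg] at h1 h2
      exact ⟨fun h => by rw [hz (le_antisymm h2 h), map_zero], fun _ => h1⟩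
  have hdefect : ∀ (h : C.D) (k : ℤ), ∃ y : N.gp, (0 ≤ y ∨ y ≤ 0) ∧ ∀ x ∈ N.cone,
      slopeDefect A θ C hC (x.comp φ.toFun) h k = x y := by
    intro h k
    by_cases hh : h ∈ Set.range f.onD
    · obtain ⟨e, rfl⟩ := hh
      refine ⟨m.pot (C₂.tgt e) - m.pot (C₂.src e) - k • C₂.len e, ?_, fun x hx => ?_⟩
      · rcases le_or_gt k (m.slope e) with hk | hk
        · left
          exact sub_nonneg.2 ((ToricMonoid.zsmul_le_zsmul_of_le hk (C₂.len_nonneg e)).trans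
            (m.isSolution.smul_le e))
        · right
          exact sub_nonpos.2 ((m.isSolution.le_smul e).trans
            (ToricMonoid.zsmul_le_zsmul_of_le hk (C₂.len_nonneg e)))
      · rw [slopeDefect, hpot x hx, hpot x hx, f.onV_src, f.onV_tgt, AddMonoidHom.comp_apply,
          f.len_onD, map_sub, map_sub, map_zsmul, zsmul_eq_mul]
    · refine ⟨0, Or.inl le_rfl, fun x hx => ?_⟩
      rw [slopeDefect, hpot x hx, hpot x hx, f.onV_contracted hh, AddMonoidHom.comp_apply,
        f.len_contracted h hh]
      simp
  have hvalue : ∀ i, ∃ i', ∀ x ∈ N.cone,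
      realValue A θ C hC (x.comp φ.toFun) i = x (potentialValue C₂ m.pot m.slope i') := by
    rintro (v | ⟨h, k⟩)
    · exact ⟨Sum.inl (f.onV v), fun x hx => hpot x hx v⟩
    · by_cases hh : h ∈ Set.range f.onD
      · obtain ⟨e, rfl⟩ := hh
        have hlow : ∀ x ∈ N.cone, m.slope e * x (C₂.len e) ≤
            x (m.pot (C₂.tgt e)) - x (m.pot (C₂.src e)) := fun x hx => by
          have := N.cone_apply_mono hx (m.isSolution.smul_le e)
          rwa [map_zsmul, map_sub, zsmul_eq_mul] at this
        have hhigh : ∀ x ∈ N.cone, x (m.pot (C₂.tgt e)) - x (m.pot (C₂.src e)) ≤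
            (m.slope e + 1) * x (C₂.len e) := fun x hx => by
          have := N.cone_apply_mono hx (m.isSolution.le_smul e)
          rw [map_zsmul, map_sub, zsmul_eq_mul] at this
          exact_mod_cast this
        have hval : ∀ x ∈ N.cone, realValue A θ C hC (x.comp φ.toFun) (Sum.inr (f.onD e, k)) =
            breakValue k (x (m.pot (C₂.src e))) (x (m.pot (C₂.tgt e))) (x (C₂.len e)) := by
          intro x hx
          simp only [realValue, Sum.elim_inr]
          rw [hpot x hx, hpot x hx, f.onV_src, f.onV_tgt, AddMonoidHom.comp_apply, f.len_onD]
        -- For `k` other than the slope of the model, the break value is clamped to an endpoint;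
        -- hence only values of the model occur and their total order suffices.
        rcases lt_trichotomy (k : ℤ) (m.slope e) with hk | hk | hk
        · refine ⟨Sum.inl (C₂.src e), fun x hx => ?_⟩
          rw [hval x hx, breakValue_of_ge]
          · rfl
          · refine le_trans (mul_le_mul_of_nonneg_right ?_
              (N.cone_apply_nonneg hx (C₂.len_nonneg e))) (hlow x hx)
            exact_mod_cast hk
        · refine ⟨Sum.inr e, fun x hx => ?_⟩
          rw [hval x hx, hk, breakValue_of_mem (hlow x hx) (hhigh x hx)]
          simp only [potentialValue, Sum.elim_inr, breakPos]
          rw [map_add, map_zsmul, map_sub, map_zsmul, map_sub, zsmul_eq_mul, zsmul_eq_mul]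
          push_cast
          rfl
        · refine ⟨Sum.inl (C₂.tgt e), fun x hx => ?_⟩
          have hl := N.cone_apply_nonneg hx (C₂.len_nonneg e)
          rw [hval x hx, breakValue_of_le hl]
          · rfl
          · refine (hhigh x hx).trans (mul_le_mul_of_nonneg_right ?_ hl)
            exact_mod_cast hk
      · refine ⟨Sum.inl (f.onV (C.src h)), fun x hx => ?_⟩
        simp only [realValue, Sum.elim_inr]
        rw [hpot x hx, hpot x hx, f.onV_contracted hh, AddMonoidHom.comp_apply,
          f.len_contracted h hh, breakValue_of_ge (by simp)]
        rfl
  obtain m' | ⟨h, k⟩ | ⟨h, k⟩ | ⟨i, j⟩ := j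
  · exact ⟨φ.toFun m', Or.inl (N.nonneg_iff_mem.2 (φ.map_mem _ (hs _ m'.2))), fun x _ => rfl⟩
  · exact hdefect h k
  · exact hdefect h (k + 1)
  · obtain ⟨i', hi⟩ := hvalue i
    obtain ⟨j', hj⟩ := hvalue j
    refine ⟨potentialValue C₂ m.pot m.slope i' - potentialValue C₂ m.pot m.slope j', ?_,
      fun x hx => ?_⟩
    · rw [sub_nonneg, sub_nonpos]
      exact (m.total_potentialValue i' j').symm
    · simp only [fanFunction, Sum.elim_inr]
      rw [hi x hx, hj x hx, map_sub]

-- On the image of the cone of `N` the potential is given by elements `c v` of `M.gp`. Their images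
-- in `N.gp` descend to `C₂` and, with the floors of the slopes at `x₀`, form a solution; the
-- constant signs of the differences of values provide the total order that a model requires.
include hθ hdeg f in
theorem nonempty_model_of_signCompat
    (hdeg₂ : ∑ v, θ.toFun C₂.toDualGraph h₂ v = ((∑ v, A.toFun C₂.toDualGraph h₂ v : ℤ) : ℝ))
    {s : Finset M.gp} (hs : AddSubmonoid.closure (s : Set M.gp) = M.mon) {x₀ : M.gp →+ ℝ}
    (hx₀ : x₀ ∈ M.cone)
    (hsign : ∀ x ∈ N.cone, ∀ j, SignCompat (fanFunction A θ C hC s j (x.comp φ.toFun))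
      (fanFunction A θ C hC s j x₀)) : Nonempty (Model A θ C₂ h₂) := by
  classical
  obtain ⟨c, hc0, hc⟩ := exists_linear_pot hθ hdeg hx₀
  have hcone : ∀ x ∈ N.cone, x.comp φ.toFun ∈ M.cone := fun x hx m hm => hx _ (φ.map_mem m hm)
  have hpot : ∀ x ∈ N.cone, ∀ v, realPot A θ C hC (x.comp φ.toFun) v = x (φ.toFun (c v)) :=
    fun x hx => (fanFunction_linear hθ hdeg hs hx₀ hc0 hc (hcone x hx) (Or.inr (hsign x hx))).1
  have hwell : ∀ v w, f.onV v = f.onV w → φ.toFun (c v) = φ.toFun (c w) := by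
    intro v w hvw
    refine N.eq_of_forall_cone fun x hx => ?_
    have := (f.onV_eq_iff v w).1 hvw
    clear hvw
    induction this with
    | refl => rfl
    | tail _ h ih =>
      obtain ⟨h, hh, rfl, rfl⟩ := h
      rw [ih, ← hpot x hx, ← hpot x hx]
      refine ((realPot_spec hdeg (hcone x hx)).2.eq_of_len_eq_zero h ?_).symm
      change x (φ.toFun (C.len h)) = 0
      rw [f.len_contracted h hh, map_zero]
  set a : C₂.V → N.gp := fun w => φ.toFun (c (Function.surjInv f.onV_surjective w)) with ha
  have ha' : ∀ v, a (f.onV v) = φ.toFun (c v) :=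
    fun v => hwell _ _ (Function.surjInv_eq f.onV_surjective _)
  have hxa : ∀ x ∈ N.cone, ∀ v, x (a (f.onV v)) = realPot A θ C hC (x.comp φ.toFun) v :=
    fun x hx v => by rw [ha', hpot x hx]
  have hsrc : ∀ x ∈ N.cone, ∀ e, x (a (C₂.src e)) =
      realPot A θ C hC (x.comp φ.toFun) (C.src (f.onD e)) := fun x hx e => by
    rw [← f.onV_src, hxa x hx]
  have htgt : ∀ x ∈ N.cone, ∀ e, x (a (C₂.tgt e)) =
      realPot A θ C hC (x.comp φ.toFun) (C.tgt (f.onD e)) := fun x hx e => by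
    rw [← f.onV_tgt, hxa x hx]
  have hlen : ∀ (x : N.gp →+ ℝ) e, x (C₂.len e) = (x.comp φ.toFun) (C.len (f.onD e)) := fun x e => by
    rw [AddMonoidHom.comp_apply, f.len_onD]
  have hlow : ∀ x ∈ N.cone, ∀ h,
      0 ≤ slopeDefect A θ C hC (x.comp φ.toFun) h (floorSlope A θ C hC x₀ h) := fun x hx h =>
    (hsign x hx (Sum.inr (Sum.inl (h, ⟨_, floorSlope_mem hdeg hx₀ h⟩)))).1
      (floorSlope_le hdeg hx₀ h)
  have hhigh : ∀ x ∈ N.cone, ∀ h,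
      slopeDefect A θ C hC (x.comp φ.toFun) h (floorSlope A θ C hC x₀ h + 1) ≤ 0 := fun x hx h =>
    (hsign x hx (Sum.inr (Sum.inr (Sum.inl (h, ⟨_, floorSlope_mem hdeg hx₀ h⟩))))).2
      (le_floorSlope hdeg hx₀ h)
  have hsol : IsSolution A θ C₂ h₂ a fun e => floorSlope A θ C hC x₀ (f.onD e) := by
    refine ⟨?_, fun e => N.le_of_forall_cone fun x hx => ?_,
      fun e => N.le_of_forall_cone fun x hx => ?_, fun S => ?_⟩
    · rw [← f.onV_leg, ha', hc0, map_zero]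
    · have := slopeDefect_nonneg_iff.1 (hlow x hx (f.onD e))
      rw [map_zsmul, zsmul_eq_mul, map_sub, hsrc x hx, htgt x hx, hlen]
      exact this
    · have := slopeDefect_nonpos_iff.1 (hhigh x hx (f.onD e))
      rw [map_zsmul, zsmul_eq_mul, map_sub, hsrc x hx, htgt x hx, hlen]
      exact this
    · have hmem : ∀ v, v ∈ Finset.univ.filter (fun v => f.onV v ∈ S) ↔ f.onV v ∈ S := by simp
      rw [← sum_charge_preimage hC h₂ f.toContraction _ S hmem,
        ← f.sum_inEdges_preimage _ S hmem
          (fun h => (floorSlope A θ C hC x₀ h : ℝ) + 1 / 2)]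
      refine (realPot_spec hdeg hx₀).2.sum_le _ fun h hh h0 => ?_
      simp only [DualGraph.mem_inEdges, Finset.mem_filter, Finset.mem_univ, true_and] at hh
      obtain ⟨e, rfl⟩ := f.mem_range_of_onV_ne (h := h) fun e => hh.1 (e ▸ hh.2)
      -- A length vanishing at `x₀` vanishes on the whole image of the cone of `N`, but an edge of
      -- `C₂` has positive length at an interior point.
      obtain ⟨x, hx, hxpos⟩ := N.exists_mem_cone_pos
      have h1 := ToricMonoid.apply_eq_zero_of_generators hs hx₀ (x := x.comp φ.toFun)
        (fun m hm h0 => (hsign x hx (Sum.inl ⟨m, hm⟩)).eq_zero h0) (C.len_mem _) h0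
      rw [← hlen] at h1
      exact (hxpos _ (C₂.len_nonneg e) (C₂.len_ne_zero e)).ne' h1
  have hvalue : ∀ i, ∃ i', ∀ x ∈ N.cone,
      x (potentialValue C₂ a (fun e => floorSlope A θ C hC x₀ (f.onD e)) i) =
        realValue A θ C hC (x.comp φ.toFun) i' := by
    rintro (w | e)
    · obtain ⟨v, rfl⟩ := f.onV_surjective w
      exact ⟨Sum.inl v, fun x hx => hxa x hx v⟩
    · refine ⟨Sum.inr (f.onD e, ⟨_, floorSlope_mem hdeg hx₀ (f.onD e)⟩), fun x hx => ?_⟩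
      have h1 := slopeDefect_nonneg_iff.1 (hlow x hx (f.onD e))
      have h2 := slopeDefect_nonpos_iff.1 (hhigh x hx (f.onD e))
      push_cast at h2
      simp only [realValue, potentialValue, Sum.elim_inr, breakPos]
      rw [breakValue_of_mem h1 h2, map_add, map_zsmul, map_sub, map_zsmul, map_sub, zsmul_eq_mul,
        zsmul_eq_mul, hsrc x hx, htgt x hx, hlen]
      push_cast
      rfl
  obtain ⟨m, -⟩ := hsol.exists_model hdeg₂ fun i j => by
    obtain ⟨i', hi⟩ := hvalue i
    obtain ⟨j', hj⟩ := hvalue j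
    rcases le_total 0 (fanFunction A θ C hC s (Sum.inr (Sum.inr (Sum.inr (i', j')))) x₀)
      with h | h
    · refine Or.inr (N.le_of_forall_cone fun x hx => ?_)
      rw [hi x hx, hj x hx, ← sub_nonneg]
      exact (hsign x hx (Sum.inr (Sum.inr (Sum.inr (i', j'))))).1 h
    · refine Or.inl (N.le_of_forall_cone fun x hx => ?_)
      rw [hi x hx, hj x hx, ← sub_nonpos]
      exact (hsign x hx (Sum.inr (Sum.inr (Sum.inr (i', j'))))).2 h
  exact ⟨m⟩

end Restriction

/-- The locus of tropical curves with a model is a subdivision. -/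
theorem exists_fan (hθ : θ.IsNondegenerate) (hdeg : ∀ (Γ : DualGraph n) (hΓ : Γ.IsStable g),
      ∑ v, θ.toFun Γ hΓ v = ((∑ v, A.toFun Γ hΓ v : ℤ) : ℝ)) (y : Mbar g n) :
    ∃ Δ : ConeSubdivision y.M, ∀ (z : Mbar g n) (f : y ⟶ z),
      Nonempty (Model A θ z.C z.stable) ↔
        ∃ τ ∈ Δ.cones, ∀ x ∈ z.M.cone, x.comp f.φ.toFun ∈ τ := by
  obtain ⟨s, hs⟩ := y.M.fg
  have hs' : ∀ m ∈ s, m ∈ y.M.mon := fun m hm => hs ▸ AddSubmonoid.subset_closure hm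
  obtain ⟨Δ, hΔ⟩ := ToricMonoid.exists_coneSubdivision (f := fanFunction A θ y.C y.stable s)
    (fun x₀ hx₀ => by
      obtain ⟨c, hc0, hc⟩ := exists_linear_pot hθ (hdeg _ _) hx₀
      exact ⟨_, fun x hx hsign =>
        (fanFunction_linear hθ (hdeg _ _) hs hx₀ hc0 hc hx hsign).2⟩)
    (fun x₀ hx₀ x hx m hm h0 => ToricMonoid.apply_eq_zero_of_generators hs hx₀
      (fun m hm h0 => (hx.2 (Sum.inl ⟨m, hm⟩)).eq_zero h0) hm h0)
  refine ⟨Δ, fun z f => ⟨?_, ?_⟩⟩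
  · rintro ⟨m⟩
    obtain ⟨x₀, hx₀, hpos⟩ := z.M.exists_mem_cone_pos
    -- The cone of the fan is the sign cone of the image of an interior point.
    refine ⟨_, (hΔ _).2 ⟨x₀.comp f.φ.toFun, fun m hm => hx₀ _ (f.φ.map_mem m hm), rfl⟩,
      fun x hx => ⟨fun m hm => hx _ (f.φ.map_mem m hm), ?_⟩⟩
    exact signCompat_of_model hθ (hdeg _ _) f.f m s hs' hx₀ hpos hx
  · rintro ⟨τ, hτ, h⟩
    obtain ⟨x₀, hx₀, rfl⟩ := (hΔ τ).1 hτ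
    exact nonempty_model_of_signCompat hθ (hdeg _ _) f.f (hdeg _ _) hs hx₀
      fun x hx => (h x hx).2

end TropRub

/-! ### The factorization through the stack of curves with a totally ordered model -/

theorem mainTheorem11 {g n : ℕ} [NeZero n] (A : TropRub.UniversalFunction g n ℤ)
    (θ : TropRub.UniversalFunction g n ℝ) (hθ : θ.IsNondegenerate)
    (hdeg : ∀ (Γ : TropRub.DualGraph n) (hΓ : Γ.IsStable g),
      ∑ v, θ.toFun Γ hΓ v = ((∑ v, A.toFun Γ hΓ v : ℤ) : ℝ)) :
    ∃ (T : Type 1) (_ : CategoryTheory.Category.{0} T)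
      (F : CategoryTheory.Functor (TropRub.Rub A θ) T)
      (G : CategoryTheory.Functor T (TropRub.Mbar g n)),
      F.comp G = TropRub.Rub.stabilization A θ ∧
      TropRub.IsFiniteIndexInclusion (G.comp (TropRub.Mbar.base g n)) F ∧
      TropRub.IsSubdivision (TropRub.Mbar.base g n) G :=
  ⟨(TropRub.HasModel A θ).FullSubcategory, inferInstance, TropRub.toHasModel A θ,
    (TropRub.HasModel A θ).ι, rfl, TropRub.isFiniteIndexInclusion_toHasModel hθ hdeg,
    TropRub.isSubdivision_ι (TropRub.exists_fan hθ hdeg)⟩
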